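/- Let $\mathcal G$ be a second countable locally compact Hausdorff groupoid with base space $X$, range and source maps $r,s$, and Haar system $\lambda=(\lambda^x)_{x\in X}$ (Radon measures $\lambda^x$ with support $\mathcal G^x=r^{-1}(x)$, such that $x\mapsto\int f\,d\lambda^x$ is continuous for $f\in C_c(\mathcal G)$ and $\gamma_*\lambda^{s(\gamma)}=\lambda^{r(\gamma)}$ for all $\gamma$). Its reduced $C^*$-algebra $C^*_r(\mathcal G,\lambda)$ is the closure of $C_c(\mathcal G)$, acting by $f\cdot\phi(\gamma)=\int f(\gamma')\phi(\gamma'^{-1}\gamma)\,d\lambda^{r(\gamma)}(\gamma')$, in the $C^*$-algebra of adjointable operators of the Hilbert $C_0(X)$-module $L^2(\mathcal G,\lambda)$, the completion of $C_c(\mathcal G)$ for $\langle\phi,\phi'\rangle(x)=\int\overline{\phi(\gamma^{-1})}\,\phi'(\gamma^{-1})\,d\lambda^x(\gamma)$. Let $\alpha$ be an automorphism of $\mathcal G$, with induced homeomorphism $\alpha_X$ of $X$, that preserves $\lambda$ with density $\rho_\alpha$: $\rho_\alpha:\mathcal G\to(0,\infty)$ is continuous and $\alpha_*\lambda^x=\rho_\alpha\,\lambda^{\alpha_X(x)}$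 for all $x\in X$. Put $\rho'_\alpha(\gamma)=\rho_\alpha(\gamma^{-1})$ and assume $\rho_\alpha\circ\alpha=\rho_\alpha$. Let $\mathcal G_\alpha=(\mathcal G\times\mathbb R)/\big((\gamma,t)\sim(\alpha(\gamma),t-1)\big)$ be the suspension groupoid, with base $X_\alpha=(X\times\mathbb R)/\big((x,t)\sim(\alpha_X(x),t-1)\big)$ and structure maps $r([\gamma,t])=[r(\gamma),t]$, $s([\gamma,t])=[s(\gamma),t]$, $[\gamma,t][\gamma',t]=[\gamma\gamma',t]$, $[\gamma,t]^{-1}=[\gamma^{-1},t]$. Then: 1. $\mathcal G_\alpha$ has a Haar system $\lambda_\alpha$ given by $\lambda_\alpha^{[x,t]}(f)=\int\rho_\alpha(\gamma)^{-t}f([\gamma,t])\,d\lambda^x(\gamma)$. 2. There is a unique automorphism $\tilde\alpha$ of $C^*_r(\mathcal G,\lambda)$ with $\tilde\alpha(f)=(\rho'_\alpha\rho_\alpha)^{1/2}\,f\circ\alpha^{-1}$ for all $f\in C_c(\mathcal G)$. 3. There is a unique isomorphism of $C^*$-algebras $\Lambda_\alpha$ from $C^*_r(\mathcal G_\alpha,\lambda_\alpha)$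 onto the mapping torus $\{h\in C([0,1],C^*_r(\mathcal G,\lambda)) : \tilde\alpha(h(1))=h(0)\}$ such that $\Lambda_\alpha(f)=\hat f$ for all $f\in C_c(\mathcal G_\alpha)$, where $\hat f(t)\in C_c(\mathcal G)$ is $\hat f(t)(\gamma)=\rho_\alpha(\gamma)^{-t/2}\rho'_\alpha(\gamma)^{-t/2}f([\gamma,t])$. 4. For $s\in\mathbb R$ the automorphism $\theta_s:[\gamma,t]\mapsto[\gamma,t+s]$ of $\mathcal G_\alpha$ preserves $\lambda_\alpha$ with density $\rho_{\theta_s}([\gamma,t])=\rho_\alpha(\gamma)^s$. The automorphisms $\tilde\theta_s$ of $C^*_r(\mathcal G_\alpha,\lambda_\alpha)$ given on $C_c(\mathcal G_\alpha)$ by $\tilde\theta_s(f)=(\rho'_{\theta_s}\rho_{\theta_s})^{1/2}f\circ\theta_s^{-1}$, with $\rho'_{\theta_s}(\eta)=\rho_{\theta_s}(\eta^{-1})$, exist and form a strongly continuous action of $\mathbb R$, and $\Lambda_\alpha$ is $\mathbb R$-equivariant for this action and the translation action $(s\cdot h)(t)=h(t-s)$ on the mapping torus, whose elements $h$ are extended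 to $\mathbb R$ by $h(t)=\tilde\alpha(h(t+1))$. -/

import Mathlib

open MeasureTheory Filter Topology
open scoped ENNReal CompactlySupported ComplexConjugate

noncomputable section


/-- A topological groupoid with space of arrows `G` and base space `X`.  The product `mul g h` is
only meaningful when `s g = r h`; its value on the other pairs is irrelevant.  The base is embedded
in `G` by `unit`. -/
structure TopGroupoid (G X : Type*) [TopologicalSpace G] [TopologicalSpace X] where
  r : G → X
  s : G → X
  unit : X → G
  inv : G → G
  mul : G → G → G
  r_unit : ∀ x, r (unit x) = x
  s_unit : ∀ x, s (unit x) = x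
  r_inv : ∀ g, r (inv g) = s g
  s_inv : ∀ g, s (inv g) = r g
  r_mul : ∀ g h, s g = r h → r (mul g h) = r g
  s_mul : ∀ g h, s g = r h → s (mul g h) = s h
  mul_assoc : ∀ g h k, s g = r h → s h = r k → mul (mul g h) k = mul g (mul h k)
  unit_mul : ∀ g, mul (unit (r g)) g = g
  mul_unit : ∀ g, mul g (unit (s g)) = g
  inv_mul : ∀ g, mul (inv g) g = unit (s g)
  mul_inv : ∀ g, mul g (inv g) = unit (r g)
  continuous_r : Continuous r
  continuous_s : Continuous s
  continuous_unit : Continuous unit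
  continuous_inv : Continuous inv
  continuousOn_mul : ContinuousOn (fun p : G × G => mul p.1 p.2) {p | s p.1 = r p.2}

namespace TopGroupoid

variable {G X : Type*} [TopologicalSpace G] [TopologicalSpace X]

/-- An automorphism of a topological groupoid, together with the homeomorphism of the base that it
induces. -/
structure Aut (𝒢 : TopGroupoid G X) where
  arrow : G ≃ₜ G
  base : X ≃ₜ X
  r_arrow : ∀ g, 𝒢.r (arrow g) = base (𝒢.r g)
  s_arrow : ∀ g, 𝒢.s (arrow g) = base (𝒢.s g)
  arrow_mul : ∀ g h, 𝒢.s g = 𝒢.r h → arrow (𝒢.mul g h) = 𝒢.mul (arrow g) (arrow h)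

variable (𝒢 : TopGroupoid G X)

theorem mul_inv_cancel_right {g h : G} (hgh : 𝒢.s g = 𝒢.r h) :
    𝒢.mul (𝒢.mul g h) (𝒢.inv h) = g := by
  rw [𝒢.mul_assoc g h _ hgh (𝒢.r_inv h).symm, 𝒢.mul_inv, ← hgh, 𝒢.mul_unit]

theorem inv_mul_cancel_left {g h : G} (hgh : 𝒢.s g = 𝒢.r h) :
    𝒢.mul (𝒢.inv g) (𝒢.mul g h) = h := by
  rw [← 𝒢.mul_assoc _ g h (𝒢.s_inv g) hgh, 𝒢.inv_mul, hgh, 𝒢.unit_mul]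

theorem inv_eq_of_mul {g h : G} (hgh : 𝒢.s g = 𝒢.r h) (e : 𝒢.mul g h = 𝒢.unit (𝒢.r g)) :
    𝒢.inv g = h := by
  have := 𝒢.inv_mul_cancel_left hgh
  rw [e, ← 𝒢.s_inv g, 𝒢.mul_unit] at this
  exact this

theorem inv_inv (g : G) : 𝒢.inv (𝒢.inv g) = g :=
  𝒢.inv_eq_of_mul (𝒢.s_inv g) (by rw [𝒢.inv_mul, 𝒢.r_inv])

theorem inv_mul_rev {g h : G} (hgh : 𝒢.s g = 𝒢.r h) :
    𝒢.inv (𝒢.mul g h) = 𝒢.mul (𝒢.inv h) (𝒢.inv g) := by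
  have h1 : 𝒢.s (𝒢.inv h) = 𝒢.r (𝒢.inv g) := by rw [𝒢.s_inv, 𝒢.r_inv, hgh]
  have h2 : 𝒢.s (𝒢.mul g h) = 𝒢.r (𝒢.inv h) := by rw [𝒢.s_mul g h hgh, 𝒢.r_inv]
  refine 𝒢.inv_eq_of_mul ?_ ?_
  · rw [𝒢.r_mul _ _ h1, h2]
  · rw [← 𝒢.mul_assoc _ _ _ h2 h1, 𝒢.mul_inv_cancel_right hgh, 𝒢.mul_inv, 𝒢.r_mul g h hgh]

/-- The inversion as a homeomorphism. -/
def invHomeo : G ≃ₜ G where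
  toFun := 𝒢.inv
  invFun := 𝒢.inv
  left_inv := 𝒢.inv_inv
  right_inv := 𝒢.inv_inv
  continuous_toFun := 𝒢.continuous_inv
  continuous_invFun := 𝒢.continuous_inv

theorem t2_base (𝒢 : TopGroupoid G X) [T2Space G] : T2Space X :=
  T2Space.of_injective_continuous (Function.LeftInverse.injective 𝒢.r_unit) 𝒢.continuous_unit

/-- A Haar system: Radon measures `meas x` with support the range fibre over `x`, depending
continuously on `x`, and invariant under left translations. -/
structure HaarSystem [MeasurableSpace G] (𝒢 : TopGroupoid G X) where
  meas : X → Measure G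
  finite_on_compacts : ∀ x, IsFiniteMeasureOnCompacts (meas x)
  support_eq : ∀ x, (meas x).support = {g | 𝒢.r g = x}
  continuous_integral : ∀ f : C_c(G, ℂ), Continuous fun x => ∫ g, f g ∂(meas x)
  map_mul_left : ∀ g, (meas (𝒢.s g)).map (𝒢.mul g) = meas (𝒢.r g)

attribute [instance] HaarSystem.finite_on_compacts

variable {𝒢}
variable [T2Space G] [LocallyCompactSpace G] [SecondCountableTopology G]
  [MeasurableSpace G] [BorelSpace G]

namespace HaarSystem

/-- The measure `λ_x`, the image of `λ^x` under inversion; it lives on the source fibre. -/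
def fibre (lam : 𝒢.HaarSystem) (x : X) : Measure G := (lam.meas x).map 𝒢.inv

instance (lam : 𝒢.HaarSystem) (x : X) : IsFiniteMeasureOnCompacts (lam.fibre x) := by
  refine ⟨fun K hK => ?_⟩
  rw [fibre, Measure.map_apply 𝒢.continuous_inv.measurable hK.measurableSet]
  exact (𝒢.invHomeo.isCompact_preimage.2 hK).measure_lt_top

variable (lam : 𝒢.HaarSystem)

theorem ae_r (x : X) : ∀ᵐ g ∂(lam.meas x), 𝒢.r g = x := by
  have := Measure.support_mem_ae (μ := lam.meas x)
  rw [lam.support_eq] at this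
  exact this

theorem ae_s (x : X) : ∀ᵐ g ∂(lam.fibre x), 𝒢.s g = x := by
  have := 𝒢.t2_base
  rw [fibre, ae_map_iff 𝒢.continuous_inv.aemeasurable]
  · filter_upwards [lam.ae_r x] with g hg
    rw [𝒢.s_inv, hg]
  · exact (isClosed_singleton.preimage 𝒢.continuous_s).measurableSet

theorem integrable_meas (f : C_c(G, ℂ)) (x : X) : Integrable f (lam.meas x) :=
  f.continuous.integrable_of_hasCompactSupport f.hasCompactSupport

theorem integral_fibre {F : G → ℂ} (hF : Continuous F) (x : X) :
    ∫ g, F g ∂(lam.fibre x) = ∫ g, F (𝒢.inv g) ∂(lam.meas x) := by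
  rw [fibre, integral_map 𝒢.continuous_inv.aemeasurable hF.aestronglyMeasurable]

theorem memLp_fibre (f : C_c(G, ℂ)) (x : X) : MemLp f 2 (lam.fibre x) :=
  f.continuous.memLp_of_hasCompactSupport f.hasCompactSupport

/-- The class in `L²(G_x, λ_x)` of a function with compact support. -/
def toL2 (f : C_c(G, ℂ)) (x : X) : Lp ℂ 2 (lam.fibre x) := (lam.memLp_fibre f x).toLp f

theorem bounded_integral (f : C_c(G, ℂ)) : ∃ C : ℝ, ∀ x, ‖∫ g, f g ∂(lam.meas x)‖ ≤ C := by
  have := 𝒢.t2_base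
  have hc : HasCompactSupport fun x => ∫ g, f g ∂(lam.meas x) := by
    refine HasCompactSupport.intro (f.hasCompactSupport.image 𝒢.continuous_r) fun x hx => ?_
    refine integral_eq_zero_of_ae ?_
    filter_upwards [lam.ae_r x] with g hg
    by_contra h
    exact hx ⟨g, subset_tsupport f (by simpa using h), hg⟩
  exact hc.exists_bound_of_continuous (lam.continuous_integral f)

theorem inner_toL2 (f f' : C_c(G, ℂ)) (x : X) :
    inner ℂ (lam.toL2 f x) (lam.toL2 f' x) = ∫ g, f' g * conj (f g) ∂(lam.fibre x) := by
  rw [L2.inner_def]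
  refine integral_congr_ae ?_
  filter_upwards [(lam.memLp_fibre f x).coeFn_toLp, (lam.memLp_fibre f' x).coeFn_toLp] with g h h'
  simp only [toL2, h, h']
  rfl

theorem memℓp_toL2 (f : C_c(G, ℂ)) : Memℓp (fun x => lam.toL2 f x) ∞ := by
  obtain ⟨C, hC⟩ := lam.bounded_integral
    ⟨⟨fun g => f (𝒢.inv g) * conj (f (𝒢.inv g)), by
      have := 𝒢.continuous_inv
      fun_prop⟩, by
      have : HasCompactSupport (fun g => f (𝒢.inv g)) := f.hasCompactSupport.comp_homeomorph 𝒢.invHomeo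
      exact this.mul_right⟩
  refine memℓp_infty ⟨√C, ?_⟩
  rintro _ ⟨x, rfl⟩
  refine Real.le_sqrt_of_sq_le ?_
  have h1 := inner_self_eq_norm_sq_to_K (𝕜 := ℂ) (lam.toL2 f x)
  rw [inner_toL2, integral_fibre _ (by fun_prop)] at h1
  have h2 := hC x
  simp only [CompactlySupportedContinuousMap.coe_mk, ContinuousMap.coe_mk] at h2
  rw [h1] at h2
  simpa using h2

/-- The product of the Hilbert spaces `L²(G_x, λ_x)`: bounded families, with the norm
`sup_x ‖ξ x‖`. -/
abbrev L2Prod : Type _ := lp (fun x => Lp ℂ 2 (lam.fibre x)) ∞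

/-- A function with compact support, as a family of elements of the spaces `L²(G_x, λ_x)`. -/
def toL2Prod : C_c(G, ℂ) →ₗ[ℂ] lam.L2Prod where
  toFun f := ⟨fun x => lam.toL2 f x, lam.memℓp_toL2 f⟩
  map_add' _ _ := rfl
  map_smul' _ _ := rfl

/-- The Hilbert module `L²(G, λ)`: the completion of `C_c(G)` for the norm
`sup_x ⟨φ, φ⟩(x)^{1/2}`, realized as the closure of `C_c(G)` in the Banach space `L2Prod`, whose
norm restricts to that one. -/
def L2Module : Type _ := (LinearMap.range lam.toL2Prod).topologicalClosure

instance : NormedAddCommGroup lam.L2Module :=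
  inferInstanceAs (NormedAddCommGroup (LinearMap.range lam.toL2Prod).topologicalClosure)

instance : NormedSpace ℂ lam.L2Module :=
  inferInstanceAs (NormedSpace ℂ (LinearMap.range lam.toL2Prod).topologicalClosure)

instance : CompleteSpace lam.L2Module :=
  (Submodule.isClosed_topologicalClosure (LinearMap.range lam.toL2Prod)).completeSpace_coe

/-- The canonical map from `C_c(G)` to `L²(G, λ)`. -/
def ofCc : C_c(G, ℂ) →ₗ[ℂ] lam.L2Module :=
  LinearMap.codRestrict (LinearMap.range lam.toL2Prod).topologicalClosure lam.toL2Prod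
    fun f => subset_closure ⟨f, rfl⟩

theorem denseRange_ofCc : DenseRange lam.ofCc := by
  refine Subtype.dense_iff.2 ?_
  intro ξ hξ
  refine closure_mono ?_ hξ
  rintro _ ⟨f, rfl⟩
  exact ⟨lam.ofCc f, ⟨f, rfl⟩, rfl⟩

/-- The scalar product of `L²(G, λ)`, with values in functions on the base; on `C_c(G)` it is
`⟨φ, φ'⟩(x) = ∫ conj (φ(γ⁻¹)) φ'(γ⁻¹) dλ^x(γ)`. -/
def ip (ξ η : lam.L2Module) (x : X) : ℂ := inner ℂ (ξ.1 x) (η.1 x)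

theorem ip_ofCc (f f' : C_c(G, ℂ)) (x : X) :
    lam.ip (lam.ofCc f) (lam.ofCc f') x =
      ∫ g, conj (f (𝒢.inv g)) * f' (𝒢.inv g) ∂(lam.meas x) := by
  change inner ℂ (lam.toL2 f x) (lam.toL2 f' x) = _
  rw [inner_toL2, integral_fibre _ (by fun_prop)]
  simp only [mul_comm]

theorem norm_ip_le (ξ η : lam.L2Module) (x : X) : ‖lam.ip ξ η x‖ ≤ ‖ξ‖ * ‖η‖ :=
  (norm_inner_le_norm _ _).trans (mul_le_mul (lp.norm_apply_le_norm ENNReal.top_ne_zero ξ.1 x)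
    (lp.norm_apply_le_norm ENNReal.top_ne_zero η.1 x) (norm_nonneg _) (norm_nonneg _))

theorem ip_add_left (ξ ξ' η : lam.L2Module) (x : X) :
    lam.ip (ξ + ξ') η x = lam.ip ξ η x + lam.ip ξ' η x := inner_add_left _ _ _

theorem ip_add_right (ξ η η' : lam.L2Module) (x : X) :
    lam.ip ξ (η + η') x = lam.ip ξ η x + lam.ip ξ η' x := inner_add_right _ _ _

theorem ip_smul_left (c : ℂ) (ξ η : lam.L2Module) (x : X) :
    lam.ip (c • ξ) η x = conj c * lam.ip ξ η x := inner_smul_left _ _ _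

theorem ip_smul_right (c : ℂ) (ξ η : lam.L2Module) (x : X) :
    lam.ip ξ (c • η) x = c * lam.ip ξ η x := inner_smul_right _ _ _

theorem conj_ip (ξ η : lam.L2Module) (x : X) : conj (lam.ip ξ η x) = lam.ip η ξ x :=
  inner_conj_symm _ _

theorem norm_sq_le (ξ : lam.L2Module) {C : ℝ} (h : ∀ x, ‖lam.ip ξ ξ x‖ ≤ C) (hC : 0 ≤ C) :
    ‖ξ‖ ^ 2 ≤ C := by
  have : ‖ξ‖ ≤ √C := by
    refine lp.norm_le_of_forall_le (Real.sqrt_nonneg _) fun x => Real.le_sqrt_of_sq_le ?_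
    have h1 := inner_self_eq_norm_sq_to_K (𝕜 := ℂ) (ξ.1 x)
    have h2 := h x
    rw [ip, h1] at h2
    simpa using h2
  calc ‖ξ‖ ^ 2 ≤ √C ^ 2 := by gcongr
    _ = C := Real.sq_sqrt hC

theorem ext_ip {ξ ξ' : lam.L2Module} (h : ∀ η x, lam.ip ξ η x = lam.ip ξ' η x) : ξ = ξ' := by
  have h1 : ∀ x, lam.ip (ξ - ξ') (ξ - ξ') x = 0 := fun x => by
    have h2 : ∀ η, lam.ip (ξ - ξ') η x = lam.ip ξ η x - lam.ip ξ' η x :=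
      fun η => inner_sub_left _ _ _
    rw [h2, h, sub_self]
  have h3 := lam.norm_sq_le (ξ - ξ') (C := 0) (fun x => by simp [h1]) le_rfl
  exact sub_eq_zero.1 (norm_eq_zero.1 (pow_eq_zero_iff two_ne_zero |>.1
    (le_antisymm h3 (sq_nonneg _))))

/-- The operator `S` is an adjoint of `T` for the scalar product of `L²(G, λ)`. -/
def IsAdjoint (T S : lam.L2Module →L[ℂ] lam.L2Module) : Prop :=
  ∀ ξ η x, lam.ip (S ξ) η x = lam.ip ξ (T η) x

variable {lam} in
theorem IsAdjoint.symm {T S : lam.L2Module →L[ℂ] lam.L2Module} (h : lam.IsAdjoint T S) :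
    lam.IsAdjoint S T := fun ξ η x => by
  rw [← lam.conj_ip, ← h, lam.conj_ip]

variable {lam} in
theorem IsAdjoint.unique {T S S' : lam.L2Module →L[ℂ] lam.L2Module} (h : lam.IsAdjoint T S)
    (h' : lam.IsAdjoint T S') : S = S' :=
  ContinuousLinearMap.ext fun ξ => lam.ext_ip fun η x => by rw [h, h']

/-- The algebra of adjointable operators of `L²(G, λ)`, with the operator norm. -/
def adjointableSubalgebra : Subalgebra ℂ (lam.L2Module →L[ℂ] lam.L2Module) where
  carrier := {T | ∃ S, lam.IsAdjoint T S}
  mul_mem' := by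
    rintro T T' ⟨S, h⟩ ⟨S', h'⟩
    exact ⟨S' * S, fun ξ η x => (h' _ _ x).trans (h _ _ x)⟩
  add_mem' := by
    rintro T T' ⟨S, h⟩ ⟨S', h'⟩
    exact ⟨S + S', fun ξ η x => by
      simp only [add_apply, ip_add_left, ip_add_right, h ξ, h' ξ]⟩
  algebraMap_mem' c := ⟨conj c • 1, fun ξ η x => by
    simp [Algebra.algebraMap_eq_smul_one, ip_smul_left, ip_smul_right]⟩

/-- The algebra of adjointable operators, as a type. -/
def Adjointable : Type _ := lam.adjointableSubalgebra

instance : NormedRing lam.Adjointable := inferInstanceAs (NormedRing lam.adjointableSubalgebra)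

instance : NormedAlgebra ℂ lam.Adjointable :=
  inferInstanceAs (NormedAlgebra ℂ lam.adjointableSubalgebra)

/-- The adjoint of an adjointable operator. -/
instance : Star lam.Adjointable where
  star T := ⟨T.2.choose, T.1, T.2.choose_spec.symm⟩

variable {lam} in
theorem isAdjoint_star (T : lam.Adjointable) : lam.IsAdjoint T.1 (star T).1 := T.2.choose_spec

variable {lam} in
theorem star_eq {T S : lam.Adjointable} (h : lam.IsAdjoint T.1 S.1) : star T = S :=
  Subtype.ext ((isAdjoint_star T).unique h)

instance : StarRing lam.Adjointable where
  star_involutive T := star_eq (isAdjoint_star T).symm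
  star_mul T T' := star_eq fun ξ η x =>
    (isAdjoint_star T' _ _ x).trans (isAdjoint_star T _ _ x)
  star_add T T' := star_eq fun ξ η x => by
    have h := isAdjoint_star T ξ η x
    have h' := isAdjoint_star T' ξ η x
    change lam.ip ((star T).1 ξ + (star T').1 ξ) η x = lam.ip ξ (T.1 η + T'.1 η) x
    rw [ip_add_left, ip_add_right, h, h']

instance : StarModule ℂ lam.Adjointable where
  star_smul c T := star_eq fun ξ η x => by
    have h := isAdjoint_star T ξ η x
    change lam.ip (conj c • (star T).1 ξ) η x = lam.ip ξ (c • T.1 η) x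
    rw [ip_smul_left, ip_smul_right, h, Complex.conj_conj]

theorem norm_sq_apply_le (T : lam.Adjointable) (ξ : lam.L2Module) :
    ‖T.1 ξ‖ ^ 2 ≤ ‖(star T * T).1‖ * ‖ξ‖ ^ 2 := by
  refine lam.norm_sq_le _ (fun x => ?_) (by positivity)
  rw [← isAdjoint_star T]
  have h1 : ‖(star T).1 (T.1 ξ)‖ ≤ ‖(star T * T).1‖ * ‖ξ‖ := (star T * T).1.le_opNorm ξ
  calc ‖lam.ip ((star T).1 (T.1 ξ)) ξ x‖ ≤ ‖(star T).1 (T.1 ξ)‖ * ‖ξ‖ := lam.norm_ip_le _ _ _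
    _ ≤ (‖(star T * T).1‖ * ‖ξ‖) * ‖ξ‖ := mul_le_mul_of_nonneg_right h1 (norm_nonneg _)
    _ = ‖(star T * T).1‖ * ‖ξ‖ ^ 2 := by ring

instance : CStarRing lam.Adjointable where
  norm_mul_self_le T := by
    have h0 : ‖T.1‖ ≤ √‖(star T * T).1‖ := by
      refine ContinuousLinearMap.opNorm_le_bound _ (Real.sqrt_nonneg _) fun ξ => ?_
      refine (Real.le_sqrt_of_sq_le (lam.norm_sq_apply_le T ξ)).trans_eq ?_
      exact (Real.sqrt_mul (norm_nonneg _) _).trans (by rw [Real.sqrt_sq (norm_nonneg ξ)])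
    exact (mul_self_le_mul_self (norm_nonneg _) h0).trans_eq (Real.mul_self_sqrt (norm_nonneg _))

/-! ### Convolution -/

/-- Integrals against a Haar system depend continuously on parameters. -/
theorem continuousAt_integral {P : Type*} [TopologicalSpace P] {b : P → X} (hb : Continuous b)
    {F : G → P → ℂ} (hF : Continuous fun q : G × P => F q.1 q.2) {p₀ : P} {K : Set G}
    (hK : IsCompact K) (hFK : ∀ᶠ p in 𝓝 p₀, ∀ g ∉ K, F g p = 0) :
    ContinuousAt (fun p => ∫ g, F g p ∂(lam.meas (b p))) p₀ := by
  obtain ⟨χ, hχ1, -, hχc, hχ0⟩ := exists_continuous_one_zero_of_isCompact hK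
    isClosed_empty (Set.disjoint_empty K)
  have hχ0' : ∀ g, 0 ≤ χ g := fun g => (hχ0 g).1
  let χ' : C_c(G, ℂ) := ⟨⟨fun g => (χ g : ℂ), by fun_prop⟩, hχc.comp_left Complex.ofReal_zero⟩
  obtain ⟨C, hC⟩ := lam.bounded_integral χ'
  have hχint : ∀ x, Integrable χ (lam.meas x) := fun x =>
    χ.continuous.integrable_of_hasCompactSupport hχc
  have hC' : ∀ x, ∫ g, χ g ∂(lam.meas x) ≤ C := fun x => by
    have := hC x
    have h2 : ∫ g, χ' g ∂(lam.meas x) = ((∫ g, χ g ∂(lam.meas x) : ℝ) : ℂ) := integral_ofReal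
    rw [h2, Complex.norm_real] at this
    exact (le_abs_self _).trans this
  have hFc : ∀ p, (∀ g ∉ K, F g p = 0) → HasCompactSupport fun g => F g p := fun p hp =>
    HasCompactSupport.intro hK hp
  have hFp : ∀ p, Continuous fun g => F g p := fun p =>
    hF.comp (continuous_id.prodMk continuous_const)
  have hp₀ := hFK.self_of_nhds
  let F₀ : C_c(G, ℂ) := ⟨⟨fun g => F g p₀, hFp p₀⟩, hFc p₀ hp₀⟩
  have h1 : Tendsto (fun p => ∫ g, F g p₀ ∂(lam.meas (b p))) (𝓝 p₀)
      (𝓝 (∫ g, F g p₀ ∂(lam.meas (b p₀)))) :=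
    ((lam.continuous_integral F₀).comp hb).continuousAt
  have h2 : Tendsto (fun p => ∫ g, F g p ∂(lam.meas (b p)) - ∫ g, F g p₀ ∂(lam.meas (b p)))
      (𝓝 p₀) (𝓝 0) := by
    rw [Metric.tendsto_nhds]
    intro ε hε
    have hδ : 0 < ε / (|C| + 1) := by positivity
    have h3 : ∀ᶠ p in 𝓝 p₀, ∀ g ∈ K, ‖F g p - F g p₀‖ < ε / (|C| + 1) := by
      refine hK.eventually_forall_of_forall_eventually fun g hg => ?_
      have hc : Continuous fun q : P × G => ‖F q.2 q.1 - F q.2 p₀‖ := by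
        have h4 : Continuous fun q : P × G => F q.2 q.1 :=
          hF.comp (continuous_snd.prodMk continuous_fst)
        have h5 : Continuous fun q : P × G => F q.2 p₀ :=
          hF.comp (continuous_snd.prodMk continuous_const)
        exact (h4.sub h5).norm
      exact hc.continuousAt.eventually_lt continuousAt_const (by simpa using hδ)
    filter_upwards [h3, hFK] with p hp hpK
    rw [dist_zero_right, ← integral_sub ((hFp p).integrable_of_hasCompactSupport (hFc p hpK))
      ((hFp p₀).integrable_of_hasCompactSupport (hFc p₀ hp₀))]
    calc ‖∫ g, F g p - F g p₀ ∂(lam.meas (b p))‖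
        ≤ ∫ g, ε / (|C| + 1) * χ g ∂(lam.meas (b p)) := by
          refine norm_integral_le_of_norm_le ((hχint _).const_mul _) (Eventually.of_forall fun g => ?_)
          by_cases hg : g ∈ K
          · rw [hχ1 hg]; simpa using (hp g hg).le
          · rw [hpK g hg, hp₀ g hg]; simpa using mul_nonneg hδ.le (hχ0' g)
      _ = ε / (|C| + 1) * ∫ g, χ g ∂(lam.meas (b p)) := integral_const_mul _ _
      _ ≤ ε / (|C| + 1) * |C| := by gcongr; exact (hC' _).trans (le_abs_self C)
      _ < ε := by
          rw [div_mul_eq_mul_div, div_lt_iff₀ (by positivity)]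
          nlinarith [abs_nonneg C]
  have := h2.add h1
  simpa [ContinuousAt] using this

/-- The convolution product of two functions on a groupoid. -/
def convFun (f φ : G → ℂ) (g : G) : ℂ :=
  ∫ g', f g' * φ (𝒢.mul (𝒢.inv g') g) ∂(lam.meas (𝒢.r g))

/-- A globally continuous integrand for the convolution product. -/
theorem exists_conv_integrand (f φ : C_c(G, ℂ)) : ∃ (F : G → G → ℂ) (K : Set G), IsCompact K ∧
    Continuous (fun q : G × G => F q.1 q.2) ∧ (∀ g g', g' ∉ K → F g' g = 0) ∧
    ∀ g g', 𝒢.r g' = 𝒢.r g → F g' g = f g' * φ (𝒢.mul (𝒢.inv g') g) := by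
  have := 𝒢.t2_base
  obtain ⟨χ, hχ1, -, hχc, -⟩ := exists_continuous_one_zero_of_isCompact
    f.hasCompactSupport.isCompact isClosed_empty (Set.disjoint_empty (tsupport f))
  let S : Set (G × G) := {q | 𝒢.r q.1 = 𝒢.r q.2}
  have hS : IsClosed S := isClosed_eq (𝒢.continuous_r.comp continuous_fst)
    (𝒢.continuous_r.comp continuous_snd)
  have hcont : ContinuousOn (fun q : G × G => f q.1 * φ (𝒢.mul (𝒢.inv q.1) q.2)) S := by
    refine (f.continuous.comp continuous_fst).continuousOn.mul
      (φ.continuous.comp_continuousOn ?_)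
    exact 𝒢.continuousOn_mul.comp (f := fun q : G × G => (𝒢.inv q.1, q.2))
      ((𝒢.continuous_inv.comp continuous_fst).prodMk continuous_snd).continuousOn
      fun q hq => (𝒢.s_inv q.1).trans hq
  obtain ⟨H, hH⟩ := ContinuousMap.exists_restrict_eq hS
    (⟨S.domRestrict fun q : G × G => f q.1 * φ (𝒢.mul (𝒢.inv q.1) q.2), hcont.domRestrict⟩ :
      C(S, ℂ))
  refine ⟨fun g' g => (χ g' : ℂ) * H (g', g), tsupport χ, hχc.isCompact, by fun_prop,
    fun g g' hg => by simp [image_eq_zero_of_notMem_tsupport hg], fun g g' hg => ?_⟩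
  have h1 : H (g', g) = f g' * φ (𝒢.mul (𝒢.inv g') g) :=
    DFunLike.congr_fun hH (⟨(g', g), hg⟩ : S)
  by_cases h : g' ∈ tsupport f
  · simp [h1, hχ1 h]
  · simp [h1, image_eq_zero_of_notMem_tsupport h]

theorem integrable_conv (f φ : C_c(G, ℂ)) (g : G) :
    Integrable (fun g' => f g' * φ (𝒢.mul (𝒢.inv g') g)) (lam.meas (𝒢.r g)) := by
  obtain ⟨F, K, hK, hF, hFK, hFe⟩ := exists_conv_integrand (𝒢 := 𝒢) f φ
  have h1 : Integrable (fun g' => F g' g) (lam.meas (𝒢.r g)) :=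
    (hF.comp (by fun_prop : Continuous fun g' : G => (g', g))).integrable_of_hasCompactSupport
      (HasCompactSupport.intro hK (hFK g))
  refine h1.congr ?_
  filter_upwards [lam.ae_r (𝒢.r g)] with g' hg'
  exact hFe g g' hg'

theorem continuous_convFun (f φ : C_c(G, ℂ)) : Continuous (lam.convFun f φ) := by
  obtain ⟨F, K, hK, hF, hFK, hFe⟩ := exists_conv_integrand (𝒢 := 𝒢) f φ
  have h1 : lam.convFun f φ = fun g => ∫ g', F g' g ∂(lam.meas (𝒢.r g)) := by
    funext g
    refine integral_congr_ae ?_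
    filter_upwards [lam.ae_r (𝒢.r g)] with g' hg'
    exact (hFe g g' hg').symm
  rw [h1]
  exact continuous_iff_continuousAt.2 fun g₀ => lam.continuousAt_integral 𝒢.continuous_r hF hK
    (Eventually.of_forall fun g => hFK g)

theorem hasCompactSupport_convFun (f φ : C_c(G, ℂ)) : HasCompactSupport (lam.convFun f φ) := by
  have := 𝒢.t2_base
  let S : Set (G × G) := {q | 𝒢.s q.1 = 𝒢.r q.2}
  have hS : IsClosed S := isClosed_eq (𝒢.continuous_s.comp continuous_fst)
    (𝒢.continuous_r.comp continuous_snd)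
  have hK : IsCompact ((tsupport f ×ˢ tsupport φ) ∩ S) :=
    (f.hasCompactSupport.isCompact.prod φ.hasCompactSupport.isCompact).inter_right hS
  refine HasCompactSupport.intro (hK.image_of_continuousOn
    (𝒢.continuousOn_mul.mono Set.inter_subset_right)) fun g hg => ?_
  refine integral_eq_zero_of_ae ?_
  filter_upwards [lam.ae_r (𝒢.r g)] with g' hg'
  by_contra h
  have h' := mul_ne_zero_iff.1 h
  have hs : 𝒢.s (𝒢.inv g') = 𝒢.r g := (𝒢.s_inv g').trans hg'
  refine hg ⟨(g', 𝒢.mul (𝒢.inv g') g), ⟨⟨subset_tsupport f h'.1, subset_tsupport φ h'.2⟩, ?_⟩, ?_⟩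
  · change 𝒢.s g' = 𝒢.r (𝒢.mul (𝒢.inv g') g)
    rw [𝒢.r_mul _ _ hs, 𝒢.r_inv]
  · have := 𝒢.inv_mul_cancel_left hs
    rwa [𝒢.inv_inv] at this

/-- Left convolution by `f`, as a linear map of `C_c(G)`. -/
def conv (f : C_c(G, ℂ)) : C_c(G, ℂ) →ₗ[ℂ] C_c(G, ℂ) where
  toFun φ := ⟨⟨lam.convFun f φ, lam.continuous_convFun f φ⟩, lam.hasCompactSupport_convFun f φ⟩
  map_add' φ φ' := by
    ext g
    have := integral_add (lam.integrable_conv f φ g) (lam.integrable_conv f φ' g)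
    simp only [← mul_add] at this
    exact this
  map_smul' c φ := by
    ext g
    have := integral_const_mul (μ := lam.meas (𝒢.r g)) c
      (fun g' => f g' * φ (𝒢.mul (𝒢.inv g') g))
    simp only [mul_left_comm c] at this
    exact this

/-- The involution `f^*(γ) = conj (f(γ⁻¹))` of `C_c(G)`. -/
def involution (𝒢 : TopGroupoid G X) (f : C_c(G, ℂ)) : C_c(G, ℂ) :=
  ⟨⟨fun g => conj (f (𝒢.inv g)), by have := 𝒢.continuous_inv; fun_prop⟩,
    (f.hasCompactSupport.comp_homeomorph 𝒢.invHomeo).comp_left (map_zero _)⟩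

theorem aemeasurable_translate {g : G} {x : X} (hg : 𝒢.s g = x) :
    AEMeasurable (fun h => 𝒢.mul g (𝒢.inv h)) (lam.fibre x) := by
  have := 𝒢.t2_base
  have hS : MeasurableSet {h | 𝒢.s h = x} :=
    (isClosed_singleton.preimage 𝒢.continuous_s).measurableSet
  rw [← Measure.restrict_eq_self_of_ae_mem (lam.ae_s x)]
  refine ContinuousOn.aemeasurable ?_ hS
  exact 𝒢.continuousOn_mul.comp (f := fun h : G => (g, 𝒢.inv h))
    (continuous_const.prodMk 𝒢.continuous_inv).continuousOn
    fun h hh => hg.trans (hh.symm.trans (𝒢.r_inv h).symm)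

theorem aemeasurable_mul (g : G) : AEMeasurable (𝒢.mul g) (lam.meas (𝒢.s g)) := by
  have := 𝒢.t2_base
  have hS : MeasurableSet {h | 𝒢.r h = 𝒢.s g} :=
    (isClosed_singleton.preimage 𝒢.continuous_r).measurableSet
  rw [← Measure.restrict_eq_self_of_ae_mem (lam.ae_r (𝒢.s g))]
  refine ContinuousOn.aemeasurable ?_ hS
  exact 𝒢.continuousOn_mul.comp (f := fun h : G => (g, h))
    (continuous_const.prodMk continuous_id).continuousOn fun h hh => hh.symm

theorem map_translate {g : G} {x : X} (hg : 𝒢.s g = x) :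
    (lam.fibre x).map (fun h => 𝒢.mul g (𝒢.inv h)) = lam.meas (𝒢.r g) := by
  have h1 : lam.meas x = (lam.fibre x).map 𝒢.inv := by
    rw [fibre, Measure.map_map 𝒢.continuous_inv.measurable 𝒢.continuous_inv.measurable]
    have : 𝒢.inv ∘ 𝒢.inv = id := funext 𝒢.inv_inv
    rw [this, Measure.map_id]
  rw [← lam.map_mul_left g, hg, h1, AEMeasurable.map_map_of_aemeasurable _
    𝒢.continuous_inv.aemeasurable]
  · rfl
  · rw [← h1, ← hg]; exact lam.aemeasurable_mul g

/-- The kernel of the convolution by `f` on the source fibre over `x`. -/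
def kernel (𝒢 : TopGroupoid G X) (f : G → ℂ) (x : X) (g h : G) : ℂ :=
  Set.indicator {q : G × G | 𝒢.s q.1 = x ∧ 𝒢.s q.2 = x} (fun q => f (𝒢.mul q.1 (𝒢.inv q.2))) (g, h)

theorem kernel_eq (f : G → ℂ) {x : X} {g h : G} (hg : 𝒢.s g = x) (hh : 𝒢.s h = x) :
    kernel 𝒢 f x g h = f (𝒢.mul g (𝒢.inv h)) :=
  Set.indicator_of_mem (s := {q : G × G | 𝒢.s q.1 = x ∧ 𝒢.s q.2 = x}) ⟨hg, hh⟩ _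

theorem kernel_eq_zero (f : G → ℂ) {x : X} {g h : G} (hg : ¬ (𝒢.s g = x ∧ 𝒢.s h = x)) :
    kernel 𝒢 f x g h = 0 :=
  Set.indicator_of_notMem (s := {q : G × G | 𝒢.s q.1 = x ∧ 𝒢.s q.2 = x}) hg _

theorem measurable_kernel (f : C_c(G, ℂ)) (x : X) :
    Measurable fun q : G × G => kernel 𝒢 f x q.1 q.2 := by
  have := 𝒢.t2_base
  have hS : IsClosed {q : G × G | 𝒢.s q.1 = x ∧ 𝒢.s q.2 = x} :=
    (isClosed_singleton.preimage (𝒢.continuous_s.comp continuous_fst)).inter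
      (isClosed_singleton.preimage (𝒢.continuous_s.comp continuous_snd))
  have hc : ContinuousOn (fun q : G × G => f (𝒢.mul q.1 (𝒢.inv q.2)))
      {q : G × G | 𝒢.s q.1 = x ∧ 𝒢.s q.2 = x} :=
    f.continuous.comp_continuousOn <|
      𝒢.continuousOn_mul.comp (f := fun q : G × G => (q.1, 𝒢.inv q.2))
      (continuous_fst.prodMk (𝒢.continuous_inv.comp continuous_snd)).continuousOn
      fun q hq => hq.1.trans (hq.2.symm.trans (𝒢.r_inv q.2).symm)
  refine measurable_of_restrict_of_restrict_compl hS.measurableSet ?_ ?_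
  · have : Set.domRestrict {q : G × G | 𝒢.s q.1 = x ∧ 𝒢.s q.2 = x}
        (fun q : G × G => kernel 𝒢 f x q.1 q.2) =
        Set.domRestrict _ (fun q : G × G => f (𝒢.mul q.1 (𝒢.inv q.2))) :=
      funext fun q => kernel_eq f q.2.1 q.2.2
    rw [this]
    exact hc.domRestrict.measurable
  · have : Set.domRestrict {q : G × G | 𝒢.s q.1 = x ∧ 𝒢.s q.2 = x}ᶜ
        (fun q : G × G => kernel 𝒢 f x q.1 q.2) = fun _ => 0 :=
      funext fun q => kernel_eq_zero f q.2
    rw [this]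
    exact measurable_const

theorem kernel_involution (f : C_c(G, ℂ)) (x : X) (g h : G) :
    kernel 𝒢 (involution 𝒢 f) x g h = conj (kernel 𝒢 f x h g) := by
  by_cases hgh : 𝒢.s g = x ∧ 𝒢.s h = x
  · rw [kernel_eq _ hgh.1 hgh.2, kernel_eq _ hgh.2 hgh.1]
    change conj (f _) = _
    rw [𝒢.inv_mul_rev (by rw [𝒢.r_inv, hgh.1, hgh.2]), 𝒢.inv_inv]
  · rw [kernel_eq_zero _ hgh, kernel_eq_zero _ (fun h' => hgh h'.symm), map_zero]

theorem convFun_eq (f φ : C_c(G, ℂ)) {x : X} {g : G} (hg : 𝒢.s g = x) :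
    lam.convFun f φ g = ∫ h, kernel 𝒢 f x g h * φ h ∂(lam.fibre x) := by
  rw [convFun, ← lam.map_translate hg, integral_map (lam.aemeasurable_translate hg)]
  · refine integral_congr_ae ?_
    filter_upwards [lam.ae_s x] with h hh
    have h1 : 𝒢.s g = 𝒢.r (𝒢.inv h) := by rw [𝒢.r_inv, hg, hh]
    rw [kernel_eq _ hg hh, 𝒢.inv_mul_rev h1, 𝒢.inv_inv,
      𝒢.mul_assoc _ _ _ (by rw [𝒢.r_inv, hg, hh]) (𝒢.s_inv g), 𝒢.inv_mul, hg, ← hh, 𝒢.mul_unit]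
  · rw [lam.map_translate hg]
    exact (lam.integrable_conv f φ g).aestronglyMeasurable

/-- A uniform bound for the integrals of `‖f‖` over the range fibres. -/
theorem exists_lintegral_bound (f : C_c(G, ℂ)) :
    ∃ C : NNReal, ∀ x, ∫⁻ g, ‖f g‖ₑ ∂(lam.meas x) ≤ C := by
  obtain ⟨C, hC⟩ := lam.bounded_integral
    ⟨⟨fun g => (‖f g‖ : ℂ), by fun_prop⟩, f.hasCompactSupport.norm.comp_left Complex.ofReal_zero⟩
  refine ⟨C.toNNReal, fun x => ?_⟩
  have h1 := hC x
  have h2 : ∫ g, ((‖f g‖ : ℝ) : ℂ) ∂(lam.meas x) = ((∫ g, ‖f g‖ ∂(lam.meas x) : ℝ) : ℂ) :=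
    integral_ofReal
  simp only [CompactlySupportedContinuousMap.coe_mk, ContinuousMap.coe_mk] at h1
  rw [h2, Complex.norm_real] at h1
  rw [← ofReal_integral_norm_eq_lintegral_enorm (lam.integrable_meas f x)]
  exact ENNReal.ofReal_le_ofReal ((le_abs_self _).trans h1)

theorem exists_kernel_bound (f : C_c(G, ℂ)) :
    ∃ C : NNReal, ∀ x g, ∫⁻ h, ‖kernel 𝒢 f x g h‖ₑ ∂(lam.fibre x) ≤ C := by
  obtain ⟨C, hC⟩ := lam.exists_lintegral_bound f
  refine ⟨C, fun x g => ?_⟩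
  by_cases hg : 𝒢.s g = x
  · refine le_trans (le_of_eq ?_) (hC (𝒢.r g))
    rw [← lam.map_translate hg, lintegral_map' (by fun_prop) (lam.aemeasurable_translate hg)]
    refine lintegral_congr_ae ?_
    filter_upwards [lam.ae_s x] with h hh
    rw [kernel_eq _ hg hh]
  · have : ∀ h, kernel 𝒢 f x g h = 0 := fun h => kernel_eq_zero _ fun h' => hg h'.1
    simp [this]

theorem exists_conv_bound (f : C_c(G, ℂ)) : ∃ C : NNReal, ∀ (φ : C_c(G, ℂ)) (x : X),
    ∫⁻ g, ‖lam.convFun f φ g‖ₑ ^ (2 : ℝ) ∂(lam.fibre x) ≤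
      (C : ℝ≥0∞) ^ (2 : ℝ) * ∫⁻ g, ‖φ g‖ₑ ^ (2 : ℝ) ∂(lam.fibre x) := by
  obtain ⟨C₁, hC₁⟩ := lam.exists_kernel_bound f
  obtain ⟨C₂, hC₂⟩ := lam.exists_kernel_bound (involution 𝒢 f)
  refine ⟨C₁ + C₂, fun φ x => ?_⟩
  have hk := measurable_kernel (𝒢 := 𝒢) f x
  have hkg : ∀ g, Measurable fun h => kernel 𝒢 f x g h := fun g =>
    hk.comp (measurable_const.prodMk measurable_id)
  have hkh : ∀ h, Measurable fun g => kernel 𝒢 f x g h := fun h =>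
    hk.comp (measurable_id.prodMk measurable_const)
  have hφ : Measurable φ := φ.continuous.measurable
  have h1 : ∀ g, (∫⁻ h, ‖kernel 𝒢 f x g h‖ₑ * ‖φ h‖ₑ ∂(lam.fibre x)) ^ (2 : ℝ) ≤
      C₁ * ∫⁻ h, ‖kernel 𝒢 f x g h‖ₑ * ‖φ h‖ₑ ^ (2 : ℝ) ∂(lam.fibre x) := fun g => by
    have h2 := ENNReal.lintegral_mul_le_Lp_mul_Lq (lam.fibre x) Real.HolderConjugate.two_two
      (f := fun h => ‖kernel 𝒢 f x g h‖ₑ ^ (1 / 2 : ℝ))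
      (g := fun h => ‖kernel 𝒢 f x g h‖ₑ ^ (1 / 2 : ℝ) * ‖φ h‖ₑ)
      ((hkg g).enorm.pow_const _).aemeasurable
      (((hkg g).enorm.pow_const _).mul hφ.enorm).aemeasurable
    have e1 : ∀ a : ℝ≥0∞, a ^ (1 / 2 : ℝ) * a ^ (1 / 2 : ℝ) = a := fun a => by
      rw [← ENNReal.rpow_add_of_nonneg _ _ (by norm_num) (by norm_num)]; norm_num
    have e2 : ∀ a : ℝ≥0∞, (a ^ (1 / 2 : ℝ)) ^ (2 : ℝ) = a := fun a => by
      rw [← ENNReal.rpow_mul]; norm_num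
    simp only [Pi.mul_apply, ← _root_.mul_assoc, e1, ENNReal.mul_rpow_of_nonneg _ _ zero_le_two,
      e2] at h2
    calc _ ≤ _ := ENNReal.rpow_le_rpow h2 zero_le_two
      _ = (∫⁻ h, ‖kernel 𝒢 f x g h‖ₑ ∂(lam.fibre x)) *
          ∫⁻ h, ‖kernel 𝒢 f x g h‖ₑ * ‖φ h‖ₑ ^ (2 : ℝ) ∂(lam.fibre x) := by
        rw [ENNReal.mul_rpow_of_nonneg _ _ zero_le_two, e2, e2]
      _ ≤ _ := by gcongr; exact hC₁ x g
  calc ∫⁻ g, ‖lam.convFun f φ g‖ₑ ^ (2 : ℝ) ∂(lam.fibre x)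
      ≤ ∫⁻ g, C₁ * ∫⁻ h, ‖kernel 𝒢 f x g h‖ₑ * ‖φ h‖ₑ ^ (2 : ℝ) ∂(lam.fibre x) ∂(lam.fibre x) := by
        refine lintegral_mono_ae ?_
        filter_upwards [lam.ae_s x] with g hg
        refine le_trans (ENNReal.rpow_le_rpow ?_ zero_le_two) (h1 g)
        rw [lam.convFun_eq f φ hg]
        refine (enorm_integral_le_lintegral_enorm _).trans (le_of_eq ?_)
        simp only [enorm_mul]
    _ = C₁ * ∫⁻ h, ∫⁻ g, ‖kernel 𝒢 f x g h‖ₑ * ‖φ h‖ₑ ^ (2 : ℝ) ∂(lam.fibre x) ∂(lam.fibre x) := by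
        rw [lintegral_const_mul' _ _ ENNReal.coe_ne_top, lintegral_lintegral_swap]
        exact (hk.enorm.mul ((hφ.comp measurable_snd).enorm.pow_const _)).aemeasurable
    _ ≤ C₁ * ∫⁻ h, C₂ * ‖φ h‖ₑ ^ (2 : ℝ) ∂(lam.fibre x) := by
        gcongr with h
        rw [lintegral_mul_const _ ((hkh h).enorm)]
        gcongr
        refine le_trans (le_of_eq ?_) (hC₂ x h)
        simp only [kernel_involution, RCLike.enorm_conj]
    _ = (C₁ * C₂) * ∫⁻ h, ‖φ h‖ₑ ^ (2 : ℝ) ∂(lam.fibre x) := by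
        rw [lintegral_const_mul' _ _ ENNReal.coe_ne_top, _root_.mul_assoc]
    _ ≤ _ := by
        gcongr
        rw [ENNReal.rpow_two, sq]
        push_cast
        gcongr
        · exact le_self_add
        · exact le_add_self

theorem norm_ofCc_conv_le (f : C_c(G, ℂ)) :
    ∃ C : ℝ, ∀ φ, ‖lam.ofCc (lam.conv f φ)‖ ≤ C * ‖lam.ofCc φ‖ := by
  obtain ⟨C, hC⟩ := lam.exists_conv_bound f
  refine ⟨C, fun φ => lp.norm_le_of_forall_le (by positivity) fun x => ?_⟩
  have h1 : ‖lam.toL2 φ x‖ ≤ ‖lam.ofCc φ‖ :=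
    lp.norm_apply_le_norm ENNReal.top_ne_zero (lam.toL2Prod φ) x
  refine le_trans ?_ (mul_le_mul_of_nonneg_left h1 C.2)
  change ‖lam.toL2 (lam.conv f φ) x‖ ≤ _
  rw [toL2, toL2, Lp.norm_toLp, Lp.norm_toLp,
    eLpNorm_eq_lintegral_rpow_enorm_toReal two_ne_zero ENNReal.ofNat_ne_top,
    eLpNorm_eq_lintegral_rpow_enorm_toReal two_ne_zero ENNReal.ofNat_ne_top]
  have h2 := ENNReal.rpow_le_rpow (hC φ x) (by norm_num : (0 : ℝ) ≤ 1 / 2)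
  have e : ((C : ℝ≥0∞) ^ (2 : ℝ)) ^ (1 / 2 : ℝ) = C := by rw [← ENNReal.rpow_mul]; norm_num
  have hfin : (∫⁻ g, ‖φ g‖ₑ ^ (2 : ℝ) ∂(lam.fibre x)) ^ (1 / 2 : ℝ) ≠ ∞ := by
    have h3 := (lam.memLp_fibre φ x).eLpNorm_ne_top
    rwa [eLpNorm_eq_lintegral_rpow_enorm_toReal two_ne_zero ENNReal.ofNat_ne_top] at h3
  rw [ENNReal.mul_rpow_of_nonneg _ _ (by norm_num), e] at h2
  have h4 := ENNReal.toReal_mono (ENNReal.mul_ne_top ENNReal.coe_ne_top hfin) h2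
  rw [ENNReal.toReal_mul, ENNReal.coe_toReal] at h4
  exact h4

theorem ip_conv (f φ ψ : C_c(G, ℂ)) (x : X) :
    lam.ip (lam.ofCc (lam.conv (involution 𝒢 f) φ)) (lam.ofCc ψ) x =
      lam.ip (lam.ofCc φ) (lam.ofCc (lam.conv f ψ)) x := by
  have hk := measurable_kernel (𝒢 := 𝒢) f x
  have hφ : Measurable φ := φ.continuous.measurable
  have hψ : Measurable ψ := ψ.continuous.measurable
  change inner ℂ (lam.toL2 _ x) (lam.toL2 ψ x) = inner ℂ (lam.toL2 φ x) (lam.toL2 _ x)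
  rw [inner_toL2, inner_toL2]
  have e1 : ∫ g, ψ g * conj (lam.conv (involution 𝒢 f) φ g) ∂(lam.fibre x) =
      ∫ g, ∫ h, conj (φ h) * kernel 𝒢 f x h g * ψ g ∂(lam.fibre x) ∂(lam.fibre x) := by
    refine integral_congr_ae ?_
    filter_upwards [lam.ae_s x] with g hg
    change ψ g * conj (lam.convFun _ φ g) = _
    rw [lam.convFun_eq _ φ hg, ← integral_conj, ← integral_const_mul]
    refine integral_congr_ae (Eventually.of_forall fun h => ?_)
    simp only [kernel_involution, map_mul, Complex.conj_conj]
    ring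
  have e2 : ∫ h, lam.conv f ψ h * conj (φ h) ∂(lam.fibre x) =
      ∫ h, ∫ g, conj (φ h) * kernel 𝒢 f x h g * ψ g ∂(lam.fibre x) ∂(lam.fibre x) := by
    refine integral_congr_ae ?_
    filter_upwards [lam.ae_s x] with h hh
    change lam.convFun _ ψ h * conj (φ h) = _
    rw [lam.convFun_eq _ ψ hh, ← integral_mul_const]
    refine integral_congr_ae (Eventually.of_forall fun g => ?_)
    ring
  rw [e1, e2]
  refine (integral_integral_swap (f := fun h g => conj (φ h) * kernel 𝒢 f x h g * ψ g) ?_).symm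
  have hm : Measurable (Function.uncurry fun h g => conj (φ h) * kernel 𝒢 f x h g * ψ g) :=
    ((Complex.continuous_conj.measurable.comp (hφ.comp measurable_fst)).mul hk).mul
      (hψ.comp measurable_snd)
  refine ⟨hm.aestronglyMeasurable, ?_⟩
  obtain ⟨C, hC⟩ := lam.exists_kernel_bound f
  obtain ⟨M, hM⟩ := ψ.hasCompactSupport.exists_bound_of_continuous ψ.continuous
  have hM' : ∀ g, ‖ψ g‖ₑ ≤ ENNReal.ofReal M := fun g => by
    rw [← ofReal_norm]; exact ENNReal.ofReal_le_ofReal (hM g)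
  have hφi : Integrable φ (lam.fibre x) :=
    φ.continuous.integrable_of_hasCompactSupport φ.hasCompactSupport
  rw [hasFiniteIntegral_iff_enorm, lintegral_prod _ hm.enorm.aemeasurable]
  have hkg : ∀ h, Measurable fun g => kernel 𝒢 f x h g := fun g =>
    hk.comp (measurable_const.prodMk measurable_id)
  calc ∫⁻ h, ∫⁻ g, ‖conj (φ h) * kernel 𝒢 f x h g * ψ g‖ₑ ∂(lam.fibre x) ∂(lam.fibre x)
      ≤ ∫⁻ h, ‖φ h‖ₑ * (C * ENNReal.ofReal M) ∂(lam.fibre x) := by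
        refine lintegral_mono fun h => ?_
        calc ∫⁻ g, ‖conj (φ h) * kernel 𝒢 f x h g * ψ g‖ₑ ∂(lam.fibre x)
            ≤ ∫⁻ g, ‖φ h‖ₑ * (‖kernel 𝒢 f x h g‖ₑ * ENNReal.ofReal M) ∂(lam.fibre x) := by
              refine lintegral_mono fun g => ?_
              rw [enorm_mul, enorm_mul, RCLike.enorm_conj, _root_.mul_assoc]
              gcongr
              exact hM' g
          _ = ‖φ h‖ₑ * ((∫⁻ g, ‖kernel 𝒢 f x h g‖ₑ ∂(lam.fibre x)) * ENNReal.ofReal M) := by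
              rw [lintegral_const_mul' _ _ enorm_ne_top, lintegral_mul_const' _ _ ENNReal.ofReal_ne_top]
          _ ≤ _ := by
              gcongr
              exact hC x h
    _ = (∫⁻ h, ‖φ h‖ₑ ∂(lam.fibre x)) * (C * ENNReal.ofReal M) := by
        rw [lintegral_mul_const' _ _ (ENNReal.mul_ne_top ENNReal.coe_ne_top ENNReal.ofReal_ne_top)]
    _ < ∞ := ENNReal.mul_lt_top hφi.2
        (ENNReal.mul_lt_top ENNReal.coe_lt_top ENNReal.ofReal_lt_top)

/-- The bounded operator of `L²(G, λ)` extending the left convolution by `f`. -/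
def convCLM (f : C_c(G, ℂ)) : lam.L2Module →L[ℂ] lam.L2Module :=
  (lam.ofCc ∘ₗ lam.conv f).extendOfNorm lam.ofCc

theorem convCLM_ofCc (f φ : C_c(G, ℂ)) :
    lam.convCLM f (lam.ofCc φ) = lam.ofCc (lam.conv f φ) :=
  LinearMap.extendOfNorm_eq lam.denseRange_ofCc (lam.norm_ofCc_conv_le f) φ

theorem continuous_ip (x : X) :
    Continuous fun q : lam.L2Module × lam.L2Module => lam.ip q.1 q.2 x := by
  have h1 : Continuous fun ξ : lam.L2Module => ξ.1 x :=
    (LipschitzWith.of_dist_le_mul (K := 1) fun ξ η => by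
      rw [dist_eq_norm, dist_eq_norm, NNReal.coe_one, one_mul]
      exact lp.norm_apply_le_norm ENNReal.top_ne_zero (ξ.1 - η.1) x).continuous
  exact (h1.comp continuous_fst).inner (h1.comp continuous_snd)

theorem isAdjoint_convCLM (f : C_c(G, ℂ)) :
    lam.IsAdjoint (lam.convCLM f) (lam.convCLM (involution 𝒢 f)) := fun ξ η x => by
  refine DenseRange.induction_on₂ (p := fun ξ η =>
    lam.ip (lam.convCLM (involution 𝒢 f) ξ) η x = lam.ip ξ (lam.convCLM f η) x)
    lam.denseRange_ofCc ?_ (fun φ ψ => ?_) ξ η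
  · refine isClosed_eq ?_ ?_
    · exact (lam.continuous_ip x).comp
        (((lam.convCLM _).continuous.comp continuous_fst).prodMk continuous_snd)
    · exact (lam.continuous_ip x).comp
        (continuous_fst.prodMk ((lam.convCLM _).continuous.comp continuous_snd))
  · rw [convCLM_ofCc, convCLM_ofCc, ip_conv]

instance : CompleteSpace lam.Adjointable := by
  refine Metric.complete_of_cauchySeq_tendsto fun u hu => ?_
  have h1 : CauchySeq fun n => (u n).1 := by
    rw [Metric.cauchySeq_iff] at hu ⊢
    exact hu
  have h2 : CauchySeq fun n => (star (u n)).1 := by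
    rw [Metric.cauchySeq_iff] at hu ⊢
    intro ε hε
    obtain ⟨N, hN⟩ := hu ε hε
    refine ⟨N, fun m hm n hn => ?_⟩
    have h3 : dist (star (u m)) (star (u n)) < ε := by
      rw [dist_eq_norm, ← star_sub, norm_star, ← dist_eq_norm]
      exact hN m hm n hn
    exact h3
  obtain ⟨T, hT⟩ := cauchySeq_tendsto_of_complete h1
  obtain ⟨S, hS⟩ := cauchySeq_tendsto_of_complete h2
  have hTS : lam.IsAdjoint T S := fun ξ η x => by
    have hTη : Tendsto (fun n => (u n).1 η) atTop (𝓝 (T η)) :=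
      ((ContinuousLinearMap.apply ℂ lam.L2Module η).continuous.tendsto T).comp hT
    have hSξ : Tendsto (fun n => (star (u n)).1 ξ) atTop (𝓝 (S ξ)) :=
      ((ContinuousLinearMap.apply ℂ lam.L2Module ξ).continuous.tendsto S).comp hS
    have h3 := ((lam.continuous_ip x).tendsto (S ξ, η)).comp (hSξ.prodMk_nhds tendsto_const_nhds)
    have h4 := ((lam.continuous_ip x).tendsto (ξ, T η)).comp
      ((tendsto_const_nhds (x := ξ)).prodMk_nhds hTη)
    refine tendsto_nhds_unique h3 (h4.congr fun n => ?_)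
    exact (isAdjoint_star (u n) ξ η x).symm
  exact ⟨⟨T, S, hTS⟩, tendsto_subtype_rng.2 hT⟩

instance : CStarAlgebra lam.Adjointable where

/-- The adjointable operator of `L²(G, λ)` given by the left convolution by `f`. -/
def rep (f : C_c(G, ℂ)) : lam.Adjointable := ⟨lam.convCLM f, _, lam.isAdjoint_convCLM f⟩

/-- The closure of (the star-algebra consisting of the convolution operators by elements of)
`C_c(G)` in the `C^*`-algebra of adjointable operators of `L²(G, λ)`. -/
def reducedSubalgebra : NonUnitalStarSubalgebra ℂ lam.Adjointable :=
  (NonUnitalStarAlgebra.adjoin ℂ (Set.range lam.rep)).topologicalClosure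

/-- The reduced `C^*`-algebra `C^*_r(G, λ)` of a groupoid with Haar system. -/
def Reduced : Type _ := lam.reducedSubalgebra

instance : NonUnitalCStarAlgebra lam.Reduced :=
  NonUnitalStarSubalgebra.nonUnitalCStarAlgebra lam.reducedSubalgebra
    (h_closed := NonUnitalStarSubalgebra.isClosed_topologicalClosure _)

/-- The inclusion of `C_c(G)` in the reduced `C^*`-algebra. -/
def toReduced (f : C_c(G, ℂ)) : lam.Reduced :=
  ⟨lam.rep f, subset_closure (NonUnitalStarAlgebra.subset_adjoin ℂ _ ⟨f, rfl⟩)⟩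

end HaarSystem

end TopGroupoid

/-! ### Suspensions -/

/-- The orbit relation on `Y × ℝ` of the homeomorphism `(y, t) ↦ (f y, t - 1)`. -/
def suspensionSetoid {Y : Type*} [TopologicalSpace Y] (f : Y ≃ₜ Y) : Setoid (Y × ℝ) where
  r p q := ∃ n : ℤ, q = ((f ^ n) p.1, p.2 - n)
  iseqv :=
    { refl := fun p => ⟨0, by simp⟩
      symm := by
        rintro p _ ⟨n, rfl⟩
        exact ⟨-n, by simp [← Homeomorph.mul_apply]⟩
      trans := by
        rintro p _ _ ⟨n, rfl⟩ ⟨m, rfl⟩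
        exact ⟨m + n, by simp [zpow_add]; ring⟩ }

/-- The suspension `(Y × ℝ) / (y, t) ~ (f y, t - 1)` of a homeomorphism. -/
def Suspension {Y : Type*} [TopologicalSpace Y] (f : Y ≃ₜ Y) : Type _ :=
  Quotient (suspensionSetoid f)

namespace Suspension

variable {Y Z : Type*} [TopologicalSpace Y] [TopologicalSpace Z]

instance (f : Y ≃ₜ Y) : TopologicalSpace (Suspension f) :=
  inferInstanceAs (TopologicalSpace (Quotient (suspensionSetoid f)))

instance (f : Y ≃ₜ Y) : MeasurableSpace (Suspension f) := borel _

instance (f : Y ≃ₜ Y) : BorelSpace (Suspension f) := ⟨rfl⟩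

/-- The class `[y, t]` in the suspension. -/
def mk (f : Y ≃ₜ Y) (y : Y) (t : ℝ) : Suspension f := Quotient.mk (suspensionSetoid f) (y, t)

variable {f : Y ≃ₜ Y} {f' : Z ≃ₜ Z}

theorem ind {p : Suspension f → Prop} (h : ∀ y t, p (mk f y t)) (a : Suspension f) : p a :=
  Quotient.ind (fun q => h q.1 q.2) a

theorem mk_eq_iff {y y' : Y} {t t' : ℝ} :
    mk f y t = mk f y' t' ↔ ∃ n : ℤ, y' = (f ^ n) y ∧ t' = t - n := by
  refine Quotient.eq.trans (exists_congr fun n => ?_)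
  simp [Prod.ext_iff]

theorem mk_zpow (n : ℤ) (y : Y) (t : ℝ) : mk f ((f ^ n) y) (t - n) = mk f y t :=
  (mk_eq_iff.2 ⟨n, rfl, rfl⟩).symm

theorem mk_apply (y : Y) (t : ℝ) : mk f (f y) (t - 1) = mk f y t := by
  have := mk_zpow (f := f) 1 y t
  simpa using this

theorem continuous_mk : Continuous fun q : Y × ℝ => mk f q.1 q.2 := continuous_quotient_mk'

theorem isOpenQuotientMap_mk : IsOpenQuotientMap fun q : Y × ℝ => mk f q.1 q.2 := by
  refine ⟨Quotient.mk_surjective, continuous_mk, fun U hU => ?_⟩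
  refine isOpen_coinduced.2 ?_
  have : (fun q : Y × ℝ => mk f q.1 q.2) ⁻¹' ((fun q : Y × ℝ => mk f q.1 q.2) '' U) =
      ⋃ n : ℤ, (fun q : Y × ℝ => ((f ^ n) q.1, q.2 - n)) ⁻¹' U := by
    ext ⟨y, t⟩
    simp only [Set.mem_preimage, Set.mem_image, Prod.exists, Set.mem_iUnion]
    constructor
    · rintro ⟨y', t', h, e⟩
      obtain ⟨n, rfl, rfl⟩ := mk_eq_iff.1 e.symm
      exact ⟨n, h⟩
    · rintro ⟨n, h⟩
      exact ⟨_, _, h, mk_zpow n y t⟩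
  refine this ▸ isOpen_iUnion fun n => hU.preimage ?_
  exact ((f ^ n).continuous.comp continuous_fst).prodMk (continuous_snd.sub continuous_const)

instance [LocallyCompactSpace Y] : LocallyCompactSpace (Suspension f) :=
  (isOpenQuotientMap_mk (f := f)).locallyCompactSpace

instance [SecondCountableTopology Y] : SecondCountableTopology (Suspension f) :=
  (isOpenQuotientMap_mk (f := f)).isQuotientMap.secondCountableTopology
    (isOpenQuotientMap_mk (f := f)).isOpenMap

instance [T2Space Y] : T2Space (Suspension f) := by
  rw [t2Space_iff_of_isOpenQuotientMap (isOpenQuotientMap_mk (f := f))]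
  have : {q : (Y × ℝ) × (Y × ℝ) | mk f q.1.1 q.1.2 = mk f q.2.1 q.2.2} =
      ⋃ n : ℤ, {q : (Y × ℝ) × (Y × ℝ) | q.2.1 = (f ^ n) q.1.1 ∧ q.1.2 - q.2.2 = n} := by
    ext q
    simp only [Set.mem_ofPred_eq, mk_eq_iff, Set.mem_iUnion]
    refine exists_congr fun n => and_congr_right fun _ => ?_
    constructor <;> intro h <;> linarith
  rw [this]
  have hd : Continuous fun q : (Y × ℝ) × (Y × ℝ) => q.1.2 - q.2.2 := by fun_prop
  refine LocallyFinite.isClosed_iUnion ?_ fun n => ?_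
  · have h1 : LocallyFinite fun n : ℤ => ({(n : ℝ)} : Set ℝ) := by
      intro a
      refine ⟨Metric.ball a 1, Metric.ball_mem_nhds _ one_pos, ?_⟩
      refine (Set.finite_Icc ⌊a - 1⌋ ⌈a + 1⌉).subset ?_
      rintro n ⟨b, rfl, hb⟩
      rw [Metric.mem_ball, Real.dist_eq, abs_lt] at hb
      exact ⟨Int.cast_le.1 ((Int.floor_le _).trans (by linarith) : ((⌊a - 1⌋ : ℤ) : ℝ) ≤ n),
        Int.cast_le.1 (le_trans (by linarith) (Int.le_ceil _) : (n : ℝ) ≤ (⌈a + 1⌉ : ℤ))⟩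
    exact (h1.preimage_continuous hd).subset fun n q hq => hq.2
  · exact (isClosed_eq (by fun_prop) ((f ^ n).continuous.comp (by fun_prop))).inter
      (isClosed_eq hd continuous_const)

theorem semiconj_zpow {φ : Y → Z} (hφ : ∀ y, φ (f y) = f' (φ y)) (n : ℤ) (y : Y) :
    φ ((f ^ n) y) = (f' ^ n) (φ y) := by
  induction n generalizing y with
  | zero => rfl
  | succ n ih => simp only [zpow_add_one, Homeomorph.mul_apply, ih, hφ]
  | pred n ih =>
    simp only [zpow_sub_one, Homeomorph.mul_apply, ih]
    congr 1
    apply f'.injective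
    rw [← hφ]
    change φ (f (f.symm y)) = f' (f'.symm (φ y))
    simp

/-- The map induced on suspensions by a map intertwining two homeomorphisms. -/
def map (φ : Y → Z) (hφ : ∀ y, φ (f y) = f' (φ y)) : Suspension f → Suspension f' :=
  Quotient.lift (fun q : Y × ℝ => mk f' (φ q.1) q.2) (by
    rintro q _ ⟨n, rfl⟩
    exact mk_eq_iff.2 ⟨n, semiconj_zpow hφ n q.1, rfl⟩)

@[simp]
theorem map_mk (φ : Y → Z) (hφ : ∀ y, φ (f y) = f' (φ y)) (y : Y) (t : ℝ) :
    map φ hφ (mk f y t) = mk f' (φ y) t := rfl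

theorem continuous_map {φ : Y → Z} (hφ : ∀ y, φ (f y) = f' (φ y)) (hc : Continuous φ) :
    Continuous (map φ hφ) :=
  Continuous.quotient_lift (continuous_mk.comp (by fun_prop : Continuous
    fun q : Y × ℝ => (φ q.1, q.2))) _

/-- The flow on the suspension: `s • [y, t] = [y, t + s]`. -/
def flow (f : Y ≃ₜ Y) (s : ℝ) : Suspension f ≃ₜ Suspension f where
  toFun := Quotient.map (fun q : Y × ℝ => (q.1, q.2 + s)) (by
    rintro q _ ⟨n, rfl⟩
    exact ⟨n, by simp; ring⟩)
  invFun := Quotient.map (fun q : Y × ℝ => (q.1, q.2 - s)) (by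
    rintro q _ ⟨n, rfl⟩
    exact ⟨n, by simp; ring⟩)
  left_inv := ind fun y t => congrArg (mk f y) (add_sub_cancel_right t s)
  right_inv := ind fun y t => congrArg (mk f y) (sub_add_cancel t s)
  continuous_toFun := Continuous.quotient_map' (by fun_prop) _
  continuous_invFun := Continuous.quotient_map' (by fun_prop) _

@[simp]
theorem flow_mk (s : ℝ) (y : Y) (t : ℝ) : flow f s (mk f y t) = mk f y (t + s) := rfl

/-- The maps `y ↦ [y, t]` are proper. -/
theorem isCompact_preimage_mk [LocallyCompactSpace Y] [T2Space Y] {K : Set (Suspension f)}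
    (hK : IsCompact K) (t : ℝ) : IsCompact ((fun y => mk f y t) ⁻¹' K) := by
  have hc : Continuous fun y => mk f y t :=
    continuous_mk.comp (by fun_prop : Continuous fun y : Y => (y, t))
  obtain ⟨L, hL, hKL⟩ : ∃ L : Set (Y × ℝ), IsCompact L ∧
      K ⊆ (fun q : Y × ℝ => mk f q.1 q.2) '' L := by
    choose C hC hC' using fun q : Y × ℝ => exists_compact_mem_nhds q
    obtain ⟨T, hT⟩ := hK.elim_nhds_subcover'
      (fun a _ => (fun q : Y × ℝ => mk f q.1 q.2) '' C a.out) (fun a _ => by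
        have := (isOpenQuotientMap_mk (f := f)).isOpenMap.image_mem_nhds (hC' a.out)
        have e : mk f a.out.1 a.out.2 = a := Quotient.out_eq a
        rwa [e] at this)
    refine ⟨⋃ a ∈ T, C (a : Suspension f).out, T.isCompact_biUnion fun a _ => hC _, ?_⟩
    rwa [Set.image_iUnion₂]
  obtain ⟨N, hN⟩ := (hL.image continuous_snd).isBounded.exists_norm_le
  have hfin : Set.Finite {n : ℤ | |t - n| ≤ N} := by
    refine (Set.finite_Icc ⌊t - N⌋ ⌈t + N⌉).subset fun n hn => ?_
    have hn' := abs_le.1 (show |t - n| ≤ N from hn)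
    exact ⟨Int.cast_le.1 ((Int.floor_le _).trans (by linarith) : ((⌊t - N⌋ : ℤ) : ℝ) ≤ n),
      Int.cast_le.1 (le_trans (by linarith) (Int.le_ceil _) : (n : ℝ) ≤ (⌈t + N⌉ : ℤ))⟩
  refine (hfin.isCompact_biUnion (f := fun n : ℤ => (f ^ n) ⁻¹' (Prod.fst '' L)) fun n _ =>
    (f ^ n).isCompact_preimage.2 (hL.image continuous_fst)).of_isClosed_subset
    (hK.isClosed.preimage hc) fun y hy => ?_
  obtain ⟨q, hq, e⟩ := hKL hy
  obtain ⟨n, h1, h2⟩ := mk_eq_iff.1 e.symm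
  refine Set.mem_biUnion (x := n) ?_ ⟨q, hq, h1⟩
  have := hN q.2 ⟨q, hq, rfl⟩
  rwa [h2, Real.norm_eq_abs] at this

end Suspension

namespace TopGroupoid

variable {G X : Type*} [TopologicalSpace G] [TopologicalSpace X] {𝒢 : TopGroupoid G X}

namespace Aut

variable (α : 𝒢.Aut)

theorem unit_base (x : X) : 𝒢.unit (α.base x) = α.arrow (𝒢.unit x) := by
  have h1 : 𝒢.s (𝒢.unit x) = 𝒢.r (𝒢.unit x) := by rw [𝒢.s_unit, 𝒢.r_unit]
  have h2 : 𝒢.s (α.arrow (𝒢.unit x)) = 𝒢.r (α.arrow (𝒢.unit x)) := by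
    rw [α.s_arrow, α.r_arrow, h1]
  have h3 : 𝒢.mul (𝒢.unit x) (𝒢.unit x) = 𝒢.unit x := by
    have := 𝒢.mul_unit (𝒢.unit x)
    rwa [𝒢.s_unit] at this
  have h4 := 𝒢.mul_inv_cancel_right h2
  rw [← α.arrow_mul _ _ h1, h3, 𝒢.mul_inv, α.r_arrow, 𝒢.r_unit] at h4
  exact h4

theorem inv_arrow (g : G) : 𝒢.inv (α.arrow g) = α.arrow (𝒢.inv g) := by
  have h1 : 𝒢.s g = 𝒢.r (𝒢.inv g) := (𝒢.r_inv g).symm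
  refine 𝒢.inv_eq_of_mul (by rw [α.s_arrow, α.r_arrow, h1]) ?_
  rw [← α.arrow_mul _ _ h1, 𝒢.mul_inv, ← α.unit_base, α.r_arrow]

theorem mul_zpow {g h : G} (hgh : 𝒢.s g = 𝒢.r h) (n : ℤ) :
    (α.arrow ^ n) (𝒢.mul g h) = 𝒢.mul ((α.arrow ^ n) g) ((α.arrow ^ n) h) := by
  induction n generalizing g h with
  | zero => rfl
  | succ n ih =>
    simp only [zpow_add_one, Homeomorph.mul_apply]
    rw [α.arrow_mul _ _ hgh, ih (by rw [α.s_arrow, α.r_arrow, hgh])]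
  | pred n ih =>
    simp only [zpow_sub_one, Homeomorph.mul_apply]
    have hs : α.base (𝒢.s (α.arrow⁻¹ g)) = α.base (𝒢.r (α.arrow⁻¹ h)) := by
      rw [← α.s_arrow, ← α.r_arrow]
      simpa using hgh
    have hs' := α.base.injective hs
    rw [← ih hs']
    congr 1
    apply α.arrow.injective
    rw [α.arrow_mul _ _ hs']
    simp

open Classical in
/-- The product of the suspension groupoid: `[g, t] [h, t] = [g h, t]`. -/
def suspensionMul (p q : Suspension α.arrow) : Suspension α.arrow :=
  if H : ∃ a : G × G × ℝ, 𝒢.s a.1 = 𝒢.r a.2.1 ∧ p = .mk _ a.1 a.2.2 ∧ q = .mk _ a.2.1 a.2.2 then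
    .mk _ (𝒢.mul H.choose.1 H.choose.2.1) H.choose.2.2
  else p

theorem suspensionMul_mk {g h : G} (hgh : 𝒢.s g = 𝒢.r h) (t : ℝ) :
    α.suspensionMul (.mk _ g t) (.mk _ h t) = .mk _ (𝒢.mul g h) t := by
  have H : ∃ a : G × G × ℝ, 𝒢.s a.1 = 𝒢.r a.2.1 ∧
      Suspension.mk α.arrow g t = .mk _ a.1 a.2.2 ∧
      Suspension.mk α.arrow h t = .mk _ a.2.1 a.2.2 := ⟨(g, h, t), hgh, rfl, rfl⟩
  rw [suspensionMul, dif_pos H]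
  obtain ⟨-, h1, h2⟩ := H.choose_spec
  generalize H.choose = a at h1 h2
  obtain ⟨g', h', t'⟩ := a
  obtain ⟨n, rfl, rfl⟩ := Suspension.mk_eq_iff.1 h1
  obtain ⟨m, rfl, e⟩ := Suspension.mk_eq_iff.1 h2
  obtain rfl : m = n := by
    have : (m : ℝ) = n := by simp only at e; linarith
    exact_mod_cast this
  rw [← α.mul_zpow hgh, Suspension.mk_zpow]

theorem exists_rep {p q : Suspension α.arrow}
    (hpq : Suspension.map (f' := α.base) 𝒢.s α.s_arrow p = Suspension.map 𝒢.r α.r_arrow q) :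
    ∃ g h t, 𝒢.s g = 𝒢.r h ∧ p = .mk _ g t ∧ q = .mk _ h t := by
  induction p using Suspension.ind with | _ g t
  induction q using Suspension.ind with | _ h t'
  obtain ⟨n, h1, rfl⟩ := Suspension.mk_eq_iff.1 hpq
  exact ⟨_, h, _, (Suspension.semiconj_zpow α.s_arrow n g).trans h1.symm,
    (Suspension.mk_zpow n g t).symm, rfl⟩

theorem mk_eq_mk {g g' : G} {t : ℝ} (h : Suspension.mk α.arrow g t = .mk _ g' t) : g = g' := by
  obtain ⟨n, rfl, e⟩ := Suspension.mk_eq_iff.1 h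
  obtain rfl : n = 0 := by
    have : (n : ℝ) = 0 := by linarith
    exact_mod_cast this
  rfl

/-- The suspension of a groupoid with respect to an automorphism. -/
def suspension : TopGroupoid (Suspension α.arrow) (Suspension α.base) where
  r := Suspension.map 𝒢.r α.r_arrow
  s := Suspension.map 𝒢.s α.s_arrow
  unit := Suspension.map 𝒢.unit α.unit_base
  inv := Suspension.map 𝒢.inv α.inv_arrow
  mul := α.suspensionMul
  r_unit := Suspension.ind fun x t => by simp [𝒢.r_unit]
  s_unit := Suspension.ind fun x t => by simp [𝒢.s_unit]
  r_inv := Suspension.ind fun g t => by simp [𝒢.r_inv]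
  s_inv := Suspension.ind fun g t => by simp [𝒢.s_inv]
  r_mul p q hpq := by
    obtain ⟨g, h, t, hgh, rfl, rfl⟩ := α.exists_rep hpq
    simp [α.suspensionMul_mk hgh, 𝒢.r_mul g h hgh]
  s_mul p q hpq := by
    obtain ⟨g, h, t, hgh, rfl, rfl⟩ := α.exists_rep hpq
    simp [α.suspensionMul_mk hgh, 𝒢.s_mul g h hgh]
  mul_assoc p q u hpq hqu := by
    obtain ⟨g, h, t, hgh, rfl, rfl⟩ := α.exists_rep hpq
    obtain ⟨h', k, t', hk, e, rfl⟩ := α.exists_rep hqu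
    obtain ⟨n, rfl, rfl⟩ := Suspension.mk_eq_iff.1 e
    rw [← Suspension.mk_zpow n g t, ← Suspension.mk_zpow n h t]
    have hgh' : 𝒢.s ((α.arrow ^ n) g) = 𝒢.r ((α.arrow ^ n) h) := by
      rw [Suspension.semiconj_zpow α.s_arrow, Suspension.semiconj_zpow α.r_arrow, hgh]
    rw [α.suspensionMul_mk hgh', α.suspensionMul_mk hk, α.suspensionMul_mk, α.suspensionMul_mk,
      𝒢.mul_assoc _ _ _ hgh' hk]
    · rw [𝒢.r_mul _ _ hk, hgh']
    · rw [𝒢.s_mul _ _ hgh', hk]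
  unit_mul := Suspension.ind fun g t => by
    simp only [Suspension.map_mk]
    rw [α.suspensionMul_mk (𝒢.s_unit _), 𝒢.unit_mul]
  mul_unit := Suspension.ind fun g t => by
    simp only [Suspension.map_mk]
    rw [α.suspensionMul_mk (𝒢.r_unit _).symm, 𝒢.mul_unit]
  inv_mul := Suspension.ind fun g t => by
    simp only [Suspension.map_mk]
    rw [α.suspensionMul_mk (𝒢.s_inv _), 𝒢.inv_mul]
  mul_inv := Suspension.ind fun g t => by
    simp only [Suspension.map_mk]
    rw [α.suspensionMul_mk (𝒢.r_inv _).symm, 𝒢.mul_inv]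
  continuous_r := Suspension.continuous_map _ 𝒢.continuous_r
  continuous_s := Suspension.continuous_map _ 𝒢.continuous_s
  continuous_unit := Suspension.continuous_map _ 𝒢.continuous_unit
  continuous_inv := Suspension.continuous_map _ 𝒢.continuous_inv
  continuousOn_mul := by
    rintro ⟨p, q⟩ hpq
    obtain ⟨g, h, t, hgh, rfl, rfl⟩ := α.exists_rep hpq
    intro W hW
    simp only [α.suspensionMul_mk hgh] at hW
    have hW' := Suspension.continuous_mk.continuousAt (x := (𝒢.mul g h, t)) hW
    rw [Filter.mem_map, nhds_prod_eq, Filter.mem_prod_iff] at hW'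
    obtain ⟨V, hV, I, hI, hVI⟩ := hW'
    have hm := 𝒢.continuousOn_mul (g, h) hgh hV
    rw [Filter.mem_map, mem_nhdsWithin_iff_exists_mem_nhds_inter] at hm
    obtain ⟨U, hU, hUV⟩ := hm
    rw [nhds_prod_eq, Filter.mem_prod_iff] at hU
    obtain ⟨A, hA, B, hB, hAB⟩ := hU
    have hJ : I ∩ Metric.ball t (1 / 2) ∈ 𝓝 t :=
      Filter.inter_mem hI (Metric.ball_mem_nhds _ (by norm_num))
    have hA' := (Suspension.isOpenQuotientMap_mk (f := α.arrow)).isOpenMap.image_mem_nhds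
      (prod_mem_nhds hA hJ)
    have hB' := (Suspension.isOpenQuotientMap_mk (f := α.arrow)).isOpenMap.image_mem_nhds
      (prod_mem_nhds hB hJ)
    rw [Filter.mem_map, mem_nhdsWithin_iff_exists_mem_nhds_inter]
    refine ⟨_, prod_mem_nhds hA' hB', ?_⟩
    rintro ⟨_, _⟩ ⟨⟨⟨⟨a, u⟩, ⟨ha, hu⟩, rfl⟩, ⟨⟨b, v⟩, ⟨hb, hv⟩, rfl⟩⟩, hc⟩
    obtain ⟨n, e1, e2⟩ := Suspension.mk_eq_iff.1 hc
    have hu2 := hu.2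
    have hv2 := hv.2
    rw [Metric.mem_ball, Real.dist_eq, abs_lt] at hu2 hv2
    simp only at hu2 hv2 e1 e2
    obtain rfl : n = 0 := by
      have h1 : (n : ℝ) < 1 := by linarith [hu2.2, hv2.1]
      have h2 : (-1 : ℝ) < n := by linarith [hu2.1, hv2.2]
      have h1' : n < 1 := by exact_mod_cast h1
      have h2' : -1 < n := by exact_mod_cast h2
      omega
    obtain rfl : v = u := by simpa using e2
    have hab : 𝒢.s a = 𝒢.r b := by simpa using e1.symm
    change α.suspensionMul _ _ ∈ W
    rw [α.suspensionMul_mk hab]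
    exact hVI (Set.mk_mem_prod (hUV ⟨hAB (Set.mk_mem_prod ha hb), hab⟩) hu.1)

/-- The automorphism `θ_s : [g, t] ↦ [g, t + s]` of the suspension groupoid. -/
def suspensionFlow (s : ℝ) : α.suspension.Aut where
  arrow := Suspension.flow α.arrow s
  base := Suspension.flow α.base s
  r_arrow := Suspension.ind fun _ _ => rfl
  s_arrow := Suspension.ind fun _ _ => rfl
  arrow_mul p q hpq := by
    obtain ⟨g, h, t, hgh, rfl, rfl⟩ := α.exists_rep hpq
    change Suspension.flow α.arrow s (α.suspensionMul _ _) =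
      α.suspensionMul (Suspension.flow α.arrow s _) (Suspension.flow α.arrow s _)
    rw [α.suspensionMul_mk hgh]
    simp only [Suspension.flow_mk]
    rw [α.suspensionMul_mk hgh]

end Aut

namespace HaarSystem

variable [MeasurableSpace G]

/-- The automorphism `α` preserves the Haar system `lam` with density `ρ`: a continuous function
with values in `(0, ∞)` whose restriction to each range fibre `G^{α(x)}` is the Radon-Nikodym
derivative of `α_* λ^x` with respect to `λ^{α(x)}`.  As `ρ` is positive, the two measures are then
in the same class. -/
structure Density (lam : 𝒢.HaarSystem) (α : 𝒢.Aut) where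
  ρ : G → ℝ
  continuous_ρ : Continuous ρ
  pos : ∀ g, 0 < ρ g
  map_eq : ∀ x, (lam.meas x).map α.arrow =
    (lam.meas (α.base x)).withDensity fun g => ENNReal.ofReal (ρ g)

namespace Density

variable {lam : 𝒢.HaarSystem} {α : 𝒢.Aut} (d : lam.Density α)

theorem continuous_rpow {u : G → G} (hu : Continuous u) (c : ℝ) :
    Continuous fun g => d.ρ (u g) ^ c :=
  (d.continuous_ρ.comp hu).rpow_const fun g => Or.inl (d.pos (u g)).ne'

/-- The function `γ ↦ (ρ(γ⁻¹) ρ(γ))^{1/2} f(α⁻¹(γ))`. -/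
def twist (f : C_c(G, ℂ)) : C_c(G, ℂ) where
  toFun g := ((d.ρ (𝒢.inv g) ^ (1 / 2 : ℝ) * d.ρ g ^ (1 / 2 : ℝ) : ℝ) : ℂ) * f (α.arrow.symm g)
  continuous_toFun := (Complex.continuous_ofReal.comp
    ((d.continuous_rpow 𝒢.continuous_inv _).mul (d.continuous_rpow continuous_id _))).mul
    (f.continuous.comp α.arrow.symm.continuous)
  hasCompactSupport' := (f.hasCompactSupport.comp_homeomorph α.arrow.symm).mul_left

/-- The function `f̂(t, ·) : γ ↦ ρ(γ)^{-t/2} ρ(γ⁻¹)^{-t/2} f([γ, t])`. -/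
def hat [T2Space G] [LocallyCompactSpace G] (f : C_c(Suspension α.arrow, ℂ)) (t : ℝ) :
    C_c(G, ℂ) where
  toFun g := ((d.ρ g ^ (-t / 2) * d.ρ (𝒢.inv g) ^ (-t / 2) : ℝ) : ℂ) * f (.mk α.arrow g t)
  continuous_toFun := (Complex.continuous_ofReal.comp
    ((d.continuous_rpow continuous_id _).mul (d.continuous_rpow 𝒢.continuous_inv _))).mul
    (f.continuous.comp (Suspension.continuous_mk.comp (continuous_id.prodMk continuous_const)))
  hasCompactSupport' := HasCompactSupport.intro
    (Suspension.isCompact_preimage_mk f.hasCompactSupport t) fun g hg => by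
      rw [image_eq_zero_of_notMem_tsupport (f := f) (x := .mk α.arrow g t) hg, mul_zero]

end Density

end HaarSystem

end TopGroupoid

/-! ### Mapping tori -/

section MappingTorus

variable {A : Type*} [NonUnitalCStarAlgebra A]

/-- The mapping torus `{h ∈ C([0,1], A) : β(h(1)) = h(0)}` of an automorphism `β` of `A`. -/
def mappingTorus (β : A ≃⋆ₐ[ℂ] A) : NonUnitalStarSubalgebra ℂ C(unitInterval, A) where
  carrier := {h | β (h 1) = h 0}
  add_mem' {a b} ha hb := by
    change β (a 1 + b 1) = a 0 + b 0
    rw [map_add, ha, hb]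
  zero_mem' := map_zero β
  mul_mem' {a b} ha hb := by
    change β (a 1 * b 1) = a 0 * b 0
    rw [map_mul, ha, hb]
  smul_mem' c a ha := by
    change β (c • a 1) = c • a 0
    rw [map_smul, ha]
  star_mem' {a} ha := by
    change β (star (a 1)) = star (a 0)
    rw [map_star, ha]

/-- The extension of an element `h` of the mapping torus of `β` to the function on `ℝ` with
`h(u) = β(h(u + 1))` for all `u`. -/
def mappingTorusExtend {β : A ≃⋆ₐ[ℂ] A} (h : mappingTorus β) (u : ℝ) : A :=
  (β ^ (-⌊u⌋)) (h.1 ⟨Int.fract u, Int.fract_nonneg u, (Int.fract_lt_one u).le⟩)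

theorem mappingTorusExtend_add_one {β : A ≃⋆ₐ[ℂ] A} (h : mappingTorus β) (u : ℝ) :
    β (mappingTorusExtend h (u + 1)) = mappingTorusExtend h u := by
  simp only [mappingTorusExtend, Int.floor_add_one, Int.fract_add_one]
  rw [← StarAlgEquiv.mul_apply, ← zpow_one_add]
  congr 2
  ring

theorem mappingTorusExtend_coe {β : A ≃⋆ₐ[ℂ] A} (h : mappingTorus β) (t : unitInterval) :
    mappingTorusExtend h t = h.1 t := by
  obtain ⟨t, ht⟩ := t
  rcases ht.2.lt_or_eq with h1 | rfl
  · have e : ⌊t⌋ = 0 := Int.floor_eq_zero_iff.2 ⟨ht.1, h1⟩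
    simp [mappingTorusExtend, e, Int.fract_eq_self.2 ⟨ht.1, h1⟩]
  · have h2 : β (h.1 1) = h.1 0 := h.2
    simp only [mappingTorusExtend, Int.floor_one, Int.fract_one, zpow_neg, zpow_one]
    change β.symm (h.1 0) = h.1 1
    rw [← h2, StarAlgEquiv.symm_apply_apply]

end MappingTorus

end

/-!
Restricting functions on the suspension to the slice `𝒢 × {t}`, and composing functions on `𝒢` with
`α⁻¹`, are both weighted pullbacks along a groupoid homomorphism which carries each Haar measure to
a multiple of another one. Since left translations preserve the Haar system and commute with `α`,
the density is left invariant, hence `ρ(γ) = ρ(s(γ))`: the weights are powers of functions on the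
base, a weighted pullback respects convolution and involution, and on each fibre it is, up to a
scalar, isometric for the `L²` norms.

The norm of the reduced algebra is a supremum over the fibres. So a weighted pullback does not
increase it, and a jointly surjective family of them determines it: the norm of `f` on the
suspension is the supremum over `t ∈ [0, 1]` of the norms of its restrictions `f̂(t)`. Hence
`f ↦ f̂` extends to an isometric homomorphism into the mapping torus. Its image is a module over
the continuous functions on the circle and has dense fibres, so it is dense by a partition of unity
on the circle, and closed because it is complete. The flow shifts `f̂`, which gives the group law,
the strong continuity and the equivariance at once.
-/

noncomputable section

theorem exists_compactlySupported_eqOn_one {Y : Type*} [TopologicalSpace Y] [RegularSpace Y]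
    [LocallyCompactSpace Y] {K : Set Y} (hK : IsCompact K) :
    ∃ χ : C_c(Y, ℂ), ∀ y ∈ K, χ y = 1 := by
  obtain ⟨χ, hχ, -, hχc, -⟩ :=
    exists_continuous_one_zero_of_isCompact hK isClosed_empty (Set.disjoint_empty K)
  refine ⟨⟨⟨fun y => (χ y : ℂ), by fun_prop⟩, hχc.comp_left Complex.ofReal_zero⟩, fun y hy => ?_⟩
  exact congrArg Complex.ofReal (hχ hy)

theorem exists_compactlySupported_comp_eq {Y Z : Type*} [TopologicalSpace Y] [TopologicalSpace Z]
    [NormalSpace Z] [RegularSpace Z] [LocallyCompactSpace Z] {e : Y → Z} (he : IsClosedEmbedding e)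
    (ψ : C_c(Y, ℂ)) : ∃ f : C_c(Z, ℂ), ∀ y, f (e y) = ψ y := by
  obtain ⟨E, hE⟩ := ContinuousMap.exists_extension he (ψ : C(Y, ℂ))
  obtain ⟨χ, hχ⟩ :=
    exists_compactlySupported_eqOn_one (ψ.hasCompactSupport.isCompact.image he.continuous)
  refine ⟨⟨⟨fun z => χ z * E z, by fun_prop⟩, χ.hasCompactSupport.mul_right⟩, fun y => ?_⟩
  have hEy : E (e y) = ψ y := DFunLike.congr_fun hE y
  change χ (e y) * E (e y) = ψ y
  rw [hEy]
  by_cases hy : y ∈ tsupport ψ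
  · rw [hχ _ (Set.mem_image_of_mem e hy), one_mul]
  · rw [image_eq_zero_of_notMem_tsupport hy, mul_zero]

theorem surjective_of_isometry_of_denseRange {Y Z : Type*} [EMetricSpace Y] [CompleteSpace Y]
    [EMetricSpace Z] {Φ : Y → Z} (hΦ : Isometry Φ) (hd : DenseRange Φ) : Function.Surjective Φ := by
  have hclosed : IsClosed (Set.range Φ) := hΦ.isClosedEmbedding.isClosed_range
  exact Set.range_eq_univ.1 (hclosed.closure_eq ▸ hd.closure_range)

theorem map_withDensity_comp {Y Z : Type*} [MeasurableSpace Y] [MeasurableSpace Z] (μ : Measure Y)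
    {T : Y → Z} (hT : AEMeasurable T μ) {k : Z → ℝ≥0∞} (hk : Measurable k) :
    (μ.withDensity fun y => k (T y)).map T = (μ.map T).withDensity k := by
  have hT' : AEMeasurable T (μ.withDensity fun y => k (T y)) :=
    hT.mono_ac (withDensity_absolutelyContinuous _ _)
  refine Measure.ext fun s hs => ?_
  have hs' : NullMeasurableSet (T ⁻¹' s) μ := hT.nullMeasurable hs
  rw [Measure.map_apply_of_aemeasurable hT' hs, withDensity_apply _ hs,
    withDensity_apply₀ _ hs', ← lintegral_indicator hs, ← lintegral_indicator₀ hs',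
    lintegral_map' (hk.indicator hs).aemeasurable hT]
  rfl

theorem integral_map_withDensity_ofReal {Y Z : Type*} [MeasurableSpace Y] [MeasurableSpace Z]
    {μ : Measure Y} {w : Y → ℝ} (hw : Measurable w) (hw₀ : ∀ y, 0 ≤ w y) {T : Y → Z}
    (hT : Measurable T) {F : Z → ℂ}
    (hF : AEStronglyMeasurable F ((μ.withDensity fun y => ENNReal.ofReal (w y)).map T)) :
    ∫ z, F z ∂((μ.withDensity fun y => ENNReal.ofReal (w y)).map T) =
      ∫ y, (w y : ℂ) * F (T y) ∂μ := by
  rw [integral_map hT.aemeasurable hF, integral_withDensity_eq_integral_toReal_smul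
    hw.ennreal_ofReal (Eventually.of_forall fun _ => ENNReal.ofReal_lt_top)]
  refine integral_congr_ae (Eventually.of_forall fun y => ?_)
  simp only [ENNReal.toReal_ofReal (hw₀ y)]
  rfl

theorem eqOn_support_of_ae_eq {Y Z : Type*} [TopologicalSpace Y] [HereditarilyLindelofSpace Y]
    [MeasurableSpace Y] [TopologicalSpace Z] [T2Space Z] {μ : Measure Y} {f g : Y → Z}
    (hf : ContinuousOn f μ.support) (hg : ContinuousOn g μ.support) (hfg : f =ᵐ[μ] g) :
    Set.EqOn f g μ.support := by
  intro y hy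
  by_contra hne
  have hnhds : ∀ᶠ z in 𝓝[μ.support] y, f z ≠ g z :=
    ((hf y hy).prodMk_nhds (hg y hy)).eventually (isClosed_diagonal.isOpen_compl.mem_nhds hne)
  rw [eventually_nhdsWithin_iff] at hnhds
  have hnull := ae_iff.1 (hfg.and (Measure.support_mem_ae (μ := μ)))
  refine ((Measure.mem_support_iff_forall y).1 hy _ hnhds).ne' (measure_mono_null ?_ hnull)
  exact fun z hz hcon => hz hcon.2 hcon.1

namespace TopGroupoid

variable {G X : Type*} [TopologicalSpace G] [TopologicalSpace X]

section Algebra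

variable (𝒢 : TopGroupoid G X)

theorem mul_inv_cancel_left {g h : G} (hgh : 𝒢.r h = 𝒢.r g) :
    𝒢.mul h (𝒢.mul (𝒢.inv h) g) = g := by
  have := 𝒢.inv_mul_cancel_left ((𝒢.s_inv h).trans hgh)
  rwa [𝒢.inv_inv] at this

theorem eq_unit_of_mul_self {g : G} (hg : 𝒢.s g = 𝒢.r g) (h : 𝒢.mul g g = g) :
    g = 𝒢.unit (𝒢.r g) := by
  have := 𝒢.mul_inv_cancel_right hg
  rw [h, 𝒢.mul_inv] at this
  exact this.symm

theorem isCompact_image_mul [T2Space G] {K L : Set G} (hK : IsCompact K) (hL : IsCompact L) :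
    IsCompact ((fun p : G × G => 𝒢.mul p.1 p.2) '' (K ×ˢ L ∩ {p | 𝒢.s p.1 = 𝒢.r p.2})) := by
  have := 𝒢.t2_base
  have hclosed : IsClosed {p : G × G | 𝒢.s p.1 = 𝒢.r p.2} :=
    isClosed_eq (𝒢.continuous_s.comp continuous_fst) (𝒢.continuous_r.comp continuous_snd)
  exact ((hK.prod hL).inter_right hclosed).image_of_continuousOn
    (𝒢.continuousOn_mul.mono Set.inter_subset_right)

end Algebra

variable {𝒢 : TopGroupoid G X}

/-- The product `k ∘ s · φ`, through which continuous functions on the base act on `C_c(G)`. -/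
def mulSource (𝒢 : TopGroupoid G X) (k : C(X, ℂ)) (φ : C_c(G, ℂ)) : C_c(G, ℂ) where
  toFun g := k (𝒢.s g) * φ g
  continuous_toFun := (k.continuous.comp 𝒢.continuous_s).mul φ.continuous
  hasCompactSupport' := φ.hasCompactSupport.mul_left

/-- The function `g ↦ |φ(g⁻¹)|²`, whose integrals along the range fibres are the fibrewise
squared norms of `φ`. -/
def normSqInv (𝒢 : TopGroupoid G X) (φ : C_c(G, ℂ)) : C_c(G, ℂ) where
  toFun g := φ (𝒢.inv g) * conj (φ (𝒢.inv g))
  continuous_toFun := by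
    have := 𝒢.continuous_inv
    fun_prop
  hasCompactSupport' := (φ.hasCompactSupport.comp_homeomorph 𝒢.invHomeo).mul_right

/-- The pointwise absolute value of a compactly supported function, with values in `ℂ` so that it
can be convolved. -/
def absCc (φ : C_c(G, ℂ)) : C_c(G, ℂ) where
  toFun g := (‖φ g‖ : ℂ)
  continuous_toFun := by fun_prop
  hasCompactSupport' := φ.hasCompactSupport.norm.comp_left Complex.ofReal_zero

variable [T2Space G] [LocallyCompactSpace G] [SecondCountableTopology G]
  [MeasurableSpace G] [BorelSpace G]

namespace HaarSystem

variable (lam : 𝒢.HaarSystem)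

/-! ### The convolution algebra -/

theorem convFun_inv_mul (f φ : C_c(G, ℂ)) {k g : G} (hk : 𝒢.r k = 𝒢.r g) :
    lam.convFun f φ (𝒢.mul (𝒢.inv k) g) =
      ∫ h, f (𝒢.mul (𝒢.inv k) h) * φ (𝒢.mul (𝒢.inv h) g) ∂(lam.meas (𝒢.r g)) := by
  have hkg : 𝒢.s (𝒢.inv k) = 𝒢.r g := (𝒢.s_inv k).trans hk
  have hr : 𝒢.r (𝒢.mul (𝒢.inv k) g) = 𝒢.r (𝒢.inv k) := 𝒢.r_mul _ _ hkg
  have hint := (lam.integrable_conv f φ (𝒢.mul (𝒢.inv k) g)).aestronglyMeasurable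
  rw [hr, ← lam.map_mul_left (𝒢.inv k)] at hint
  rw [convFun, hr, ← lam.map_mul_left (𝒢.inv k), integral_map (lam.aemeasurable_mul _) hint, hkg]
  refine integral_congr_ae ?_
  filter_upwards [lam.ae_r (𝒢.r g)] with h hh
  have hkh : 𝒢.s (𝒢.inv k) = 𝒢.r h := hkg.trans hh.symm
  have hhk : 𝒢.s (𝒢.inv h) = 𝒢.r k := by rw [𝒢.s_inv, hh, hk]
  rw [𝒢.inv_mul_rev hkh, 𝒢.inv_inv,
    𝒢.mul_assoc _ _ _ hhk (by rw [𝒢.r_mul _ _ hkg, 𝒢.r_inv]), 𝒢.mul_inv_cancel_left hk]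

theorem exists_conv_assoc_integrand (f g φ : C_c(G, ℂ)) (γ : G) : ∃ H : G → G → ℂ,
    Continuous (Function.uncurry H) ∧ HasCompactSupport (Function.uncurry H) ∧
    ∀ k h, 𝒢.r k = 𝒢.r γ → 𝒢.r h = 𝒢.r γ →
      H k h = f k * g (𝒢.mul (𝒢.inv k) h) * φ (𝒢.mul (𝒢.inv h) γ) := by
  obtain ⟨χ, hχ⟩ := exists_compactlySupported_eqOn_one
    (𝒢.isCompact_image_mul f.hasCompactSupport.isCompact g.hasCompactSupport.isCompact)
  obtain ⟨F, K, hK, hF, hFK, hFfg⟩ := exists_conv_integrand (𝒢 := 𝒢) f g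
  obtain ⟨F', K', hK', hF', hFK', hFχφ⟩ := exists_conv_integrand (𝒢 := 𝒢) χ φ
  refine ⟨fun k h => F k h * F' h γ, hF.mul (hF'.comp (by fun_prop : Continuous fun q : G × G =>
    (q.2, γ))), HasCompactSupport.intro (hK.prod hK') fun q hq => ?_, fun k h hk hh => ?_⟩
  · rcases not_and_or.1 hq with hq | hq
    · exact mul_eq_zero_of_left (hFK _ _ hq) _
    · exact mul_eq_zero_of_right _ (hFK' _ _ hq)
  · change F k h * F' h γ = _
    rw [hFfg h k (hk.trans hh.symm), hFχφ γ h hh]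
    by_cases hfg : f k * g (𝒢.mul (𝒢.inv k) h) = 0
    · rw [hfg, zero_mul, zero_mul]
    have hkh : 𝒢.s (𝒢.inv k) = 𝒢.r h := by rw [𝒢.s_inv, hk, hh]
    have hχh : χ h = 1 := by
      refine hχ h ⟨(k, 𝒢.mul (𝒢.inv k) h), ⟨⟨?_, ?_⟩, ?_⟩, 𝒢.mul_inv_cancel_left (hk.trans hh.symm)⟩
      · exact subset_tsupport f (left_ne_zero_of_mul hfg)
      · exact subset_tsupport g (right_ne_zero_of_mul hfg)
      · exact ((𝒢.r_mul _ _ hkh).trans (𝒢.r_inv k)).symm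
    rw [hχh, one_mul]

theorem conv_assoc (f g φ : C_c(G, ℂ)) :
    lam.conv (lam.conv f g) φ = lam.conv f (lam.conv g φ) := by
  ext γ
  obtain ⟨H, hH, hHc, hHfgφ⟩ := exists_conv_assoc_integrand (𝒢 := 𝒢) f g φ γ
  have hleft : lam.convFun (lam.conv f g) φ γ =
      ∫ h, ∫ k, H k h ∂(lam.meas (𝒢.r γ)) ∂(lam.meas (𝒢.r γ)) := by
    refine integral_congr_ae ?_
    filter_upwards [lam.ae_r (𝒢.r γ)] with h hh
    change lam.convFun f g h * _ = _
    rw [convFun, ← integral_mul_const, hh]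
    refine integral_congr_ae ?_
    filter_upwards [lam.ae_r (𝒢.r γ)] with k hk
    rw [hHfgφ k h hk hh]
  have hright : lam.convFun f (lam.conv g φ) γ =
      ∫ k, ∫ h, H k h ∂(lam.meas (𝒢.r γ)) ∂(lam.meas (𝒢.r γ)) := by
    refine integral_congr_ae ?_
    filter_upwards [lam.ae_r (𝒢.r γ)] with k hk
    change f k * lam.convFun g φ (𝒢.mul (𝒢.inv k) γ) = _
    rw [lam.convFun_inv_mul g φ hk, ← integral_const_mul]
    refine integral_congr_ae ?_
    filter_upwards [lam.ae_r (𝒢.r γ)] with h hh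
    rw [hHfgφ k h hk hh, _root_.mul_assoc]
  exact hleft.trans
    ((integral_integral_swap_of_hasCompactSupport hH hHc).symm.trans hright.symm)

theorem conv_add_left (f f' φ : C_c(G, ℂ)) :
    lam.conv (f + f') φ = lam.conv f φ + lam.conv f' φ := by
  ext g
  have := integral_add (lam.integrable_conv f φ g) (lam.integrable_conv f' φ g)
  simp only [← add_mul] at this
  exact this

theorem conv_smul_left (c : ℂ) (f φ : C_c(G, ℂ)) :
    lam.conv (c • f) φ = c • lam.conv f φ := by
  ext g
  have := integral_const_mul (μ := lam.meas (𝒢.r g)) c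
    (fun g' => f g' * φ (𝒢.mul (𝒢.inv g') g))
  simp only [← _root_.mul_assoc] at this
  exact this

theorem eq_rep_of_forall_ofCc {f : C_c(G, ℂ)} {T : lam.Adjointable}
    (h : ∀ φ, T.1 (lam.ofCc φ) = lam.ofCc (lam.conv f φ)) : T = lam.rep f := by
  refine Subtype.ext (ContinuousLinearMap.coeFn_injective ?_)
  refine lam.denseRange_ofCc.equalizer T.1.continuous (lam.rep f).1.continuous ?_
  funext φ
  exact (h φ).trans (lam.convCLM_ofCc f φ).symm

theorem rep_add (f f' : C_c(G, ℂ)) : lam.rep (f + f') = lam.rep f + lam.rep f' := by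
  refine (lam.eq_rep_of_forall_ofCc fun φ => ?_).symm
  change lam.convCLM f (lam.ofCc φ) + lam.convCLM f' (lam.ofCc φ) = _
  rw [convCLM_ofCc, convCLM_ofCc, conv_add_left, map_add]

theorem rep_smul (c : ℂ) (f : C_c(G, ℂ)) : lam.rep (c • f) = c • lam.rep f := by
  refine (lam.eq_rep_of_forall_ofCc fun φ => ?_).symm
  change c • lam.convCLM f (lam.ofCc φ) = _
  rw [convCLM_ofCc, conv_smul_left, map_smul]

theorem rep_conv (f f' : C_c(G, ℂ)) : lam.rep (lam.conv f f') = lam.rep f * lam.rep f' := by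
  refine (lam.eq_rep_of_forall_ofCc fun φ => ?_).symm
  change lam.convCLM f (lam.convCLM f' (lam.ofCc φ)) = _
  rw [convCLM_ofCc, convCLM_ofCc, conv_assoc]

theorem rep_involution (f : C_c(G, ℂ)) : lam.rep (involution 𝒢 f) = star (lam.rep f) := by
  have hadj : lam.IsAdjoint (lam.rep f).1 (lam.rep (involution 𝒢 f)).1 := lam.isAdjoint_convCLM f
  exact (star_eq hadj).symm

/-- `C_c(G)` as a star subalgebra of the adjointable operators: the image of the convolution
algebra before taking the closure. -/
def convSubalgebra : NonUnitalStarSubalgebra ℂ lam.Adjointable where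
  carrier := Set.range lam.rep
  add_mem' := by
    rintro _ _ ⟨f, rfl⟩ ⟨f', rfl⟩
    exact ⟨f + f', lam.rep_add f f'⟩
  zero_mem' := ⟨0, by simpa only [zero_smul] using lam.rep_smul 0 0⟩
  mul_mem' := by
    rintro _ _ ⟨f, rfl⟩ ⟨f', rfl⟩
    exact ⟨lam.conv f f', lam.rep_conv f f'⟩
  smul_mem' := by
    rintro c _ ⟨f, rfl⟩
    exact ⟨c • f, lam.rep_smul c f⟩
  star_mem' := by
    rintro _ ⟨f, rfl⟩
    exact ⟨involution 𝒢 f, lam.rep_involution f⟩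

/-- The inclusion of `C_c(G)` in the reduced `C^*`-algebra as a linear map, of which every
homomorphism on the reduced algebra is an extension. -/
def toReducedₗ : C_c(G, ℂ) →ₗ[ℂ] lam.Reduced where
  toFun := lam.toReduced
  map_add' f f' := Subtype.ext (lam.rep_add f f')
  map_smul' c f := Subtype.ext (lam.rep_smul c f)

theorem toReduced_smul (c : ℂ) (f : C_c(G, ℂ)) :
    lam.toReduced (c • f) = c • lam.toReduced f := lam.toReducedₗ.map_smul c f

theorem toReduced_sub (f f' : C_c(G, ℂ)) :
    lam.toReduced (f - f') = lam.toReduced f - lam.toReduced f' := lam.toReducedₗ.map_sub f f'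

theorem toReduced_conv (f f' : C_c(G, ℂ)) :
    lam.toReduced (lam.conv f f') = lam.toReduced f * lam.toReduced f' :=
  Subtype.ext (lam.rep_conv f f')

theorem toReduced_involution (f : C_c(G, ℂ)) :
    lam.toReduced (involution 𝒢 f) = star (lam.toReduced f) :=
  Subtype.ext (lam.rep_involution f)

theorem denseRange_toReduced : DenseRange lam.toReduced := by
  have hadjoin : NonUnitalStarAlgebra.adjoin ℂ (Set.range lam.rep) ≤ lam.convSubalgebra :=
    NonUnitalStarAlgebra.adjoin_le subset_rfl
  refine Subtype.dense_iff.2 fun T hT => closure_mono (fun T' hT' => ?_) hT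
  obtain ⟨f, rfl⟩ := hadjoin hT'
  exact ⟨lam.toReduced f, ⟨f, rfl⟩, rfl⟩

/-! ### The norm of the reduced algebra -/

theorem conv_mulSource (k : C(X, ℂ)) (f φ : C_c(G, ℂ)) :
    lam.conv f (mulSource 𝒢 k φ) = mulSource 𝒢 k (lam.conv f φ) := by
  ext g
  change lam.convFun f _ g = k (𝒢.s g) * lam.convFun f φ g
  rw [convFun, convFun, ← integral_const_mul]
  refine integral_congr_ae ?_
  filter_upwards [lam.ae_r (𝒢.r g)] with h hh
  change f h * (k (𝒢.s _) * φ _) = _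
  rw [𝒢.s_mul _ _ ((𝒢.s_inv h).trans hh), mul_left_comm]

theorem toL2_mulSource (k : C(X, ℂ)) (φ : C_c(G, ℂ)) (x : X) :
    lam.toL2 (mulSource 𝒢 k φ) x = k x • lam.toL2 φ x := by
  rw [toL2, toL2, ← MemLp.toLp_const_smul, MemLp.toLp_eq_toLp_iff]
  filter_upwards [lam.ae_s x] with g hg
  change k (𝒢.s g) * φ g = k x * φ g
  rw [hg]

theorem norm_toL2_sq (φ : C_c(G, ℂ)) (x : X) :
    ((‖lam.toL2 φ x‖ ^ 2 : ℝ) : ℂ) = ∫ g, normSqInv 𝒢 φ g ∂(lam.meas x) := by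
  have hinner := inner_self_eq_norm_sq_to_K (𝕜 := ℂ) (lam.toL2 φ x)
  rw [inner_toL2, integral_fibre _ (by fun_prop)] at hinner
  rw [Complex.ofReal_pow]
  exact hinner.symm

theorem continuous_norm_toL2_sq (φ : C_c(G, ℂ)) : Continuous fun x => ‖lam.toL2 φ x‖ ^ 2 := by
  have h := Complex.continuous_re.comp (lam.continuous_integral (normSqInv 𝒢 φ))
  refine h.congr fun x => ?_
  simp only [Function.comp, ← norm_toL2_sq, Complex.ofReal_re]

theorem norm_toL2_le (φ : C_c(G, ℂ)) (x : X) : ‖lam.toL2 φ x‖ ≤ ‖lam.ofCc φ‖ :=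
  lp.norm_apply_le_norm ENNReal.top_ne_zero (lam.toL2Prod φ) x

theorem norm_ofCc_le {φ : C_c(G, ℂ)} {C : ℝ} (hC : 0 ≤ C) (h : ∀ x, ‖lam.toL2 φ x‖ ≤ C) :
    ‖lam.ofCc φ‖ ≤ C := lp.norm_le_of_forall_le hC h

theorem norm_toReduced_le {f : C_c(G, ℂ)} {C : ℝ} (hC : 0 ≤ C)
    (h : ∀ φ x, ‖lam.toL2 (lam.conv f φ) x‖ ≤ C * ‖lam.toL2 φ x‖) : ‖lam.toReduced f‖ ≤ C := by
  change ‖lam.convCLM f‖ ≤ C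
  refine ContinuousLinearMap.opNorm_le_bound _ hC fun ξ => ?_
  refine lam.denseRange_ofCc.induction_on ξ ?_ fun φ => ?_
  · exact isClosed_le (lam.convCLM f).continuous.norm (continuous_const.mul continuous_norm)
  · rw [convCLM_ofCc]
    refine lam.norm_ofCc_le (by positivity) fun x => (h φ x).trans ?_
    gcongr
    exact lam.norm_toL2_le φ x

theorem norm_toL2_conv_le_mul_sqrt (f φ : C_c(G, ℂ)) (x : X) {ε : ℝ} (hε : 0 < ε) :
    ‖lam.toL2 (lam.conv f φ) x‖ ≤ ‖lam.toReduced f‖ * √(‖lam.toL2 φ x‖ ^ 2 + ε) := by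
  have hpos : ∀ y, 0 < √(‖lam.toL2 φ y‖ ^ 2 + ε) := fun y => Real.sqrt_pos.2 (by positivity)
  -- Dividing `φ` by `√(‖φ‖² + ε)` on each source fibre puts it in the unit ball of the module.
  let k : C(X, ℂ) := ⟨fun y => (((√(‖lam.toL2 φ y‖ ^ 2 + ε))⁻¹ : ℝ) : ℂ),
    Complex.continuous_ofReal.comp <|
      ((lam.continuous_norm_toL2_sq φ).add continuous_const).sqrt.inv₀ fun y => (hpos y).ne'⟩
  have hk : ∀ y, ‖k y‖ = (√(‖lam.toL2 φ y‖ ^ 2 + ε))⁻¹ := fun y =>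
    (Complex.norm_real _).trans (Real.norm_of_nonneg (inv_nonneg.2 (hpos y).le))
  have hball : ‖lam.ofCc (mulSource 𝒢 k φ)‖ ≤ 1 := by
    refine lam.norm_ofCc_le zero_le_one fun y => ?_
    rw [toL2_mulSource, norm_smul, hk, inv_mul_le_iff₀ (hpos y), mul_one]
    exact Real.le_sqrt_of_sq_le (le_add_of_nonneg_right hε.le)
  have hconv : ‖lam.convCLM f (lam.ofCc (mulSource 𝒢 k φ))‖ ≤ ‖lam.toReduced f‖ :=
    ((lam.convCLM f).le_opNorm _).trans (mul_le_of_le_one_right (norm_nonneg _) hball)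
  rw [convCLM_ofCc, conv_mulSource] at hconv
  have hx := (lam.norm_toL2_le _ x).trans hconv
  rwa [toL2_mulSource, norm_smul, hk, inv_mul_le_iff₀ (hpos x), mul_comm] at hx

theorem norm_toL2_conv_le (f φ : C_c(G, ℂ)) (x : X) :
    ‖lam.toL2 (lam.conv f φ) x‖ ≤ ‖lam.toReduced f‖ * ‖lam.toL2 φ x‖ := by
  have hcont : Continuous fun ε : ℝ => ‖lam.toReduced f‖ * √(‖lam.toL2 φ x‖ ^ 2 + ε) := by
    fun_prop
  have hlim := (hcont.tendsto 0).mono_left (nhdsWithin_le_nhds (s := Set.Ioi 0))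
  rw [add_zero, Real.sqrt_sq (norm_nonneg _)] at hlim
  exact ge_of_tendsto hlim (eventually_mem_nhdsWithin.mono fun ε hε =>
    lam.norm_toL2_conv_le_mul_sqrt f φ x hε)

theorem norm_toL2_absCc (φ : C_c(G, ℂ)) (x : X) : ‖lam.toL2 (absCc φ) x‖ = ‖lam.toL2 φ x‖ := by
  rw [toL2, toL2, Lp.norm_toLp, Lp.norm_toLp]
  congr 1
  exact eLpNorm_congr_norm_ae (Eventually.of_forall fun g => by simp [absCc])

theorem norm_conv_le_of_dominated {f χ : C_c(G, ℂ)} {ε : ℝ} (hf : ∀ g, ‖f g‖ ≤ ε * ‖χ g‖)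
    (φ : C_c(G, ℂ)) (g : G) :
    ‖lam.conv f φ g‖ ≤ ε * ‖lam.conv (absCc χ) (absCc φ) g‖ := by
  have habs : lam.conv (absCc χ) (absCc φ) g =
      ((∫ h, ‖χ h‖ * ‖φ (𝒢.mul (𝒢.inv h) g)‖ ∂(lam.meas (𝒢.r g)) : ℝ) : ℂ) := by
    refine Eq.trans (integral_congr_ae (Eventually.of_forall fun h => ?_)) integral_ofReal
    exact (Complex.ofReal_mul _ _).symm
  have hint : Integrable (fun h => ‖χ h‖ * ‖φ (𝒢.mul (𝒢.inv h) g)‖) (lam.meas (𝒢.r g)) := by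
    simpa only [norm_mul] using (lam.integrable_conv χ φ g).norm
  rw [habs, Complex.norm_real, Real.norm_of_nonneg (integral_nonneg fun h => by positivity),
    ← integral_const_mul]
  refine norm_integral_le_of_norm_le (hint.const_mul _) (Eventually.of_forall fun h => ?_)
  rw [norm_mul, ← _root_.mul_assoc]
  gcongr
  exact hf h

theorem norm_toReduced_le_of_dominated {f χ : C_c(G, ℂ)} {ε : ℝ} (hε : 0 ≤ ε)
    (hf : ∀ g, ‖f g‖ ≤ ε * ‖χ g‖) : ‖lam.toReduced f‖ ≤ ε * ‖lam.toReduced (absCc χ)‖ := by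
  refine lam.norm_toReduced_le (by positivity) fun φ x => ?_
  calc ‖lam.toL2 (lam.conv f φ) x‖
      ≤ ε * ‖lam.toL2 (lam.conv (absCc χ) (absCc φ)) x‖ := by
        refine Lp.norm_le_mul_norm_of_ae_le_mul ?_
        filter_upwards [(lam.memLp_fibre (lam.conv f φ) x).coeFn_toLp,
          (lam.memLp_fibre (lam.conv (absCc χ) (absCc φ)) x).coeFn_toLp] with g hg hg'
        simpa only [toL2, hg, hg'] using lam.norm_conv_le_of_dominated hf φ g
    _ ≤ ε * (‖lam.toReduced (absCc χ)‖ * ‖lam.toL2 φ x‖) := by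
        rw [← lam.norm_toL2_absCc φ x]
        gcongr
        exact lam.norm_toL2_conv_le _ _ _
    _ = ε * ‖lam.toReduced (absCc χ)‖ * ‖lam.toL2 φ x‖ := (_root_.mul_assoc _ _ _).symm

theorem continuousAt_toReduced {T : Type*} [TopologicalSpace T] {F : T → C_c(G, ℂ)}
    (hF : Continuous fun q : T × G => F q.1 q.2) {t₀ : T} {K : Set G} (hK : IsCompact K)
    (hFK : ∀ᶠ t in 𝓝 t₀, ∀ g ∉ K, F t g = 0) :
    ContinuousAt (fun t => lam.toReduced (F t)) t₀ := by
  obtain ⟨χ, hχ⟩ := exists_compactlySupported_eqOn_one hK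
  set C := ‖lam.toReduced (absCc χ)‖
  refine Metric.continuousAt_iff'.2 fun ε hε => ?_
  set δ := ε / (C + 1)
  have hδ : 0 < δ := by positivity
  have hunif : ∀ᶠ t in 𝓝 t₀, ∀ g ∈ K, ‖F t g - F t₀ g‖ < δ := by
    refine hK.eventually_forall_of_forall_eventually fun g _ => ?_
    have hcont : Continuous fun q : T × G => ‖F q.1 q.2 - F t₀ q.2‖ := by fun_prop
    refine hcont.continuousAt.eventually_lt continuousAt_const ?_
    simpa only [sub_self, norm_zero] using hδ
  filter_upwards [hunif, hFK] with t ht htK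
  rw [dist_eq_norm, ← toReduced_sub]
  calc ‖lam.toReduced (F t - F t₀)‖ ≤ δ * C := by
        refine lam.norm_toReduced_le_of_dominated hδ.le fun g => ?_
        change ‖F t g - F t₀ g‖ ≤ δ * ‖χ g‖
        by_cases hg : g ∈ K
        · simpa only [hχ g hg, norm_one, mul_one] using (ht g hg).le
        · rw [htK g hg, hFK.self_of_nhds g hg, sub_self, norm_zero]
          positivity
    _ < δ * (C + 1) := mul_lt_mul_of_pos_left (lt_add_one C) hδ
    _ = ε := div_mul_cancel₀ ε (by positivity)

/-! ### Homomorphisms of reduced algebras -/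

namespace Reduced

variable {lam} {B : Type*} [NonUnitalCStarAlgebra B]

theorem hom_ext {F F' : Type*}
    [FunLike F lam.Reduced B] [NonUnitalAlgHomClass F ℂ lam.Reduced B]
    [StarHomClass F lam.Reduced B]
    [FunLike F' lam.Reduced B] [NonUnitalAlgHomClass F' ℂ lam.Reduced B]
    [StarHomClass F' lam.Reduced B] {Φ : F} {Ψ : F'}
    (h : ∀ f, Φ (lam.toReduced f) = Ψ (lam.toReduced f)) (a : lam.Reduced) : Φ a = Ψ a := by
  have hΦ : Continuous Φ := AddMonoidHomClass.continuous_of_bound Φ 1 fun a => by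
    rw [one_mul]; exact NonUnitalStarAlgHom.norm_apply_le Φ a
  have hΨ : Continuous Ψ := AddMonoidHomClass.continuous_of_bound Ψ 1 fun a => by
    rw [one_mul]; exact NonUnitalStarAlgHom.norm_apply_le Ψ a
  exact congrFun (lam.denseRange_toReduced.equalizer hΦ hΨ (funext h)) a

section Lift

variable (j : C_c(G, ℂ) →ₗ[ℂ] B)

theorem extendOfNorm_toReduced (hn : ∀ f, ‖j f‖ ≤ ‖lam.toReduced f‖) (f : C_c(G, ℂ)) :
    j.extendOfNorm lam.toReducedₗ (lam.toReduced f) = j f :=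
  LinearMap.extendOfNorm_eq lam.denseRange_toReduced ⟨1, fun f => (hn f).trans_eq (one_mul _).symm⟩
    f

variable (hn : ∀ f, ‖j f‖ ≤ ‖lam.toReduced f‖) (hm : ∀ f f', j (lam.conv f f') = j f * j f')
  (hs : ∀ f, j (involution 𝒢 f) = star (j f))

/-- The star homomorphism on the reduced `C^*`-algebra extending a star representation `j` of the
convolution algebra that is dominated by the reduced norm. -/
def lift : lam.Reduced →⋆ₙₐ[ℂ] B where
  toFun := j.extendOfNorm lam.toReducedₗ
  map_smul' := map_smul _
  map_zero' := map_zero _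
  map_add' := map_add _
  map_mul' a b := by
    have hT := (j.extendOfNorm lam.toReducedₗ).continuous
    refine lam.denseRange_toReduced.induction_on₂ (p := fun a b => j.extendOfNorm lam.toReducedₗ
      (a * b) = j.extendOfNorm lam.toReducedₗ a * j.extendOfNorm lam.toReducedₗ b)
      (isClosed_eq (by fun_prop) (by fun_prop)) (fun f f' => ?_) a b
    rw [← toReduced_conv]
    simp only [extendOfNorm_toReduced j hn, hm]
  map_star' a := by
    have hT := (j.extendOfNorm lam.toReducedₗ).continuous
    refine lam.denseRange_toReduced.induction_on (p := fun a => j.extendOfNorm lam.toReducedₗ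
      (star a) = star (j.extendOfNorm lam.toReducedₗ a)) a
      (isClosed_eq (by fun_prop) (by fun_prop)) fun f => ?_
    rw [← toReduced_involution]
    simp only [extendOfNorm_toReduced j hn, hs]

theorem lift_toReduced (f : C_c(G, ℂ)) : lift j hn hm hs (lam.toReduced f) = j f :=
  extendOfNorm_toReduced j hn f

theorem isometry_lift (hj : ∀ f, ‖j f‖ = ‖lam.toReduced f‖) :
    Isometry (lift j (fun f => (hj f).le) hm hs) := by
  have hcont : Continuous (lift j (fun f => (hj f).le) hm hs) :=
    (j.extendOfNorm lam.toReducedₗ).continuous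
  refine AddMonoidHomClass.isometry_of_norm _ fun a => ?_
  refine lam.denseRange_toReduced.induction_on
    (p := fun a => ‖lift j (fun f => (hj f).le) hm hs a‖ = ‖a‖) a
    (isClosed_eq hcont.norm continuous_norm) fun f => ?_
  rw [lift_toReduced, hj]

end Lift

end Reduced

end HaarSystem

end TopGroupoid

/-! ### Weighted homomorphisms of groupoids -/

namespace TopGroupoid

namespace HaarSystem

variable {G X G' X' : Type*} [TopologicalSpace G] [TopologicalSpace X] [TopologicalSpace G']
  [TopologicalSpace X'] {𝒢 : TopGroupoid G X} {𝒢' : TopGroupoid G' X'}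
  [MeasurableSpace G] [MeasurableSpace G']

/-- A proper continuous homomorphism of groupoids that maps the Haar system `lam`, weighted by
`weight² ∘ s`, onto the Haar system `lam'`. Functions on `𝒢'` are pulled back along it to
functions on `𝒢`, compatibly with the convolution products and the norms of the `L²`-fibres. -/
structure WeightedHom (lam : 𝒢.HaarSystem) (lam' : 𝒢'.HaarSystem) where
  arrow : G → G'
  base : X → X'
  weight : X → ℝ
  continuous_arrow : Continuous arrow
  isCompact_preimage : ∀ ⦃K⦄, IsCompact K → IsCompact (arrow ⁻¹' K)
  continuous_weight : Continuous weight
  weight_pos : ∀ x, 0 < weight x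
  r_arrow : ∀ g, 𝒢'.r (arrow g) = base (𝒢.r g)
  s_arrow : ∀ g, 𝒢'.s (arrow g) = base (𝒢.s g)
  arrow_mul : ∀ g h, 𝒢.s g = 𝒢.r h → arrow (𝒢.mul g h) = 𝒢'.mul (arrow g) (arrow h)
  map_eq : ∀ x, ((lam.meas x).withDensity fun g =>
    ENNReal.ofReal (weight (𝒢.s g) ^ 2)).map arrow = lam'.meas (base x)

namespace WeightedHom

variable {lam : 𝒢.HaarSystem} {lam' : 𝒢'.HaarSystem} (P : lam.WeightedHom lam')

theorem arrow_unit (x : X) : P.arrow (𝒢.unit x) = 𝒢'.unit (P.base x) := by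
  have hx : 𝒢.s (𝒢.unit x) = 𝒢.r (𝒢.unit x) := by rw [𝒢.s_unit, 𝒢.r_unit]
  have hidem : 𝒢.mul (𝒢.unit x) (𝒢.unit x) = 𝒢.unit x := by
    simpa only [𝒢.s_unit] using 𝒢.mul_unit (𝒢.unit x)
  have := 𝒢'.eq_unit_of_mul_self (g := P.arrow (𝒢.unit x)) (by rw [P.s_arrow, P.r_arrow, hx])
    (by rw [← P.arrow_mul _ _ hx, hidem])
  rwa [P.r_arrow, 𝒢.r_unit] at this

theorem arrow_inv (g : G) : P.arrow (𝒢.inv g) = 𝒢'.inv (P.arrow g) := by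
  refine (𝒢'.inv_eq_of_mul (by rw [P.s_arrow, P.r_arrow, 𝒢.r_inv]) ?_).symm
  rw [← P.arrow_mul _ _ (𝒢.r_inv g).symm, 𝒢.mul_inv, P.arrow_unit, P.r_arrow]

theorem continuous_weight_mul_weight :
    Continuous fun g => P.weight (𝒢.r g) * P.weight (𝒢.s g) :=
  (P.continuous_weight.comp 𝒢.continuous_r).mul (P.continuous_weight.comp 𝒢.continuous_s)

theorem weight_mul_weight_ne_zero (g : G) : P.weight (𝒢.r g) * P.weight (𝒢.s g) ≠ 0 :=
  (mul_pos (P.weight_pos _) (P.weight_pos _)).ne'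

theorem integral_base [BorelSpace G] [BorelSpace G'] {x : X} {F : G' → ℂ}
    (hF : AEStronglyMeasurable F (lam'.meas (P.base x))) :
    ∫ g, F g ∂(lam'.meas (P.base x)) =
      ∫ g, ((P.weight (𝒢.s g) ^ 2 : ℝ) : ℂ) * F (P.arrow g) ∂(lam.meas x) := by
  rw [← P.map_eq x] at hF ⊢
  exact integral_map_withDensity_ofReal
    ((P.continuous_weight.comp 𝒢.continuous_s).pow 2).measurable (fun _ => sq_nonneg _)
    P.continuous_arrow.measurable hF

/-- The pull-back `g ↦ weight (r g) * weight (s g) * f (arrow g)` of functions on `𝒢'`. The factor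
`weight ∘ r` makes the pull-back commute with the involution. -/
def pull : C_c(G', ℂ) →ₗ[ℂ] C_c(G, ℂ) where
  toFun f :=
    { toFun := fun g => ((P.weight (𝒢.r g) * P.weight (𝒢.s g) : ℝ) : ℂ) * f (P.arrow g)
      continuous_toFun := (Complex.continuous_ofReal.comp P.continuous_weight_mul_weight).mul
        (f.continuous.comp P.continuous_arrow)
      hasCompactSupport' := HasCompactSupport.intro'
        (P.isCompact_preimage f.hasCompactSupport)
        ((isClosed_tsupport f).preimage P.continuous_arrow) fun g hg => by
          rw [image_eq_zero_of_notMem_tsupport (f := f) hg, mul_zero] }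
  map_add' f f' := by
    ext g
    exact mul_add _ (f _) (f' _)
  map_smul' c f := by
    ext g
    exact mul_left_comm _ c (f _)

theorem pull_apply (f : C_c(G', ℂ)) (g : G) :
    P.pull f g = ((P.weight (𝒢.r g) * P.weight (𝒢.s g) : ℝ) : ℂ) * f (P.arrow g) := rfl

theorem pull_involution (f : C_c(G', ℂ)) :
    P.pull (involution 𝒢' f) = involution 𝒢 (P.pull f) := by
  ext g
  change _ * conj (f _) = conj (_ * f _)
  rw [map_mul, Complex.conj_ofReal, P.arrow_inv, 𝒢.r_inv, 𝒢.s_inv, mul_comm (P.weight (𝒢.r g))]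

variable [T2Space G'] [LocallyCompactSpace G']

theorem pull_surjective [SecondCountableTopology G'] (hP : Function.Injective P.arrow) :
    Function.Surjective P.pull := by
  intro ψ
  have he : IsClosedEmbedding P.arrow := by
    refine .of_continuous_injective_isClosedMap P.continuous_arrow hP ?_
    exact (isProperMap_iff_isCompact_preimage.2
      ⟨P.continuous_arrow, fun K hK => P.isCompact_preimage hK⟩).isClosedMap
  let ψ' : C_c(G, ℂ) :=
    { toFun := fun g => (((P.weight (𝒢.r g) * P.weight (𝒢.s g))⁻¹ : ℝ) : ℂ) * ψ g
      continuous_toFun := (Complex.continuous_ofReal.comp <|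
        P.continuous_weight_mul_weight.inv₀ P.weight_mul_weight_ne_zero).mul ψ.continuous
      hasCompactSupport' := ψ.hasCompactSupport.mul_left }
  obtain ⟨f, hf⟩ := exists_compactlySupported_comp_eq he ψ'
  refine ⟨f, ?_⟩
  ext g
  rw [pull_apply, hf]
  change _ * (((P.weight (𝒢.r g) * P.weight (𝒢.s g))⁻¹ : ℝ) * ψ g) = ψ g
  rw [Complex.ofReal_inv,
    mul_inv_cancel_left₀ (Complex.ofReal_ne_zero.2 (P.weight_mul_weight_ne_zero g))]

variable [T2Space G] [LocallyCompactSpace G] [SecondCountableTopology G] [BorelSpace G]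
  [SecondCountableTopology G'] [BorelSpace G']

theorem pull_conv (f φ : C_c(G', ℂ)) :
    P.pull (lam'.conv f φ) = lam.conv (P.pull f) (P.pull φ) := by
  ext g
  change _ * lam'.convFun f φ (P.arrow g) = lam.convFun _ _ g
  have hint := (lam'.integrable_conv f φ (P.arrow g)).aestronglyMeasurable
  rw [P.r_arrow] at hint
  rw [convFun, convFun, P.r_arrow, P.integral_base hint, ← integral_const_mul]
  refine integral_congr_ae ?_
  filter_upwards [lam.ae_r (𝒢.r g)] with h hh
  have hs : 𝒢.s (𝒢.inv h) = 𝒢.r g := (𝒢.s_inv h).trans hh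
  rw [pull_apply, pull_apply, P.arrow_mul _ _ hs, P.arrow_inv, 𝒢.r_mul _ _ hs, 𝒢.s_mul _ _ hs,
    𝒢.r_inv, hh]
  push_cast
  ring

theorem norm_toL2_pull (φ : C_c(G', ℂ)) (x : X) :
    ‖lam.toL2 (P.pull φ) x‖ = P.weight x * ‖lam'.toL2 φ (P.base x)‖ := by
  have hsq : ((‖lam.toL2 (P.pull φ) x‖ ^ 2 : ℝ) : ℂ) =
      (((P.weight x * ‖lam'.toL2 φ (P.base x)‖) ^ 2 : ℝ) : ℂ) := by
    rw [mul_pow, Complex.ofReal_mul, norm_toL2_sq, norm_toL2_sq,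
      P.integral_base (F := normSqInv 𝒢' φ) (normSqInv 𝒢' φ).continuous.aestronglyMeasurable,
      ← integral_const_mul]
    refine integral_congr_ae ?_
    filter_upwards [lam.ae_r x] with g hg
    change P.pull φ (𝒢.inv g) * conj (P.pull φ (𝒢.inv g)) =
      _ * (_ * (φ (𝒢'.inv (P.arrow g)) * conj (φ (𝒢'.inv (P.arrow g)))))
    rw [pull_apply, map_mul, Complex.conj_ofReal, P.arrow_inv, 𝒢.r_inv, 𝒢.s_inv, hg]
    push_cast
    ring
  exact (pow_left_inj₀ (norm_nonneg _) (mul_nonneg (P.weight_pos x).le (norm_nonneg _))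
    two_ne_zero).1 (Complex.ofReal_injective hsq)

theorem norm_toReduced_pull_le (hP : Function.Injective P.arrow) (f : C_c(G', ℂ)) :
    ‖lam.toReduced (P.pull f)‖ ≤ ‖lam'.toReduced f‖ := by
  refine lam.norm_toReduced_le (norm_nonneg _) fun ψ x => ?_
  obtain ⟨φ, rfl⟩ := P.pull_surjective hP ψ
  rw [← pull_conv, norm_toL2_pull, norm_toL2_pull, mul_left_comm]
  exact mul_le_mul_of_nonneg_left (lam'.norm_toL2_conv_le f φ _) (P.weight_pos x).le

theorem norm_toReduced_le_of_forall_pull {ι : Type*} {P : ι → lam.WeightedHom lam'}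
    (hP : ∀ y, ∃ i x, (P i).base x = y) {f : C_c(G', ℂ)} {C : ℝ} (hC : 0 ≤ C)
    (h : ∀ i, ‖lam.toReduced ((P i).pull f)‖ ≤ C) : ‖lam'.toReduced f‖ ≤ C := by
  refine lam'.norm_toReduced_le hC fun φ y => ?_
  obtain ⟨i, x, rfl⟩ := hP y
  have hx := lam.norm_toL2_conv_le ((P i).pull f) ((P i).pull φ) x
  rw [← pull_conv, norm_toL2_pull, norm_toL2_pull, mul_left_comm] at hx
  refine (le_of_mul_le_mul_left hx ((P i).weight_pos x)).trans ?_
  gcongr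
  exact h i

theorem toReduced_pull_conv (f f' : C_c(G', ℂ)) : lam.toReduced (P.pull (lam'.conv f f')) =
    lam.toReduced (P.pull f) * lam.toReduced (P.pull f') := by
  rw [pull_conv, toReduced_conv]

variable (hP : Function.Injective P.arrow)

/-- The homomorphism of reduced `C^*`-algebras induced by an injective weighted homomorphism of
groupoids, in the opposite direction. -/
def reducedHom : lam'.Reduced →⋆ₙₐ[ℂ] lam.Reduced :=
  Reduced.lift (lam.toReducedₗ ∘ₗ P.pull) (P.norm_toReduced_pull_le hP) P.toReduced_pull_conv
    fun f => (congrArg lam.toReduced (P.pull_involution f)).trans (lam.toReduced_involution _)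

theorem reducedHom_toReduced (f : C_c(G', ℂ)) :
    P.reducedHom hP (lam'.toReduced f) = lam.toReduced (P.pull f) :=
  Reduced.lift_toReduced ..

variable (hbase : Function.Surjective P.base)

include hbase in
theorem isometry_reducedHom : Isometry (P.reducedHom hP) := by
  refine Reduced.isometry_lift (lam.toReducedₗ ∘ₗ P.pull) _ _ fun f => ?_
  refine le_antisymm (P.norm_toReduced_pull_le hP f) ?_
  exact norm_toReduced_le_of_forall_pull (P := fun _ : Unit => P)
    (fun y => ⟨(), hbase y⟩) (norm_nonneg _) fun _ => le_rfl

include hbase in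
theorem bijective_reducedHom : Function.Bijective (P.reducedHom hP) := by
  have hiso := P.isometry_reducedHom hP hbase
  refine ⟨hiso.injective, surjective_of_isometry_of_denseRange hiso ?_⟩
  refine lam.denseRange_toReduced.mono ?_
  rintro _ ⟨ψ, rfl⟩
  obtain ⟨φ, rfl⟩ := P.pull_surjective hP ψ
  exact ⟨lam'.toReduced φ, P.reducedHom_toReduced hP φ⟩

/-- The isomorphism of reduced `C^*`-algebras induced by a weighted isomorphism of groupoids. -/
def reducedEquiv : lam'.Reduced ≃⋆ₐ[ℂ] lam.Reduced :=
  StarAlgEquiv.ofBijective (P.reducedHom hP) (P.bijective_reducedHom hP hbase)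

theorem reducedEquiv_toReduced (f : C_c(G', ℂ)) :
    P.reducedEquiv hP hbase (lam'.toReduced f) = lam.toReduced (P.pull f) :=
  P.reducedHom_toReduced hP f

end WeightedHom

/-! ### The automorphism of the reduced algebra induced by an automorphism of the groupoid -/

section Translation

variable [T2Space G] [LocallyCompactSpace G] [SecondCountableTopology G] [BorelSpace G]
  (lam : 𝒢.HaarSystem)

theorem map_mul_inv_map_mul {g : G} {ν : Measure G} (hν : ν ≪ lam.meas (𝒢.s g)) :
    (ν.map (𝒢.mul g)).map (𝒢.mul (𝒢.inv g)) = ν := by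
  have hm := lam.aemeasurable_mul g
  have hm' : AEMeasurable (𝒢.mul (𝒢.inv g)) (ν.map (𝒢.mul g)) := by
    have hinv := lam.aemeasurable_mul (𝒢.inv g)
    rw [𝒢.s_inv, ← lam.map_mul_left] at hinv
    refine hinv.mono_ac (.mk fun s hs h0 => ?_)
    rw [Measure.map_apply_of_aemeasurable hm hs] at h0
    rw [Measure.map_apply_of_aemeasurable (hm.mono_ac hν) hs, hν h0]
  rw [AEMeasurable.map_map_of_aemeasurable hm' (hm.mono_ac hν)]
  refine (Measure.map_congr (g := id) ?_).trans Measure.map_id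
  filter_upwards [hν.ae_le (lam.ae_r (𝒢.s g))] with h hh
  exact 𝒢.inv_mul_cancel_left hh.symm

theorem map_mul_map_arrow (α : 𝒢.Aut) (k : G)
    (hk : AEMeasurable (𝒢.mul (α.arrow k)) ((lam.meas (𝒢.s k)).map α.arrow)) :
    ((lam.meas (𝒢.s k)).map α.arrow).map (𝒢.mul (α.arrow k)) =
      (lam.meas (𝒢.r k)).map α.arrow := by
  rw [← lam.map_mul_left, AEMeasurable.map_map_of_aemeasurable hk
    α.arrow.continuous.aemeasurable, AEMeasurable.map_map_of_aemeasurable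
    α.arrow.continuous.aemeasurable (lam.aemeasurable_mul k)]
  refine Measure.map_congr ?_
  filter_upwards [lam.ae_r (𝒢.s k)] with h hh
  exact (α.arrow_mul k h hh.symm).symm

end Translation

namespace Density

variable {lam : 𝒢.HaarSystem} {α : 𝒢.Aut} (d : lam.Density α)

theorem measurable_ofReal_ρ [OpensMeasurableSpace G] :
    Measurable fun g => ENNReal.ofReal (d.ρ g) :=
  d.continuous_ρ.measurable.ennreal_ofReal

variable [T2Space G] [LocallyCompactSpace G] [SecondCountableTopology G] [BorelSpace G]

theorem ae_ρ_mul (g : G) : ∀ᵐ h ∂(lam.meas (𝒢.s g)), d.ρ (𝒢.mul g h) = d.ρ h := by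
  obtain ⟨k, rfl⟩ := α.arrow.surjective g
  have hm := lam.aemeasurable_mul (α.arrow k)
  have hmap := d.map_eq (𝒢.s k)
  rw [← α.s_arrow] at hmap
  have hm' : AEMeasurable (𝒢.mul (α.arrow k)) ((lam.meas (𝒢.s k)).map α.arrow) := by
    rw [hmap]; exact hm.mono_ac (withDensity_absolutelyContinuous _ _)
  -- Both sides are the image of `λ^{s(k)}` under `h ↦ α(k h)`.
  have htranslate : ((lam.meas (𝒢.s (α.arrow k))).withDensity fun h =>
        ENNReal.ofReal (d.ρ h)).map (𝒢.mul (α.arrow k)) =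
      ((lam.meas (𝒢.s (α.arrow k))).withDensity fun h =>
        ENNReal.ofReal (d.ρ (𝒢.mul (α.arrow k) h))).map (𝒢.mul (α.arrow k)) := by
    rw [map_withDensity_comp _ hm d.measurable_ofReal_ρ, ← hmap, lam.map_mul_left, α.r_arrow,
      ← d.map_eq, lam.map_mul_map_arrow α k hm']
  have hdensity := congrArg (Measure.map (𝒢.mul (𝒢.inv (α.arrow k)))) htranslate
  rw [lam.map_mul_inv_map_mul (withDensity_absolutelyContinuous _ _),
    lam.map_mul_inv_map_mul (withDensity_absolutelyContinuous _ _)] at hdensity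
  filter_upwards [(withDensity_eq_iff_of_sigmaFinite d.measurable_ofReal_ρ.aemeasurable
    (d.measurable_ofReal_ρ.comp_aemeasurable hm)).1 hdensity] with h hh
  exact ((ENNReal.ofReal_eq_ofReal_iff (d.pos _).le (d.pos _).le).1 hh).symm

theorem ρ_mul {g h : G} (hgh : 𝒢.s g = 𝒢.r h) : d.ρ (𝒢.mul g h) = d.ρ h := by
  have hcont : ContinuousOn (fun h => d.ρ (𝒢.mul g h)) (lam.meas (𝒢.s g)).support := by
    rw [lam.support_eq]
    exact d.continuous_ρ.comp_continuousOn (𝒢.continuousOn_mul.comp (f := fun h : G => (g, h))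
      (by fun_prop) fun h (hh : 𝒢.r h = 𝒢.s g) => hh.symm)
  refine eqOn_support_of_ae_eq hcont d.continuous_ρ.continuousOn (d.ae_ρ_mul g) ?_
  rw [lam.support_eq]
  exact hgh.symm

theorem ρ_eq_ρ_unit (g : G) : d.ρ g = d.ρ (𝒢.unit (𝒢.s g)) := by
  rw [← 𝒢.inv_mul, d.ρ_mul (𝒢.s_inv g)]

theorem ρ_inv (g : G) : d.ρ (𝒢.inv g) = d.ρ (𝒢.unit (𝒢.r g)) := by
  rw [d.ρ_eq_ρ_unit, 𝒢.s_inv]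

/-- The inverse of `α`, with weight `ρ^{1/2}` on the units: the pull-back of functions along it is
`twist`. -/
def twistHom : lam.WeightedHom lam where
  arrow := α.arrow.symm
  base := α.base.symm
  weight x := d.ρ (𝒢.unit x) ^ (1 / 2 : ℝ)
  continuous_arrow := α.arrow.symm.continuous
  isCompact_preimage _ hK := α.arrow.symm.isCompact_preimage.2 hK
  continuous_weight := (d.continuous_ρ.comp 𝒢.continuous_unit).rpow_const
    fun _ => Or.inl (d.pos _).ne'
  weight_pos _ := Real.rpow_pos_of_pos (d.pos _) _
  r_arrow g := α.base.injective (by rw [← α.r_arrow, α.arrow.apply_symm_apply,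
    α.base.apply_symm_apply])
  s_arrow g := α.base.injective (by rw [← α.s_arrow, α.arrow.apply_symm_apply,
    α.base.apply_symm_apply])
  arrow_mul g h hgh := α.arrow.injective (by
    rw [α.arrow_mul _ _ (α.base.injective (by
      rw [← α.s_arrow, ← α.r_arrow, α.arrow.apply_symm_apply, α.arrow.apply_symm_apply, hgh])),
      α.arrow.apply_symm_apply, α.arrow.apply_symm_apply, α.arrow.apply_symm_apply])
  map_eq x := by
    have hweight : ∀ g, (d.ρ (𝒢.unit (𝒢.s g)) ^ (1 / 2 : ℝ)) ^ 2 = d.ρ g := fun g => by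
      rw [← d.ρ_eq_ρ_unit, ← Real.sqrt_eq_rpow, Real.sq_sqrt (d.pos g).le]
    have hmap := d.map_eq (α.base.symm x)
    rw [α.base.apply_symm_apply] at hmap
    simp only [hweight]
    rw [← hmap, Measure.map_map α.arrow.symm.continuous.measurable α.arrow.continuous.measurable,
      α.arrow.symm_comp_self, Measure.map_id]

theorem pull_twistHom (f : C_c(G, ℂ)) : d.twistHom.pull f = d.twist f := by
  ext g
  change ((d.ρ (𝒢.unit (𝒢.r g)) ^ (1 / 2 : ℝ) * d.ρ (𝒢.unit (𝒢.s g)) ^ (1 / 2 : ℝ) : ℝ) : ℂ) * _ =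
    ((d.ρ (𝒢.inv g) ^ (1 / 2 : ℝ) * d.ρ g ^ (1 / 2 : ℝ) : ℝ) : ℂ) * _
  rw [← d.ρ_eq_ρ_unit, ← d.ρ_inv]
  rfl

/-- The automorphism of the reduced `C^*`-algebra induced by the automorphism `α` of the groupoid,
given on `C_c(G)` by `twist`. -/
def twistEquiv : lam.Reduced ≃⋆ₐ[ℂ] lam.Reduced :=
  d.twistHom.reducedEquiv α.arrow.symm.injective α.base.symm.surjective

theorem twistEquiv_toReduced (f : C_c(G, ℂ)) :
    d.twistEquiv (lam.toReduced f) = lam.toReduced (d.twist f) := by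
  rw [← pull_twistHom]
  exact d.twistHom.reducedEquiv_toReduced _ _ f

end Density

end HaarSystem

end TopGroupoid

/-! ### The Haar system of the suspension -/

namespace Suspension

variable {Y : Type*} [TopologicalSpace Y] {f : Y ≃ₜ Y}

theorem apply_zpow_sub_intCast {Z : Type*} {F : Y → ℝ → Z} (hF : ∀ y t, F (f y) (t - 1) = F y t)
    (n : ℤ) (y : Y) (t : ℝ) : F ((f ^ n) y) (t - n) = F y t := by
  induction n generalizing y t with
  | zero => simp
  | succ n ih =>
    rw [zpow_add_one, Homeomorph.mul_apply, ← hF y t, ← ih (f y) (t - 1), Int.cast_add,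
      Int.cast_one, add_comm, sub_add_eq_sub_sub]
  | pred n ih =>
    obtain ⟨z, rfl⟩ := f.surjective y
    rw [← Homeomorph.mul_apply, ← zpow_add_one, sub_add_cancel, ← add_sub_cancel_right t 1, hF,
      ← ih z (t + 1)]
    congr 1
    push_cast
    ring

/-- The map on the suspension given by `F` on representatives. -/
def lift {Z : Type*} (F : Y → ℝ → Z) (hF : ∀ y t, F (f y) (t - 1) = F y t) : Suspension f → Z :=
  Quotient.lift (fun q : Y × ℝ => F q.1 q.2) (by
    rintro q _ ⟨n, rfl⟩
    exact (apply_zpow_sub_intCast hF n q.1 q.2).symm)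

theorem continuous_lift {Z : Type*} [TopologicalSpace Z] {F : Y → ℝ → Z}
    (hF : ∀ y t, F (f y) (t - 1) = F y t) (hc : Continuous fun q : Y × ℝ => F q.1 q.2) :
    Continuous (lift F hF) :=
  Continuous.quotient_lift hc _

theorem continuous_mk_left (t : ℝ) : Continuous fun y : Y => mk f y t :=
  continuous_mk.comp (by fun_prop : Continuous fun y : Y => (y, t))

theorem continuous_flow : Continuous fun q : Suspension f × ℝ => flow f q.2 q.1 := by
  rw [((isOpenQuotientMap_mk (f := f)).prodMap
    (IsOpenQuotientMap.id (X := ℝ))).isQuotientMap.continuous_iff]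
  exact continuous_mk.comp (by fun_prop : Continuous fun q : (Y × ℝ) × ℝ => (q.1.1, q.1.2 + q.2))

theorem exists_isCompact_of_mk_mem [LocallyCompactSpace Y] [T2Space Y] {K : Set (Suspension f)}
    (hK : IsCompact K) (t₀ : ℝ) :
    ∃ L : Set Y, IsCompact L ∧ ∀ᶠ t in 𝓝 t₀, ∀ y ∉ L, mk f y t ∉ K := by
  have hflow : IsCompact ((fun q : Suspension f × ℝ => flow f q.2 q.1) ''
      (K ×ˢ Metric.closedBall 0 1)) :=
    (hK.prod (isCompact_closedBall 0 1)).image continuous_flow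
  refine ⟨_, isCompact_preimage_mk hflow t₀, ?_⟩
  filter_upwards [Metric.closedBall_mem_nhds t₀ one_pos] with t ht y hy hyK
  refine hy ⟨(mk f y t, t₀ - t), ⟨hyK, ?_⟩, ?_⟩
  · rwa [mem_closedBall_zero_iff, ← dist_eq_norm, dist_comm]
  · simp only [flow_mk, add_sub_cancel]

theorem exists_isCompact_forall_notMem_eq_zero [LocallyCompactSpace Y] [T2Space Y]
    (φ : C_c(Suspension f, ℂ)) (t₀ : ℝ) :
    ∃ L : Set Y, IsCompact L ∧ ∀ᶠ t in 𝓝 t₀, ∀ y ∉ L, φ (mk f y t) = 0 := by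
  obtain ⟨L, hL, hLφ⟩ := exists_isCompact_of_mk_mem φ.hasCompactSupport.isCompact t₀
  exact ⟨L, hL, hLφ.mono fun t ht y hy => image_eq_zero_of_notMem_tsupport (ht y hy)⟩

end Suspension

namespace TopGroupoid

namespace HaarSystem

namespace Density

variable {G X : Type*} [TopologicalSpace G] [TopologicalSpace X] {𝒢 : TopGroupoid G X}
  [MeasurableSpace G] {lam : 𝒢.HaarSystem} {α : 𝒢.Aut} (d : lam.Density α)

/-- The measure `f ↦ ∫ ρ(γ)^{-t} f([γ, t]) dλ^x(γ)` on the suspension. -/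
def suspensionMeas (x : X) (t : ℝ) : Measure (Suspension α.arrow) :=
  ((lam.meas x).withDensity fun g => ENNReal.ofReal (d.ρ g ^ (-t))).map
    fun g => .mk α.arrow g t

theorem measurable_ofReal_rpow [OpensMeasurableSpace G] (c : ℝ) :
    Measurable fun g => ENNReal.ofReal (d.ρ g ^ c) :=
  (d.continuous_rpow continuous_id c).measurable.ennreal_ofReal

variable [BorelSpace G]

theorem suspensionMeas_base_sub_one (hd : ∀ g, d.ρ (α.arrow g) = d.ρ g) (x : X) (t : ℝ) :
    d.suspensionMeas (α.base x) (t - 1) = d.suspensionMeas x t := by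
  have hρ : (fun g => ENNReal.ofReal (d.ρ g ^ (-(t - 1)))) =
      (fun g => ENNReal.ofReal (d.ρ g)) * fun g => ENNReal.ofReal (d.ρ g ^ (-t)) := by
    funext g
    rw [Pi.mul_apply, ← ENNReal.ofReal_mul (d.pos g).le, neg_sub, sub_eq_add_neg,
      Real.rpow_add (d.pos g), Real.rpow_one]
  have hmap := map_withDensity_comp (lam.meas x) α.arrow.continuous.aemeasurable
    (d.measurable_ofReal_rpow (-t))
  simp only [hd] at hmap
  rw [suspensionMeas, hρ, withDensity_mul _ d.measurable_ofReal_ρ (d.measurable_ofReal_rpow _),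
    ← d.map_eq, ← hmap, Measure.map_map (Suspension.continuous_mk_left _).measurable
      α.arrow.continuous.measurable]
  exact congrArg (Measure.map · _) (funext fun g => Suspension.mk_apply g t)

theorem isFiniteMeasureOnCompacts_suspensionMeas [T2Space G] [LocallyCompactSpace G]
    [SecondCountableTopology G] (x : X) (t : ℝ) :
    IsFiniteMeasureOnCompacts (d.suspensionMeas x t) := by
  refine ⟨fun K hK => ?_⟩
  have : IsLocallyFiniteMeasure
      ((lam.meas x).withDensity fun g => ENNReal.ofReal (d.ρ g ^ (-t))) :=
    IsLocallyFiniteMeasure.withDensity_ofReal (d.continuous_rpow continuous_id _)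
  rw [suspensionMeas, Measure.map_apply (Suspension.continuous_mk_left _).measurable
    hK.measurableSet]
  exact (Suspension.isCompact_preimage_mk hK t).measure_lt_top

theorem integral_suspensionMeas (f : C_c(Suspension α.arrow, ℂ)) (x : X) (t : ℝ) :
    ∫ q, f q ∂(d.suspensionMeas x t) =
      ∫ g, ((d.ρ g ^ (-t) : ℝ) : ℂ) * f (.mk α.arrow g t) ∂(lam.meas x) :=
  integral_map_withDensity_ofReal (d.continuous_rpow continuous_id _).measurable
    (fun g => (Real.rpow_pos_of_pos (d.pos g) _).le) (Suspension.continuous_mk_left _).measurable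
    f.continuous.aestronglyMeasurable

theorem mem_support_suspensionMeas [HereditarilyLindelofSpace G] (g : G) (t : ℝ) :
    .mk α.arrow g t ∈ (d.suspensionMeas (𝒢.r g) t).support := by
  rw [Measure.mem_support_iff_forall]
  intro U hU
  obtain ⟨V, hVU, hV, hgV⟩ := mem_nhds_iff.1 hU
  refine lt_of_lt_of_le ?_ (measure_mono hVU)
  have hmk := Suspension.continuous_mk_left (f := α.arrow) t
  rw [suspensionMeas, Measure.map_apply hmk.measurable hV.measurableSet]
  have hg : g ∈ (lam.meas (𝒢.r g)).support := by
    rw [lam.support_eq]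
    rfl
  have hpos := (Measure.mem_support_iff_forall g).1 hg _ (hmk.continuousAt (hV.mem_nhds hgV))
  have habs : lam.meas (𝒢.r g) ≪
      (lam.meas (𝒢.r g)).withDensity fun g => ENNReal.ofReal (d.ρ g ^ (-t)) :=
    withDensity_absolutelyContinuous' (d.measurable_ofReal_rpow (-t)).aemeasurable
      (Eventually.of_forall fun g =>
        (ENNReal.ofReal_pos.2 (Real.rpow_pos_of_pos (d.pos g) _)).ne')
  exact pos_iff_ne_zero.2 fun h => hpos.ne' (habs h)

variable [T2Space G] [LocallyCompactSpace G] [SecondCountableTopology G]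

theorem continuous_integral_suspensionMeas (f : C_c(Suspension α.arrow, ℂ)) :
    Continuous fun p : X × ℝ => ∫ q, f q ∂(d.suspensionMeas p.1 p.2) := by
  simp only [integral_suspensionMeas]
  refine continuous_iff_continuousAt.2 fun p₀ => ?_
  obtain ⟨L, hL, hLf⟩ := Suspension.exists_isCompact_forall_notMem_eq_zero f p₀.2
  refine lam.continuousAt_integral
    (F := fun g p => ((d.ρ g ^ (-p.2) : ℝ) : ℂ) * f (.mk α.arrow g p.2)) continuous_fst ?_ hL ?_
  · refine (Complex.continuous_ofReal.comp ?_).mul (f.continuous.comp ?_)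
    · exact (d.continuous_ρ.comp continuous_fst).rpow (by fun_prop) fun q => Or.inl (d.pos _).ne'
    · exact Suspension.continuous_mk.comp
        (by fun_prop : Continuous fun q : G × (X × ℝ) => (q.1, q.2.2))
  · filter_upwards [continuous_snd.continuousAt hLf] with p hp g hg
    rw [hp g hg, mul_zero]

theorem ae_suspensionMeas (x : X) (t : ℝ) :
    ∀ᵐ q ∂(d.suspensionMeas x t), α.suspension.r q = .mk α.base x t := by
  have := 𝒢.t2_base
  refine (ae_map_iff (Suspension.continuous_mk_left _).aemeasurable
    (isClosed_singleton.preimage α.suspension.continuous_r).measurableSet).2 ?_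
  filter_upwards [(withDensity_absolutelyContinuous _ _).ae_le (lam.ae_r x)] with g hg
  exact congrArg (Suspension.mk α.base · t) hg

theorem support_suspensionMeas (x : X) (t : ℝ) :
    (d.suspensionMeas x t).support = {q | α.suspension.r q = .mk α.base x t} := by
  have := 𝒢.t2_base
  refine Set.Subset.antisymm (Measure.support_subset_of_isClosed
    (isClosed_singleton.preimage α.suspension.continuous_r) (d.ae_suspensionMeas x t)) ?_
  refine Suspension.ind fun g u hg => ?_
  obtain ⟨n, rfl, rfl⟩ := Suspension.mk_eq_iff.1 hg
  rw [← Suspension.mk_zpow n g u, ← Suspension.semiconj_zpow α.r_arrow n g]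
  exact d.mem_support_suspensionMeas _ _

theorem aemeasurable_suspension_mul (g : G) (t : ℝ) :
    AEMeasurable (α.suspension.mul (.mk α.arrow g t)) (d.suspensionMeas (𝒢.s g) t) := by
  have := 𝒢.t2_base
  rw [← Measure.restrict_eq_self_of_ae_mem (d.ae_suspensionMeas (𝒢.s g) t)]
  refine ContinuousOn.aemeasurable ?_
    (isClosed_singleton.preimage α.suspension.continuous_r).measurableSet
  exact α.suspension.continuousOn_mul.comp
    (f := fun h : Suspension α.arrow => (Suspension.mk α.arrow g t, h))
    (continuous_const.prodMk continuous_id).continuousOn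
    fun h (hh : α.suspension.r h = .mk α.base (𝒢.s g) t) => hh.symm

theorem map_mul_left_withDensity_rpow (g : G) (c : ℝ) :
    ((lam.meas (𝒢.s g)).withDensity fun h => ENNReal.ofReal (d.ρ h ^ c)).map (𝒢.mul g) =
      (lam.meas (𝒢.r g)).withDensity fun h => ENNReal.ofReal (d.ρ h ^ c) := by
  rw [← lam.map_mul_left g, ← map_withDensity_comp _ (lam.aemeasurable_mul g)
    (d.measurable_ofReal_rpow c)]
  refine congrArg (Measure.map _) (withDensity_congr_ae ?_)
  filter_upwards [lam.ae_r (𝒢.s g)] with h hh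
  rw [d.ρ_mul hh.symm]

theorem map_mul_left_suspensionMeas (g : G) (t : ℝ) :
    (d.suspensionMeas (𝒢.s g) t).map (α.suspension.mul (.mk α.arrow g t)) =
      d.suspensionMeas (𝒢.r g) t := by
  have hmk := (Suspension.continuous_mk_left (f := α.arrow) t).aemeasurable
    (μ := (lam.meas (𝒢.s g)).withDensity fun h => ENNReal.ofReal (d.ρ h ^ (-t)))
  rw [suspensionMeas, suspensionMeas, AEMeasurable.map_map_of_aemeasurable
    (d.aemeasurable_suspension_mul g t) hmk, ← d.map_mul_left_withDensity_rpow g,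
    AEMeasurable.map_map_of_aemeasurable (Suspension.continuous_mk_left _).aemeasurable
      ((lam.aemeasurable_mul g).mono_ac (withDensity_absolutelyContinuous _ _))]
  refine Measure.map_congr ?_
  filter_upwards [(withDensity_absolutelyContinuous _ _).ae_le (lam.ae_r (𝒢.s g))] with h hh
  exact α.suspensionMul_mk hh.symm t

/-- The Haar system of the suspension groupoid. -/
def suspensionHaar (hd : ∀ g, d.ρ (α.arrow g) = d.ρ g) : α.suspension.HaarSystem where
  meas := Suspension.lift d.suspensionMeas (d.suspensionMeas_base_sub_one hd)
  finite_on_compacts := Suspension.ind d.isFiniteMeasureOnCompacts_suspensionMeas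
  support_eq := Suspension.ind d.support_suspensionMeas
  continuous_integral f := by
    rw [(Suspension.isOpenQuotientMap_mk (f := α.base)).isQuotientMap.continuous_iff]
    exact d.continuous_integral_suspensionMeas f
  map_mul_left := Suspension.ind d.map_mul_left_suspensionMeas

end Density

end HaarSystem

end TopGroupoid

theorem exists_mem_forall_norm_sub_le_of_isOpenQuotientMap {Y Z V : Type*} [TopologicalSpace Y]
    [TopologicalSpace Z] [CompactSpace Z] [T2Space Z] [SeminormedAddCommGroup V] [NormedSpace ℝ V]
    {q : Y → Z} (hq : IsOpenQuotientMap q) {S : AddSubmonoid (Y → V)}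
    (hsmul : ∀ k : C(Z, ℝ), ∀ F ∈ S, (fun y => k (q y) • F y) ∈ S) {H : Y → V}
    (hcont : ∀ F ∈ S, Continuous fun y => ‖F y - H y‖)
    (hfib : ∀ F ∈ S, ∀ y y', q y = q y' → ‖F y - H y‖ = ‖F y' - H y'‖) {ε : ℝ}
    (hε : ∀ y, ∃ F ∈ S, ‖F y - H y‖ < ε) : ∃ F ∈ S, ∀ y, ‖F y - H y‖ ≤ ε := by
  let U : S → Set Z := fun F => q '' {y | ‖F.1 y - H y‖ < ε}
  have hU_open (F : S) : IsOpen (U F) :=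
    hq.isOpenMap _ (isOpen_lt (hcont F.1 F.2) continuous_const)
  have hU_mem {F : S} {y : Y} (hy : q y ∈ U F) : ‖F.1 y - H y‖ < ε := by
    obtain ⟨y', hy', hyy'⟩ := hy
    exact (hfib F.1 F.2 y y' hyy'.symm).trans_lt hy'
  have hU_cover : Set.univ ⊆ ⋃ F, U F := fun z _ => by
    obtain ⟨y, rfl⟩ := hq.surjective z
    obtain ⟨F, hF, hy⟩ := hε y
    exact Set.mem_iUnion.2 ⟨⟨F, hF⟩, y, hy, rfl⟩
  obtain ⟨p, hp⟩ := PartitionOfUnity.exists_isSubordinate isClosed_univ U hU_open hU_cover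
  have hfin := p.locallyFinite.finite_nonempty_of_compact
  refine ⟨∑ F ∈ hfin.toFinset, fun y => p F (q y) • F.1 y,
    S.sum_mem fun F _ => hsmul _ _ F.2, fun y => ?_⟩
  have hsum : (∑ F ∈ hfin.toFinset, fun y => p F (q y) • F.1 y) y =
      ∑ᶠ F, p F (q y) • F.1 y := by
    rw [Finset.sum_apply]
    refine (finsum_eq_sum_of_support_subset _ fun F hF => ?_).symm
    exact hfin.mem_toFinset.2 ⟨q y, fun h => hF (by simp only [h, zero_smul])⟩
  rw [hsum, ← dist_eq_norm]
  refine p.finsum_smul_mem_convex (g := fun F _ => F.1 y) (Set.mem_univ (q y)) (fun F hF => ?_)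
    (convex_closedBall (H y) ε)
  rw [Metric.mem_closedBall, dist_eq_norm]
  exact (hU_mem (hp F (subset_tsupport _ hF))).le

/-! ### Mapping tori -/

variable {A : Type*} [NonUnitalCStarAlgebra A] {β : A ≃⋆ₐ[ℂ] A}

/-- The functions `ℝ → A` satisfying `F(u) = β(F(u + 1))`, which are the extensions to `ℝ` of
elements of the mapping torus of `β` when they are continuous. -/
def IsTwistedPeriodic (β : A ≃⋆ₐ[ℂ] A) (F : ℝ → A) : Prop :=
  ∀ u, β (F (u + 1)) = F u

namespace IsTwistedPeriodic

variable {F F' : ℝ → A}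

theorem sub (hF : IsTwistedPeriodic β F) (hF' : IsTwistedPeriodic β F') :
    IsTwistedPeriodic β fun u => F u - F' u :=
  fun u => by rw [map_sub, hF, hF']

theorem periodic_norm (hF : IsTwistedPeriodic β F) : Function.Periodic (fun u => ‖F u‖) 1 :=
  fun u => by simp only [← hF u, StarAlgEquiv.norm_map]

theorem zpow_apply_add_intCast (hF : IsTwistedPeriodic β F) (n : ℤ) (u : ℝ) :
    (β ^ n) (F (u + n)) = F u := by
  induction n with
  | zero => simp
  | succ n ih =>
    rw [zpow_add_one, StarAlgEquiv.mul_apply, Int.cast_add, Int.cast_one, ← add_assoc, hF, ih]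
  | pred n ih =>
    rw [← hF (u + _), ← StarAlgEquiv.mul_apply, ← zpow_add_one, sub_add_cancel, Int.cast_sub,
      Int.cast_one, add_assoc, sub_add_cancel, ih]

theorem continuous (hF : IsTwistedPeriodic β F) (hc : ContinuousOn F (Set.Icc 0 1)) :
    Continuous F := by
  have hfin : LocallyFinite fun n : ℤ => Set.Icc (n : ℝ) (n + 1) :=
    locallyFinite_Icc_of_tendsto tendsto_intCast_atTop_atTop
      (tendsto_atBot_add_const_right _ 1 (tendsto_intCast_atBot_iff.2 tendsto_id))
  refine hfin.continuous (Set.iUnion_eq_univ_iff.2 fun u =>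
    ⟨⌊u⌋, Int.floor_le u, (Int.lt_floor_add_one u).le⟩) (fun n => isClosed_Icc) fun n => ?_
  have hn : F = (β ^ (-n)) ∘ F ∘ fun u => u - n := funext fun u => by
    rw [← hF.zpow_apply_add_intCast (-n) u, Int.cast_neg, ← sub_eq_add_neg]
    rfl
  rw [hn]
  refine (StarAlgEquiv.isometry (β ^ (-n))).continuous.comp_continuousOn
    (hc.comp (by fun_prop) fun u hu => ?_)
  exact ⟨sub_nonneg.2 hu.1, sub_le_iff_le_add'.2 hu.2⟩

theorem mappingTorusExtend_eq (hF : IsTwistedPeriodic β F) {h : mappingTorus β}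
    (hh : ∀ t : unitInterval, h.1 t = F t) (u : ℝ) : mappingTorusExtend h u = F u := by
  rw [mappingTorusExtend, hh, ← hF.zpow_apply_add_intCast (-⌊u⌋) u, Int.cast_neg,
    ← sub_eq_add_neg, Int.self_sub_floor]

end IsTwistedPeriodic

theorem isTwistedPeriodic_mappingTorusExtend (h : mappingTorus β) :
    IsTwistedPeriodic β (mappingTorusExtend h) :=
  mappingTorusExtend_add_one h

theorem continuous_mappingTorusExtend (h : mappingTorus β) : Continuous (mappingTorusExtend h) := by
  refine (isTwistedPeriodic_mappingTorusExtend h).continuous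
    (continuousOn_iff_continuous_domRestrict.2 ?_)
  exact h.1.continuous.congr fun t => (mappingTorusExtend_coe h t).symm

theorem continuous_of_eq_mappingTorusExtend_sub {h : mappingTorus β} {g : ℝ → mappingTorus β}
    (hg : ∀ (s : ℝ) (t : unitInterval), (g s).1 t = mappingTorusExtend h (t - s)) :
    Continuous g := by
  refine Continuous.subtype_mk (ContinuousMap.continuous_of_continuous_uncurry _ ?_) _
  refine Continuous.congr (f := fun q : ℝ × unitInterval => mappingTorusExtend h (q.2 - q.1)) ?_
    fun q => (hg q.1 q.2).symm
  exact (continuous_mappingTorusExtend h).comp (by fun_prop)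

/-! ### Restriction to the slices of the suspension -/

namespace Suspension

variable {Y : Type*} [TopologicalSpace Y]

/-- The projection `[y, t] ↦ t` of a suspension to the circle. -/
def toCircle (f : Y ≃ₜ Y) : Suspension f → AddCircle (1 : ℝ) :=
  lift (fun _ t => t) fun _ t => by rw [AddCircle.coe_sub, AddCircle.coe_period, sub_zero]

variable {f : Y ≃ₜ Y}

theorem continuous_toCircle : Continuous (toCircle f) :=
  continuous_lift _ ((AddCircle.continuous_mk' 1).comp continuous_snd)

/-- The product of `φ` with a function on the circle. -/
def mulCircle (k : C(AddCircle (1 : ℝ), ℝ)) (φ : C_c(Suspension f, ℂ)) :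
    C_c(Suspension f, ℂ) where
  toFun q := (k (toCircle f q) : ℂ) * φ q
  continuous_toFun := (Complex.continuous_ofReal.comp (k.continuous.comp continuous_toCircle)).mul
    φ.continuous
  hasCompactSupport' := φ.hasCompactSupport.mul_left

theorem exists_unitInterval_mk_eq (p : Suspension f) :
    ∃ (t : unitInterval) (y : Y), mk f y t = p := by
  induction p using ind with | h y u
  exact ⟨⟨Int.fract u, Int.fract_nonneg u, (Int.fract_lt_one u).le⟩, (f ^ ⌊u⌋) y, mk_zpow ⌊u⌋ y u⟩

end Suspension

namespace TopGroupoid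

namespace HaarSystem

namespace Density

variable {G X : Type*} [TopologicalSpace G] [TopologicalSpace X] {𝒢 : TopGroupoid G X}
  [MeasurableSpace G] {lam : 𝒢.HaarSystem} {α : 𝒢.Aut} (d : lam.Density α)

section Hat

variable [T2Space G] [LocallyCompactSpace G] (f : C_c(Suspension α.arrow, ℂ)) (t : ℝ)

theorem hat_apply (g : G) : d.hat f t g =
    ((d.ρ g ^ (-t / 2) * d.ρ (𝒢.inv g) ^ (-t / 2) : ℝ) : ℂ) * f (.mk α.arrow g t) := rfl

theorem hat_mulCircle (k : C(AddCircle (1 : ℝ), ℝ)) :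
    d.hat (Suspension.mulCircle k f) t = ((k (t : AddCircle (1 : ℝ)) : ℝ) : ℂ) • d.hat f t := by
  ext g
  exact mul_left_comm _ _ (f _)

theorem continuous_hat : Continuous fun q : ℝ × G => d.hat f q.1 q.2 := by
  have hρ : Continuous fun q : ℝ × G => d.ρ q.2 ^ (-q.1 / 2) :=
    (d.continuous_ρ.comp continuous_snd).rpow (by fun_prop) fun _ => Or.inl (d.pos _).ne'
  have hρ' : Continuous fun q : ℝ × G => d.ρ (𝒢.inv q.2) ^ (-q.1 / 2) :=
    hρ.comp (continuous_fst.prodMk (𝒢.continuous_inv.comp continuous_snd))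
  exact (Complex.continuous_ofReal.comp (hρ.mul hρ')).mul
    (f.continuous.comp (Suspension.continuous_mk.comp continuous_swap))

theorem twist_hat (hd : ∀ g, d.ρ (α.arrow g) = d.ρ g) :
    d.twist (d.hat f (t + 1)) = d.hat f t := by
  ext g
  obtain ⟨g, rfl⟩ := α.arrow.surjective g
  have hmk : Suspension.mk α.arrow g (t + 1) = .mk α.arrow (α.arrow g) t := by
    rw [← Suspension.mk_apply g (t + 1), add_sub_cancel_right]
  have hpow (h : G) : d.ρ h ^ (-t / 2) = d.ρ h ^ (1 / 2 : ℝ) * d.ρ h ^ (-(t + 1) / 2) := by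
    rw [← Real.rpow_add (d.pos h)]
    congr 1
    ring
  change ((d.ρ (𝒢.inv (α.arrow g)) ^ (1 / 2 : ℝ) * d.ρ (α.arrow g) ^ (1 / 2 : ℝ) : ℝ) : ℂ) *
    d.hat f (t + 1) (α.arrow.symm (α.arrow g)) = _
  rw [α.arrow.symm_apply_apply, hat_apply, hat_apply, α.inv_arrow, hd, hd, hmk, hpow g,
    hpow (𝒢.inv g)]
  push_cast
  ring

end Hat

variable [T2Space G] [LocallyCompactSpace G] [SecondCountableTopology G] [BorelSpace G]

theorem continuous_toReduced_hat (f : C_c(Suspension α.arrow, ℂ)) :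
    Continuous fun t => lam.toReduced (d.hat f t) := by
  refine continuous_iff_continuousAt.2 fun t₀ => ?_
  obtain ⟨L, hL, hLf⟩ := Suspension.exists_isCompact_forall_notMem_eq_zero f t₀
  refine lam.continuousAt_toReduced (d.continuous_hat f) hL ?_
  filter_upwards [hLf] with t ht g hg
  rw [hat_apply, ht g hg, mul_zero]

variable (hd : ∀ g, d.ρ (α.arrow g) = d.ρ g)

/-- The inclusion `g ↦ [g, t]` of a slice in the suspension groupoid, with weight `ρ^{-t/2}` on the
units: the pull-back of functions along it is `f ↦ d.hat f t`. -/
def sliceHom (t : ℝ) : lam.WeightedHom (d.suspensionHaar hd) where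
  arrow g := .mk α.arrow g t
  base x := .mk α.base x t
  weight x := d.ρ (𝒢.unit x) ^ (-t / 2)
  continuous_arrow := Suspension.continuous_mk_left t
  isCompact_preimage _ hK := Suspension.isCompact_preimage_mk hK t
  continuous_weight := (d.continuous_ρ.comp 𝒢.continuous_unit).rpow_const
    fun _ => Or.inl (d.pos _).ne'
  weight_pos _ := Real.rpow_pos_of_pos (d.pos _) _
  r_arrow _ := rfl
  s_arrow _ := rfl
  arrow_mul _ _ hgh := (α.suspensionMul_mk hgh t).symm
  map_eq x := by
    have hweight (g : G) : (d.ρ (𝒢.unit (𝒢.s g)) ^ (-t / 2)) ^ 2 = d.ρ g ^ (-t) := by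
      rw [← d.ρ_eq_ρ_unit, ← Real.rpow_mul_natCast (d.pos g).le, Nat.cast_two,
        div_mul_cancel₀ _ two_ne_zero]
    simp only [hweight]
    rfl

theorem pull_sliceHom (f : C_c(Suspension α.arrow, ℂ)) (t : ℝ) :
    (d.sliceHom hd t).pull f = d.hat f t := by
  ext g
  rw [WeightedHom.pull_apply, hat_apply, d.ρ_inv, d.ρ_eq_ρ_unit g, mul_comm (d.ρ _ ^ _)]
  rfl

theorem injective_sliceHom (t : ℝ) : Function.Injective (d.sliceHom hd t).arrow :=
  fun _ _ h => α.mk_eq_mk h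

/-- The restriction of elements of the reduced `C^*`-algebra of the suspension to the slice at
`t`, given by `f ↦ d.hat f t` on functions. -/
def sliceRestrict (t : ℝ) : (d.suspensionHaar hd).Reduced →⋆ₙₐ[ℂ] lam.Reduced :=
  (d.sliceHom hd t).reducedHom (d.injective_sliceHom hd t)

theorem sliceRestrict_toReduced (t : ℝ) (f : C_c(Suspension α.arrow, ℂ)) :
    d.sliceRestrict hd t ((d.suspensionHaar hd).toReduced f) = lam.toReduced (d.hat f t) := by
  rw [← d.pull_sliceHom hd]
  exact (d.sliceHom hd t).reducedHom_toReduced _ f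

theorem isTwistedPeriodic_sliceRestrict (a : (d.suspensionHaar hd).Reduced) :
    IsTwistedPeriodic d.twistEquiv fun t => d.sliceRestrict hd t a := by
  intro t
  refine Reduced.hom_ext (Φ := (d.twistEquiv : lam.Reduced →⋆ₙₐ[ℂ] lam.Reduced).comp
    (d.sliceRestrict hd (t + 1))) (Ψ := d.sliceRestrict hd t) (fun f => ?_) a
  change d.twistEquiv (d.sliceRestrict hd (t + 1) _) = _
  rw [sliceRestrict_toReduced, sliceRestrict_toReduced, twistEquiv_toReduced, d.twist_hat f t hd]

theorem continuous_sliceRestrict (a : (d.suspensionHaar hd).Reduced) :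
    Continuous fun t => d.sliceRestrict hd t a := by
  refine continuous_of_uniform_approx_of_continuous fun u hu => ?_
  obtain ⟨ε, hε, hεu⟩ := Metric.mem_uniformity_dist.1 hu
  obtain ⟨f, hf⟩ := (d.suspensionHaar hd).denseRange_toReduced.exists_dist_lt a hε
  refine ⟨_, d.continuous_toReduced_hat f, fun t => hεu ?_⟩
  rw [← d.sliceRestrict_toReduced hd, dist_eq_norm, ← map_sub]
  exact (NonUnitalStarAlgHom.norm_apply_le _ _).trans_lt (by rwa [← dist_eq_norm])

/-! ### The reduced algebra of the suspension as a mapping torus -/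

/-- The continuous function on `[0, 1]` formed by the restrictions of an element of the reduced
`C^*`-algebra of the suspension groupoid to the slices. -/
def sliceFunction : (d.suspensionHaar hd).Reduced →⋆ₙₐ[ℂ] C(unitInterval, lam.Reduced) where
  toFun a := ⟨fun t => d.sliceRestrict hd t a,
    (d.continuous_sliceRestrict hd a).comp continuous_subtype_val⟩
  map_smul' c a := ContinuousMap.ext fun t => map_smul (d.sliceRestrict hd t) c a
  map_zero' := ContinuousMap.ext fun t => map_zero (d.sliceRestrict hd t)
  map_add' a b := ContinuousMap.ext fun t => map_add (d.sliceRestrict hd t) a b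
  map_mul' a b := ContinuousMap.ext fun t => map_mul (d.sliceRestrict hd t) a b
  map_star' a := ContinuousMap.ext fun t => map_star (d.sliceRestrict hd t) a

theorem isometry_sliceFunction : Isometry (d.sliceFunction hd) := by
  have hle (a) : ‖d.sliceFunction hd a‖ ≤ ‖a‖ := NonUnitalStarAlgHom.norm_apply_le _ a
  have hcont : Continuous (d.sliceFunction hd) :=
    AddMonoidHomClass.continuous_of_bound _ 1 fun a => (hle a).trans_eq (one_mul _).symm
  refine AddMonoidHomClass.isometry_of_norm _ fun a => le_antisymm (hle a) ?_
  refine (d.suspensionHaar hd).denseRange_toReduced.induction_on (p := fun a =>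
    ‖a‖ ≤ ‖d.sliceFunction hd a‖) a (isClosed_le continuous_norm hcont.norm) fun f => ?_
  refine WeightedHom.norm_toReduced_le_of_forall_pull (P := fun t : unitInterval => d.sliceHom hd t)
    Suspension.exists_unitInterval_mk_eq (norm_nonneg _) fun t => ?_
  rw [pull_sliceHom, ← d.sliceRestrict_toReduced hd]
  exact (d.sliceFunction hd ((d.suspensionHaar hd).toReduced f)).norm_coe_le_norm t

theorem sliceFunction_mem_mappingTorus (a : (d.suspensionHaar hd).Reduced) :
    d.sliceFunction hd a ∈ mappingTorus d.twistEquiv := by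
  have h := d.isTwistedPeriodic_sliceRestrict hd a 0
  rwa [zero_add] at h

/-- The homomorphism from the reduced `C^*`-algebra of the suspension groupoid to the mapping torus
given by restriction to the slices. -/
def toMappingTorus : (d.suspensionHaar hd).Reduced →⋆ₙₐ[ℂ] mappingTorus d.twistEquiv :=
  NonUnitalStarAlgHom.codRestrict (d.sliceFunction hd) (mappingTorus d.twistEquiv)
    (d.sliceFunction_mem_mappingTorus hd)

theorem isometry_toMappingTorus : Isometry (d.toMappingTorus hd) :=
  d.isometry_sliceFunction hd

include hd in
theorem exists_norm_hat_sub_mappingTorusExtend_le (h : mappingTorus d.twistEquiv) {ε : ℝ}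
    (hε : 0 < ε) : ∃ f : C_c(Suspension α.arrow, ℂ),
      ∀ u, ‖lam.toReduced (d.hat f u) - mappingTorusExtend h u‖ ≤ ε := by
  let hatₗ : C_c(Suspension α.arrow, ℂ) →ₗ[ℂ] ℝ → lam.Reduced :=
    LinearMap.pi fun u => lam.toReducedₗ ∘ₗ (d.sliceHom hd u).pull
  have hhat (f) : hatₗ f = fun u => lam.toReduced (d.hat f u) :=
    funext fun u => congrArg lam.toReduced (d.pull_sliceHom hd f u)
  have hper (f) : Function.Periodic (fun u => ‖hatₗ f u - mappingTorusExtend h u‖) 1 := by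
    rw [hhat]
    simp only [← d.sliceRestrict_toReduced hd]
    exact ((d.isTwistedPeriodic_sliceRestrict hd _).sub
      (isTwistedPeriodic_mappingTorusExtend h)).periodic_norm
  have hsmul (k : C(AddCircle (1 : ℝ), ℝ)) : ∀ F ∈ hatₗ.range.toAddSubmonoid,
      (fun u : ℝ => k u • F u) ∈ hatₗ.range.toAddSubmonoid := by
    rintro _ ⟨f, rfl⟩
    refine ⟨Suspension.mulCircle k f, funext fun u => ?_⟩
    simp only [hhat, hat_mulCircle, toReduced_smul, Complex.coe_smul]
  have hcont : ∀ F ∈ hatₗ.range.toAddSubmonoid,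
      Continuous fun u => ‖F u - mappingTorusExtend h u‖ := by
    rintro _ ⟨f, rfl⟩
    rw [hhat]
    exact ((d.continuous_toReduced_hat f).sub (continuous_mappingTorusExtend h)).norm
  have hfib : ∀ F ∈ hatₗ.range.toAddSubmonoid, ∀ u v : ℝ, (u : AddCircle (1 : ℝ)) = v →
      ‖F u - mappingTorusExtend h u‖ = ‖F v - mappingTorusExtend h v‖ := by
    rintro _ ⟨f, rfl⟩ u v huv
    exact ((hper f).lift_coe u).symm.trans ((congrArg _ huv).trans ((hper f).lift_coe v))
  have hslice (u : ℝ) : ∃ F ∈ hatₗ.range.toAddSubmonoid, ‖F u - mappingTorusExtend h u‖ < ε := by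
    obtain ⟨ψ, hψ⟩ := lam.denseRange_toReduced.exists_dist_lt (mappingTorusExtend h u) hε
    obtain ⟨f, rfl⟩ := (d.sliceHom hd u).pull_surjective (d.injective_sliceHom hd u) ψ
    exact ⟨hatₗ f, ⟨f, rfl⟩, by rwa [dist_comm, dist_eq_norm] at hψ⟩
  obtain ⟨_, ⟨f, rfl⟩, hf⟩ := exists_mem_forall_norm_sub_le_of_isOpenQuotientMap
    (QuotientAddGroup.isOpenQuotientMap_mk (N := AddSubgroup.zmultiples (1 : ℝ)))
    hsmul hcont hfib hslice
  exact ⟨f, fun u => by simpa only [hhat] using hf u⟩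

theorem denseRange_toMappingTorus : DenseRange (d.toMappingTorus hd) := by
  refine Metric.denseRange_iff.2 fun h ε hε => ?_
  obtain ⟨f, hf⟩ := d.exists_norm_hat_sub_mappingTorusExtend_le hd h (half_pos hε)
  refine ⟨(d.suspensionHaar hd).toReduced f, lt_of_le_of_lt ?_ (half_lt_self hε)⟩
  rw [dist_comm, dist_eq_norm]
  refine (ContinuousMap.norm_le _ (half_pos hε).le).2 fun t => ?_
  have ht := hf t
  rwa [mappingTorusExtend_coe, ← d.sliceRestrict_toReduced hd] at ht

/-- The isomorphism of the reduced `C^*`-algebra of the suspension groupoid with the mapping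
torus. -/
def mappingTorusEquiv : (d.suspensionHaar hd).Reduced ≃⋆ₐ[ℂ] mappingTorus d.twistEquiv :=
  StarAlgEquiv.ofBijective (d.toMappingTorus hd) ⟨(d.isometry_toMappingTorus hd).injective,
    surjective_of_isometry_of_denseRange (d.isometry_toMappingTorus hd)
      (d.denseRange_toMappingTorus hd)⟩

theorem mappingTorusEquiv_apply (a : (d.suspensionHaar hd).Reduced) (t : unitInterval) :
    (d.mappingTorusEquiv hd a).1 t = d.sliceRestrict hd t a := rfl

theorem mappingTorusEquiv_toReduced (f : C_c(Suspension α.arrow, ℂ)) (t : unitInterval) :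
    (d.mappingTorusEquiv hd ((d.suspensionHaar hd).toReduced f)).1 t =
      lam.toReduced (d.hat f t) :=
  d.sliceRestrict_toReduced hd t f

theorem eq_mappingTorusEquiv {Φ : (d.suspensionHaar hd).Reduced ≃⋆ₐ[ℂ] mappingTorus d.twistEquiv}
    (hΦ : ∀ (f : C_c(Suspension α.arrow, ℂ)) (t : unitInterval),
      (Φ ((d.suspensionHaar hd).toReduced f)).1 t = lam.toReduced (d.hat f t)) :
    Φ = d.mappingTorusEquiv hd := by
  refine StarAlgEquiv.ext fun a => Subtype.ext ?_
  refine Reduced.hom_ext (Φ := (NonUnitalStarSubalgebraClass.subtype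
      (mappingTorus d.twistEquiv)).comp (Φ : _ →⋆ₙₐ[ℂ] mappingTorus d.twistEquiv))
    (Ψ := d.sliceFunction hd) (fun f => ContinuousMap.ext fun t => ?_) a
  exact (hΦ f t).trans (d.sliceRestrict_toReduced hd t f).symm

theorem mappingTorusExtend_mappingTorusEquiv (a : (d.suspensionHaar hd).Reduced) (u : ℝ) :
    mappingTorusExtend (d.mappingTorusEquiv hd a) u = d.sliceRestrict hd u a :=
  (d.isTwistedPeriodic_sliceRestrict hd a).mappingTorusExtend_eq
    (d.mappingTorusEquiv_apply hd a) u

theorem eq_of_forall_sliceRestrict_eq {a b : (d.suspensionHaar hd).Reduced}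
    (h : ∀ t, d.sliceRestrict hd t a = d.sliceRestrict hd t b) : a = b :=
  (d.mappingTorusEquiv hd).injective (Subtype.ext (ContinuousMap.ext fun t => h t))

/-! ### The flow on the suspension -/

/-- The function `[γ, t] ↦ ρ(γ)^s` on the suspension. -/
def flowρ (s : ℝ) : Suspension α.arrow → ℝ :=
  Suspension.lift (fun g _ => d.ρ g ^ s) fun g _ => by rw [hd]

omit [T2Space G] [LocallyCompactSpace G] [SecondCountableTopology G] [BorelSpace G] in
theorem continuous_flowρ (s : ℝ) : Continuous (d.flowρ hd s) :=
  Suspension.continuous_lift _ ((d.continuous_rpow continuous_id s).comp continuous_fst)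

omit [T2Space G] [LocallyCompactSpace G] [SecondCountableTopology G] in
theorem map_flow_suspensionMeas (x : X) (t s : ℝ) :
    (d.suspensionMeas x t).map (Suspension.flow α.arrow s) =
      (d.suspensionMeas x (t + s)).withDensity fun q => ENNReal.ofReal (d.flowρ hd s q) := by
  have hmul : ((fun g => ENNReal.ofReal (d.ρ g ^ (-(t + s)))) *
      fun g => ENNReal.ofReal (d.ρ g ^ s)) = fun g => ENNReal.ofReal (d.ρ g ^ (-t)) := by
    funext g
    rw [Pi.mul_apply, ← ENNReal.ofReal_mul (Real.rpow_pos_of_pos (d.pos g) _).le,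
      ← Real.rpow_add (d.pos g), neg_add_rev, neg_add_cancel_comm]
  rw [suspensionMeas, Measure.map_map (Suspension.flow α.arrow s).continuous.measurable
    (Suspension.continuous_mk_left _).measurable, suspensionMeas, ← map_withDensity_comp _
    (Suspension.continuous_mk_left _).aemeasurable
    (d.continuous_flowρ hd s).measurable.ennreal_ofReal, ← hmul,
    withDensity_mul _ (d.measurable_ofReal_rpow _) (d.measurable_ofReal_rpow s)]
  rfl

/-- The flow on the suspension preserves the Haar system with density `[γ, t] ↦ ρ(γ)^s`. -/
def flowDensity (s : ℝ) : (d.suspensionHaar hd).Density (α.suspensionFlow s) where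
  ρ := d.flowρ hd s
  continuous_ρ := d.continuous_flowρ hd s
  pos := Suspension.ind fun g _ => Real.rpow_pos_of_pos (d.pos g) s
  map_eq := Suspension.ind fun x t => d.map_flow_suspensionMeas hd x t s

theorem flow_twist_mk (s : ℝ) (f : C_c(Suspension α.arrow, ℂ)) (g : G) (t : ℝ) :
    (d.flowDensity hd s).twist f (.mk α.arrow g t) =
      ((d.ρ (𝒢.inv g) ^ (s / 2) * d.ρ g ^ (s / 2) : ℝ) : ℂ) * f (.mk α.arrow g (t - s)) := by
  have hsqrt (g : G) : (d.ρ g ^ s) ^ (1 / 2 : ℝ) = d.ρ g ^ (s / 2) := by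
    rw [← Real.rpow_mul (d.pos g).le, mul_one_div]
  rw [← hsqrt, ← hsqrt]
  rfl

theorem hat_flow_twist (s : ℝ) (f : C_c(Suspension α.arrow, ℂ)) (t : ℝ) :
    d.hat ((d.flowDensity hd s).twist f) t = d.hat f (t - s) := by
  ext g
  have hexp : -(t - s) / 2 = -t / 2 + s / 2 := by ring
  rw [hat_apply, hat_apply, flow_twist_mk, hexp, Real.rpow_add (d.pos _), Real.rpow_add (d.pos _)]
  push_cast
  ring

theorem sliceRestrict_flow_twistEquiv (s t : ℝ) (a : (d.suspensionHaar hd).Reduced) :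
    d.sliceRestrict hd t ((d.flowDensity hd s).twistEquiv a) = d.sliceRestrict hd (t - s) a := by
  refine Reduced.hom_ext (Φ := (d.sliceRestrict hd t).comp
    ((d.flowDensity hd s).twistEquiv : (d.suspensionHaar hd).Reduced →⋆ₙₐ[ℂ] _))
    (Ψ := d.sliceRestrict hd (t - s)) (fun f => ?_) a
  change d.sliceRestrict hd t ((d.flowDensity hd s).twistEquiv _) = _
  rw [twistEquiv_toReduced, sliceRestrict_toReduced, sliceRestrict_toReduced, hat_flow_twist]

/-- The action of `ℝ` on the reduced `C^*`-algebra of the suspension groupoid induced by the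
flow. -/
def flowAction : Multiplicative ℝ →*
    ((d.suspensionHaar hd).Reduced ≃⋆ₐ[ℂ] (d.suspensionHaar hd).Reduced) where
  toFun s := (d.flowDensity hd s.toAdd).twistEquiv
  map_one' := StarAlgEquiv.ext fun a => d.eq_of_forall_sliceRestrict_eq hd fun t => by
    rw [sliceRestrict_flow_twistEquiv, toAdd_one, sub_zero, StarAlgEquiv.one_apply]
  map_mul' s s' := StarAlgEquiv.ext fun a => d.eq_of_forall_sliceRestrict_eq hd fun t => by
    rw [StarAlgEquiv.mul_apply, sliceRestrict_flow_twistEquiv, sliceRestrict_flow_twistEquiv,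
      sliceRestrict_flow_twistEquiv, toAdd_mul, sub_sub]

theorem flowAction_toReduced (s : ℝ) (f : C_c(Suspension α.arrow, ℂ)) :
    d.flowAction hd (.ofAdd s) ((d.suspensionHaar hd).toReduced f) =
      (d.suspensionHaar hd).toReduced ((d.flowDensity hd s).twist f) :=
  (d.flowDensity hd s).twistEquiv_toReduced f

theorem mappingTorusEquiv_flowAction (s : ℝ) (a : (d.suspensionHaar hd).Reduced)
    (t : unitInterval) : (d.mappingTorusEquiv hd (d.flowAction hd (.ofAdd s) a)).1 t =
      mappingTorusExtend (d.mappingTorusEquiv hd a) (t - s) := by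
  rw [mappingTorusExtend_mappingTorusEquiv]
  exact d.sliceRestrict_flow_twistEquiv hd s t a

theorem continuous_flowAction (a : (d.suspensionHaar hd).Reduced) :
    Continuous fun s : ℝ => d.flowAction hd (.ofAdd s) a :=
  (d.isometry_toMappingTorus hd).isEmbedding.continuous_iff.2
    (continuous_of_eq_mappingTorusExtend_sub fun s t => d.mappingTorusEquiv_flowAction hd s a t)

end Density

end HaarSystem

end TopGroupoid

end

theorem mainTheorem6 {G X : Type*} [TopologicalSpace G] [TopologicalSpace X]
    [T2Space G] [LocallyCompactSpace G] [SecondCountableTopology G]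
    [MeasurableSpace G] [BorelSpace G]
    (𝒢 : TopGroupoid G X) (lam : 𝒢.HaarSystem) (α : 𝒢.Aut) (d : lam.Density α)
    (hd : ∀ g, d.ρ (α.arrow g) = d.ρ g) :
    -- the Haar system of the suspension groupoid
    ∃ lamα : α.suspension.HaarSystem,
      (∀ (x : X) (t : ℝ), lamα.meas (.mk α.base x t) =
        ((lam.meas x).withDensity fun g => ENNReal.ofReal (d.ρ g ^ (-t))).map
          fun g => .mk α.arrow g t) ∧
    -- the automorphism of `C^*_r(G, λ)` induced by `α`
    ∃ αt : lam.Reduced ≃⋆ₐ[ℂ] lam.Reduced,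
      (∀ f : C_c(G, ℂ), αt (lam.toReduced f) = lam.toReduced (d.twist f)) ∧
      (∀ αt' : lam.Reduced ≃⋆ₐ[ℂ] lam.Reduced,
        (∀ f : C_c(G, ℂ), αt' (lam.toReduced f) = lam.toReduced (d.twist f)) → αt' = αt) ∧
    -- the isomorphism with the mapping torus
    ∃ Λ : lamα.Reduced ≃⋆ₐ[ℂ] mappingTorus αt,
      (∀ (f : C_c(Suspension α.arrow, ℂ)) (t : unitInterval),
        (Λ (lamα.toReduced f)).1 t = lam.toReduced (d.hat f t)) ∧
      (∀ Λ' : lamα.Reduced ≃⋆ₐ[ℂ] mappingTorus αt,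
        (∀ (f : C_c(Suspension α.arrow, ℂ)) (t : unitInterval),
          (Λ' (lamα.toReduced f)).1 t = lam.toReduced (d.hat f t)) → Λ' = Λ) ∧
    -- the action of `ℝ` induced by the flow on the suspension groupoid
    ∃ δ : (s : ℝ) → lamα.Density (α.suspensionFlow s),
      (∀ (s : ℝ) (g : G) (t : ℝ), (δ s).ρ (.mk α.arrow g t) = d.ρ g ^ s) ∧
    ∃ θ : Multiplicative ℝ →* (lamα.Reduced ≃⋆ₐ[ℂ] lamα.Reduced),
      (∀ (s : ℝ) (f : C_c(Suspension α.arrow, ℂ)),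
        θ (.ofAdd s) (lamα.toReduced f) = lamα.toReduced ((δ s).twist f)) ∧
      (∀ a : lamα.Reduced, Continuous fun s : ℝ => θ (.ofAdd s) a) ∧
    -- the isomorphism is equivariant for the translation action on the mapping torus
      ∀ (s : ℝ) (a : lamα.Reduced) (t : unitInterval),
        (Λ (θ (.ofAdd s) a)).1 t = mappingTorusExtend (Λ a) ((t : ℝ) - s) := by
  refine ⟨d.suspensionHaar hd, fun _ _ => rfl, d.twistEquiv, d.twistEquiv_toReduced,
    fun αt' hαt' => ?_, d.mappingTorusEquiv hd, d.mappingTorusEquiv_toReduced hd,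
    fun _ hΛ' => d.eq_mappingTorusEquiv hd hΛ', d.flowDensity hd, fun _ _ _ => rfl,
    d.flowAction hd, d.flowAction_toReduced hd, d.continuous_flowAction hd,
    d.mappingTorusEquiv_flowAction hd⟩
  exact StarAlgEquiv.ext (TopGroupoid.HaarSystem.Reduced.hom_ext fun f =>
    (hαt' f).trans (d.twistEquiv_toReduced f).symm)
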